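/- Let $K=\mathbb{C}\{x\}[x^{-1}]$ be the field of convergent Laurent series, and let $M$ be a germ of meromorphic connection: a finite-dimensional $K$-vector space with a connection $\nabla$, on which $x\partial_x$ acts by $\nabla_{x\partial_x}$. **The Deligne filtration.** The filtration $V^\bullet M$ is the decreasing, exhaustive filtration of $M$, indexed by $b\in\mathbb{R}$ and left-continuous ($V^bM=\bigcap_{c<b}V^cM$), such that each $V^bM$ is a finitely generated $\mathbb{C}\{x\}\langle x\partial_x\rangle$-submodule, $xV^bM=V^{b+1}M$, and each $\mathrm{gr}^b_VM=V^bM/\bigcup_{c>b}V^cM$ is a finite-dimensional $\mathbb{C}$-vector space on which all eigenvalues of $x\partial_x$ have real part $b$. **The parabolic filtration.** Let $q\geq1$, let $\pi:y\mapsto x=y^q$, let $N=\pi^+M=\mathbb{C}\{y\}[y^{-1}]\otimes_KM$ be the pulled-back connection, and let $\widehat N=\mathbb{C}((y))\otimes_{\mathbb{C}\{y\}[y^{-1}]}N$. Suppose that there is an isomorphism of connections $\widehat N\simeq\bigoplus_{\varphi\in\Phi}(E^\varphi\otimes R_\varphi)$ over $\mathbb{C}((y))$, where $\Phi\subset y^{-1}\mathbb{C}[y^{-1}]$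 is finite, $E^\varphi$ is the rank-one connection with a generator $e^\varphi$ such that $\nabla e^\varphi=d\varphi\otimes e^\varphi$, and each $R_\varphi$ is a formal connection with regular singularity. Let $V^bR_\varphi$ be the unique $\mathbb{C}[[y]]$-lattice of $R_\varphi$ that is stable under $y\partial_y$ and such that the eigenvalues of $y\partial_y$ on $V^bR_\varphi/yV^bR_\varphi$ have real part in $[b,b+1)$. Put $$\mathcal P^b(\widehat N)=\bigoplus_{\varphi\in\Phi}E^\varphi\otimes V^bR_\varphi,\qquad \mathcal P^b(N)=\mathcal P^b(\widehat N)\cap N,\qquad \mathcal P^b(M)=\mathcal P^{qb}(N)^{\mathbb{Z}/q\mathbb{Z}},$$ where the $q$-th roots of unity $\zeta$ act on $N$ by $g(y)\otimes m\mapsto g(\zeta y)\otimes m$, and $M$ is identified with the invariants of $N$ through $m\mapsto1\otimes m$. **Statement.** The filtration $V^\bullet M$ exists and is unique, and for every $b\in\mathbb{R}$ the $\mathbb{C}\{x\}\langle x\partial_x\rangle$-submodule of $M$ generated by $\mathcal P^b(M)$ is $V^b(M)$: $$\mathbb{C}\{x\}\langle x\partial_x\rangle\cdot\mathcal P^b(M)=V^b(M).$$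 -/

import Mathlib

open scoped LaurentSeries PowerSeries TensorProduct

/- `ℂ((x))` carries two `ℂ`-algebra structures in the library, with provably but not definitionally
equal scalar actions; only the coefficientwise one is kept. -/
attribute [-instance] HahnSeries.powerSeriesAlgebra

noncomputable section

namespace MeroConn

/-! ### Convergent Laurent series -/

/-- A formal Laurent series converges on some punctured disc around `0`: its coefficients grow at
most geometrically (there are only finitely many coefficients of negative index). -/
def IsConvergent (f : ℂ⸨X⸩) : Prop :=
  ∃ C A : ℝ, ∀ n : ℕ, ‖f.coeff (n : ℤ)‖ ≤ C * A ^ n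

theorem IsConvergent.shift {f : ℂ⸨X⸩} (hf : IsConvergent f) (N : ℤ) :
    ∃ C A : ℝ, 0 ≤ C ∧ 1 ≤ A ∧ ∀ n : ℕ, ‖f.coeff ((n : ℤ) + N)‖ ≤ C * A ^ n := by
  obtain ⟨C, A, h⟩ := hf
  have h' : ∀ n : ℕ, ‖f.coeff (n : ℤ)‖ ≤ |C| * (max 1 |A|) ^ n := fun n => by
    refine (h n).trans ((le_abs_self _).trans ?_)
    rw [abs_mul, abs_pow]
    gcongr
    exact le_max_right _ _
  have hA : (1 : ℝ) ≤ max 1 |A| := le_max_left _ _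
  set B := max 1 |A| with hB
  rcases le_total 0 N with hN | hN
  · obtain ⟨k, rfl⟩ := Int.eq_ofNat_of_zero_le hN
    refine ⟨|C| * B ^ k, B, by positivity, hA, fun n => ?_⟩
    have := h' (n + k)
    push_cast at this
    refine this.trans (le_of_eq ?_)
    ring
  · obtain ⟨k, rfl⟩ := Int.exists_eq_neg_ofNat hN
    have hs : 0 ≤ ∑ i ∈ Finset.range k, ‖f.coeff ((i : ℤ) + -(k : ℤ))‖ :=
      Finset.sum_nonneg fun _ _ => norm_nonneg _
    refine ⟨|C| + ∑ i ∈ Finset.range k, ‖f.coeff ((i : ℤ) + -(k : ℤ))‖, B, by positivity, hA,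
      fun n => ?_⟩
    have hBn : 1 ≤ B ^ n := one_le_pow₀ hA
    rcases lt_or_ge n k with hnk | hnk
    · have h1 := Finset.single_le_sum
        (f := fun i : ℕ => ‖f.coeff ((i : ℤ) + -(k : ℤ))‖) (fun _ _ => norm_nonneg _)
        (Finset.mem_range.2 hnk)
      nlinarith [abs_nonneg C]
    · obtain ⟨j, rfl⟩ := Nat.exists_eq_add_of_le hnk
      have h1 := h' j
      have h2 : ((k + j : ℕ) : ℤ) + -(k : ℤ) = j := by push_cast; ring
      rw [h2]
      have h3 : B ^ j ≤ B ^ (k + j) := pow_le_pow_right₀ hA (by omega)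
      have h4 := mul_le_mul_of_nonneg_left h3 (abs_nonneg C)
      nlinarith

theorem isConvergent_single_mul {f : ℂ⸨X⸩} (hf : IsConvergent f) (k : ℤ) :
    IsConvergent (HahnSeries.single k 1 * f) := by
  obtain ⟨C, A, -, -, h⟩ := hf.shift (-k)
  refine ⟨C, A, fun n => ?_⟩
  have := h n
  rwa [HahnSeries.coeff_single_mul, one_mul, sub_eq_add_neg]

theorem IsConvergent.exists_powerSeries {f : ℂ⸨X⸩} (hf : IsConvergent f) :
    ∃ C A : ℝ, 0 ≤ C ∧ 1 ≤ A ∧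
      ∀ n : ℕ, ‖PowerSeries.coeff n f.powerSeriesPart‖ ≤ C * A ^ n := by
  obtain ⟨C, A, hC, hA, h⟩ := hf.shift f.order
  refine ⟨C, A, hC, hA, fun n => ?_⟩
  rw [LaurentSeries.powerSeriesPart_coeff, add_comm]
  exact h n

theorem isConvergent_coe {p : ℂ⟦X⟧} {C A : ℝ} (h : ∀ n : ℕ, ‖PowerSeries.coeff n p‖ ≤ C * A ^ n) :
    IsConvergent (p : ℂ⸨X⸩) :=
  ⟨C, A, fun n => by rw [LaurentSeries.coeff_coe_powerSeries]; exact h n⟩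

theorem IsConvergent.mul {f g : ℂ⸨X⸩} (hf : IsConvergent f) (hg : IsConvergent g) :
    IsConvergent (f * g) := by
  obtain ⟨C, A, hC, hA, h⟩ := hf.exists_powerSeries
  obtain ⟨D, B, hD, hB, h'⟩ := hg.exists_powerSeries
  rw [← LaurentSeries.single_order_mul_powerSeriesPart f,
    ← LaurentSeries.single_order_mul_powerSeriesPart g, mul_mul_mul_comm, mul_assoc]
  refine isConvergent_single_mul (isConvergent_single_mul ?_ _) _
  rw [← PowerSeries.coe_mul]
  refine isConvergent_coe (C := C * D) (A := 2 * (A * B)) fun n => ?_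
  rw [PowerSeries.coeff_mul]
  have hAB : ∀ i ∈ Finset.HasAntidiagonal.antidiagonal n,
      ‖PowerSeries.coeff i.1 f.powerSeriesPart * PowerSeries.coeff i.2 g.powerSeriesPart‖
        ≤ C * D * (A * B) ^ n := by
    rintro ⟨i, j⟩ hij
    rw [Finset.HasAntidiagonal.mem_antidiagonal] at hij
    simp only at hij ⊢
    rw [norm_mul]
    have h1 : A ^ i ≤ A ^ n := pow_le_pow_right₀ hA (by omega)
    have h2 : B ^ j ≤ B ^ n := pow_le_pow_right₀ hB (by omega)
    calc _ ≤ (C * A ^ n) * (D * B ^ n) := by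
          refine mul_le_mul ((h i).trans ?_) ((h' j).trans ?_) (norm_nonneg _) (by positivity)
          · gcongr
          · gcongr
      _ = _ := by rw [mul_pow]; ring
  refine (norm_sum_le_of_le _ hAB).trans ?_
  rw [Finset.sum_const, Finset.Nat.card_antidiagonal, nsmul_eq_mul]
  have h2 : ((n + 1 : ℕ) : ℝ) ≤ 2 ^ n := by
    exact_mod_cast Nat.lt_two_pow_self
  calc _ ≤ (2 : ℝ) ^ n * (C * D * (A * B) ^ n) := by gcongr
    _ = _ := by rw [mul_pow 2]; ring

theorem IsConvergent.add {f g : ℂ⸨X⸩} (hf : IsConvergent f) (hg : IsConvergent g) :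
    IsConvergent (f + g) := by
  obtain ⟨C, A, hC, hA, h⟩ := hf.shift 0
  obtain ⟨D, B, hD, hB, h'⟩ := hg.shift 0
  refine ⟨C + D, A * B, fun n => ?_⟩
  have h1 := h n
  have h2 := h' n
  rw [add_zero] at h1 h2
  rw [HahnSeries.coeff_add, mul_pow]
  refine (norm_add_le _ _).trans ?_
  have hAn : 1 ≤ A ^ n := one_le_pow₀ hA
  have hBn : 1 ≤ B ^ n := one_le_pow₀ hB
  have e1 : A ^ n ≤ A ^ n * B ^ n := le_mul_of_one_le_right (by positivity) hBn
  have e2 : B ^ n ≤ A ^ n * B ^ n := le_mul_of_one_le_left (by positivity) hAn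
  have e3 := mul_le_mul_of_nonneg_left e1 hC
  have e4 := mul_le_mul_of_nonneg_left e2 hD
  nlinarith

theorem isConvergent_C (c : ℂ) : IsConvergent (HahnSeries.C c : ℂ⸨X⸩) := by
  refine ⟨‖c‖, 1, fun n => ?_⟩
  rw [HahnSeries.C_apply, HahnSeries.coeff_single]
  split_ifs <;> simp

theorem IsConvergent.inv {f : ℂ⸨X⸩} (hf : IsConvergent f) : IsConvergent f⁻¹ := by
  rcases eq_or_ne f 0 with rfl | hf0
  · simpa using hf
  obtain ⟨C, A, hC, hA, h⟩ := hf.exists_powerSeries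
  set p := f.powerSeriesPart with hp
  have hfp : HahnSeries.single f.order 1 * (p : ℂ⸨X⸩) = f :=
    LaurentSeries.single_order_mul_powerSeriesPart f
  have hc : PowerSeries.constantCoeff p ≠ 0 := by
    rw [← PowerSeries.coeff_zero_eq_constantCoeff_apply, hp, LaurentSeries.powerSeriesPart_coeff]
    simpa using HahnSeries.coeff_order_eq_zero.not.2 hf0
  have hinv : f⁻¹ = HahnSeries.single (-f.order) 1 * ((p⁻¹ : ℂ⟦X⟧) : ℂ⸨X⸩) := by
    refine inv_eq_of_mul_eq_one_right ?_
    calc f * _ = HahnSeries.single f.order 1 * (p : ℂ⸨X⸩) *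
          (HahnSeries.single (-f.order) 1 * ((p⁻¹ : ℂ⟦X⟧) : ℂ⸨X⸩)) := by rw [hfp]
      _ = 1 := by
        rw [mul_mul_mul_comm, ← PowerSeries.coe_mul, PowerSeries.mul_inv_cancel _ hc,
          HahnSeries.single_mul_single]
        simp
  rw [hinv]
  refine isConvergent_single_mul ?_ _
  set a := PowerSeries.constantCoeff p with ha
  have han : 0 < ‖a‖ := norm_pos_iff.2 hc
  set B : ℝ := A * max 1 (C / ‖a‖) with hB
  have hBpos : 0 < B := by positivity
  have hbd : ∀ k : ℕ, k ≠ 0 → ‖a‖⁻¹ * ‖PowerSeries.coeff k p‖ ≤ B ^ k := fun k hk => by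
    have h1 : C / ‖a‖ ≤ (max 1 (C / ‖a‖)) ^ k :=
      (le_max_right _ _).trans (le_self_pow₀ (le_max_left _ _) hk)
    calc ‖a‖⁻¹ * ‖PowerSeries.coeff k p‖ ≤ ‖a‖⁻¹ * (C * A ^ k) := by
          gcongr
          exact h k
      _ = A ^ k * (C / ‖a‖) := by ring
      _ ≤ A ^ k * (max 1 (C / ‖a‖)) ^ k := by gcongr
      _ = _ := by rw [hB, mul_pow]
  refine isConvergent_coe (C := ‖a‖⁻¹) (A := 2 * B) fun n => ?_
  induction n using Nat.strong_induction_on with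
  | _ n ih =>
    rw [PowerSeries.coeff_inv]
    split_ifs with hn
    · subst hn
      simp [← ha]
    · rw [← ha, norm_mul, norm_neg, norm_inv]
      refine mul_le_mul_of_nonneg_left ?_ (by positivity)
      have hterm : ∀ x ∈ Finset.HasAntidiagonal.antidiagonal n,
          ‖if x.2 < n then PowerSeries.coeff x.1 p * PowerSeries.coeff x.2 p⁻¹ else 0‖ ≤
            B ^ n * (if x.2 < n then (2 : ℝ) ^ x.2 else 0) := by
        rintro ⟨i, j⟩ hij
        rw [Finset.HasAntidiagonal.mem_antidiagonal] at hij
        simp only at hij ⊢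
        split_ifs with hj
        · rw [norm_mul]
          have h1 := ih j hj
          have h2 := hbd i (by omega)
          calc ‖PowerSeries.coeff i p‖ * ‖PowerSeries.coeff j p⁻¹‖
              ≤ ‖PowerSeries.coeff i p‖ * (‖a‖⁻¹ * (2 * B) ^ j) := by gcongr
            _ = (‖a‖⁻¹ * ‖PowerSeries.coeff i p‖) * (2 * B) ^ j := by ring
            _ ≤ B ^ i * (2 * B) ^ j := by gcongr
            _ = B ^ n * 2 ^ j := by rw [← hij, mul_pow, pow_add]; ring
        · simp
      refine (norm_sum_le_of_le _ hterm).trans ?_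
      rw [← Finset.mul_sum, mul_pow 2 B, mul_comm (2 ^ n)]
      have h3 : ∀ k ∈ Finset.range n, (if n - (k + 1) < n then (2 : ℝ) ^ (n - (k + 1)) else 0) =
          2 ^ (n - 1 - k) := by
        intro k hk
        rw [if_pos (by have := Finset.mem_range.1 hk; omega), Nat.sub_sub, add_comm]
      have h4 : ∑ x ∈ Finset.HasAntidiagonal.antidiagonal n,
          (if x.2 < n then (2 : ℝ) ^ x.2 else 0) ≤ 2 ^ n := by
        rw [Finset.Nat.sum_antidiagonal_eq_sum_range_succ_mk, Finset.sum_range_succ',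
          Finset.sum_congr rfl h3, Finset.sum_range_reflect (fun j => (2 : ℝ) ^ j) n,
          geom_sum_eq (by norm_num)]
        simp only [Nat.sub_zero, lt_irrefl, if_false]
        norm_num
      exact mul_le_mul_of_nonneg_left h4 (by positivity)

/-- The field `ℂ{x}[1/x]` of convergent Laurent series, as a subfield of `ℂ((x))`. -/
def ConvLaurent : IntermediateField ℂ ℂ⸨X⸩ where
  carrier := {f | IsConvergent f}
  mul_mem' := IsConvergent.mul
  add_mem' := IsConvergent.add
  algebraMap_mem' c := by
    have : algebraMap ℂ ℂ⸨X⸩ c = HahnSeries.C c := rfl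
    rw [this]
    exact isConvergent_C c
  inv_mem' _ := IsConvergent.inv

theorem mem_convLaurent {f : ℂ⸨X⸩} : f ∈ ConvLaurent ↔ IsConvergent f := Iff.rfl

/-- The ring `ℂ{x}` of convergent power series, as a subring of `ℂ{x}[1/x]`. -/
def ConvPower : Subring ConvLaurent :=
  (LaurentSeries.powerSeries_as_subring ℂ).comap (algebraMap ConvLaurent ℂ⸨X⸩)

/-- The coordinate `x`, as an element of `ℂ{x}[1/x]`. -/
def coordX : ConvLaurent :=
  ⟨HahnSeries.single 1 1, by
    rw [mem_convLaurent, ← mul_one (HahnSeries.single 1 1)]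
    exact isConvergent_single_mul (isConvergent_C 1) 1⟩

/-! ### Operations on Laurent series: `x d/dx`, rotations, ramification -/

/-- Multiplication of the coefficient `aₙ` of a Laurent series by `w n`. -/
def weightSeries (w : ℤ → ℂ) (f : ℂ⸨X⸩) : ℂ⸨X⸩ :=
  ⟨fun n => w n * f.coeff n, f.isPWO_support.mono fun n hn h => hn (by simp [h])⟩

theorem weightSeries_coeff (w : ℤ → ℂ) (f : ℂ⸨X⸩) (n : ℤ) :
    (weightSeries w f).coeff n = w n * f.coeff n := rfl

theorem support_weightSeries (w : ℤ → ℂ) (f : ℂ⸨X⸩) : (weightSeries w f).support ⊆ f.support :=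
  fun n hn h => hn (by rw [weightSeries_coeff, h, mul_zero])

theorem coeff_weightSeries_mul (w v : ℤ → ℂ) (f g : ℂ⸨X⸩) (n : ℤ) :
    (weightSeries w f * weightSeries v g).coeff n =
      ∑ ij ∈ Finset.antidiagonal f.isPWO_support g.isPWO_support n,
        w ij.1 * v ij.2 * (f.coeff ij.1 * g.coeff ij.2) := by
  rw [HahnSeries.coeff_mul]
  refine Finset.sum_congr_of_eq_on_inter ?_ ?_ ?_
  · intro ij hij hij'
    rw [Finset.mem_antidiagonal] at hij hij'
    exact absurd ⟨support_weightSeries w f hij.1, support_weightSeries v g hij.2.1, hij.2.2⟩ hij'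
  · intro ij hij hij'
    rw [Finset.mem_antidiagonal] at hij hij'
    by_contra h
    refine hij' ⟨fun h' => h ?_, fun h' => h ?_, hij.2.2⟩
    · rw [weightSeries_coeff] at h'
      linear_combination v ij.2 * g.coeff ij.2 * h'
    · rw [weightSeries_coeff] at h'
      linear_combination w ij.1 * f.coeff ij.1 * h'
  · intro ij _ _
    rw [weightSeries_coeff, weightSeries_coeff]
    ring

theorem weightSeries_one (f : ℂ⸨X⸩) : weightSeries (fun _ => 1) f = f := by
  ext n
  rw [weightSeries_coeff, one_mul]

/-- The derivation `x d/dx` of `ℂ((x))`: `∑ aₙ xⁿ ↦ ∑ n aₙ xⁿ`. -/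
def eulerFormal : Derivation ℂ ℂ⸨X⸩ ℂ⸨X⸩ where
  toFun f := weightSeries (fun n => (n : ℂ)) f
  map_add' f g := by ext n; simp [weightSeries_coeff, mul_add]
  map_smul' c f := by ext n; simp [weightSeries_coeff]; ring
  map_one_eq_zero' := by
    ext n
    simp only [LinearMap.coe_mk, AddHom.coe_mk, HahnSeries.coeff_one, HahnSeries.coeff_zero,
      weightSeries_coeff]
    split_ifs with h <;> simp [h]
  leibniz' f g := by
    ext n
    simp only [LinearMap.coe_mk, AddHom.coe_mk, smul_eq_mul, HahnSeries.coeff_add]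
    have h1 := coeff_weightSeries_mul (fun _ => 1) (fun n => (n : ℂ)) f g n
    have h2 := coeff_weightSeries_mul (fun n => (n : ℂ)) (fun _ => 1) f g n
    rw [weightSeries_one] at h1 h2
    rw [mul_comm g, h1, h2, weightSeries_coeff, HahnSeries.coeff_mul, Finset.mul_sum,
      ← Finset.sum_add_distrib]
    refine Finset.sum_congr rfl fun ij hij => ?_
    have : ij.1 + ij.2 = n := (Finset.mem_antidiagonal.1 hij).2.2
    rw [← this]
    push_cast
    ring

theorem eulerFormal_coeff (f : ℂ⸨X⸩) (n : ℤ) :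
    (eulerFormal f).coeff n = (n : ℂ) * f.coeff n := rfl

theorem IsConvergent.euler {f : ℂ⸨X⸩} (hf : IsConvergent f) : IsConvergent (eulerFormal f) := by
  obtain ⟨C, A, h⟩ := hf
  refine ⟨C, 2 * A, fun n => ?_⟩
  rw [eulerFormal_coeff, norm_mul, mul_pow]
  have h1 : ‖((n : ℤ) : ℂ)‖ ≤ 2 ^ n := by
    simp only [Int.cast_natCast, Complex.norm_natCast]
    exact_mod_cast Nat.lt_two_pow_self.le
  calc _ ≤ 2 ^ n * (C * A ^ n) := mul_le_mul h1 (h n) (norm_nonneg _) (by positivity)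
    _ = _ := by ring

/-- The derivation `x d/dx` of `ℂ{x}[1/x]`. -/
def eulerConv : Derivation ℂ ConvLaurent ConvLaurent where
  toFun f := ⟨eulerFormal f, IsConvergent.euler f.2⟩
  map_add' f g := Subtype.ext (map_add eulerFormal (f : ℂ⸨X⸩) g)
  map_smul' c f := Subtype.ext (eulerFormal.map_smul c (f : ℂ⸨X⸩))
  map_one_eq_zero' := Subtype.ext eulerFormal.map_one_eq_zero
  leibniz' f g := Subtype.ext (eulerFormal.leibniz (f : ℂ⸨X⸩) g)

/-- The rotation `f(y) ↦ f(ζ y)`, that is `∑ aₙ yⁿ ↦ ∑ ζⁿ aₙ yⁿ`, on `ℂ((y))`. -/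
def rotateFormal (ζ : ℂˣ) : ℂ⸨X⸩ →+* ℂ⸨X⸩ where
  toFun f := weightSeries (fun n => ((ζ ^ n : ℂˣ) : ℂ)) f
  map_zero' := by ext n; simp [weightSeries_coeff]
  map_one' := by
    ext n
    simp only [HahnSeries.coeff_one, weightSeries_coeff]
    split_ifs with h <;> simp [h]
  map_add' f g := by ext n; simp [weightSeries_coeff, mul_add]
  map_mul' f g := by
    ext n
    rw [coeff_weightSeries_mul, weightSeries_coeff, HahnSeries.coeff_mul, Finset.mul_sum]
    refine Finset.sum_congr rfl fun ij hij => ?_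
    have : ij.1 + ij.2 = n := (Finset.mem_antidiagonal.1 hij).2.2
    rw [← this, zpow_add, Units.val_mul]

theorem rotateFormal_coeff (ζ : ℂˣ) (f : ℂ⸨X⸩) (n : ℤ) :
    (rotateFormal ζ f).coeff n = ((ζ ^ n : ℂˣ) : ℂ) * f.coeff n := rfl

theorem IsConvergent.rotate {f : ℂ⸨X⸩} (hf : IsConvergent f) (ζ : ℂˣ) :
    IsConvergent (rotateFormal ζ f) := by
  obtain ⟨C, A, h⟩ := hf
  refine ⟨C, ‖(ζ : ℂ)‖ * A, fun n => ?_⟩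
  rw [rotateFormal_coeff, norm_mul, mul_pow, zpow_natCast, Units.val_pow_eq_pow_val, norm_pow]
  calc _ ≤ ‖(ζ : ℂ)‖ ^ n * (C * A ^ n) := by gcongr; exact h n
    _ = _ := by ring

/-- The substitution `f(x) ↦ f(y ^ q)` from `ℂ((x))` to `ℂ((y))`. -/
def ramifyFormal (q : ℕ) [NeZero q] : ℂ⸨X⸩ →+* ℂ⸨X⸩ :=
  HahnSeries.embDomainRingHom (AddMonoidHom.mulLeft (q : ℤ))
    (mul_right_injective₀ (by exact_mod_cast NeZero.ne q))
    (fun _ _ => mul_le_mul_iff_right₀ (by exact_mod_cast NeZero.pos q))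

theorem ramifyFormal_coeff_mul (q : ℕ) [NeZero q] (f : ℂ⸨X⸩) (n : ℤ) :
    (ramifyFormal q f).coeff (q * n) = f.coeff n :=
  HahnSeries.embDomain_coeff
    (f := ⟨⟨AddMonoidHom.mulLeft (q : ℤ), mul_right_injective₀ (by exact_mod_cast NeZero.ne q)⟩,
      mul_le_mul_iff_right₀ (by exact_mod_cast NeZero.pos q)⟩)

theorem ramifyFormal_coeff_of_not_dvd (q : ℕ) [NeZero q] (f : ℂ⸨X⸩) (n : ℤ) (hn : ¬ (q : ℤ) ∣ n) :
    (ramifyFormal q f).coeff n = 0 :=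
  HahnSeries.embDomain_of_notMem_range (by rintro ⟨m, rfl⟩; exact hn ⟨m, rfl⟩)

theorem IsConvergent.ramify {f : ℂ⸨X⸩} (hf : IsConvergent f) (q : ℕ) [NeZero q] :
    IsConvergent (ramifyFormal q f) := by
  obtain ⟨C, A, hC, hA, h⟩ := hf.shift 0
  refine ⟨C, A, fun n => ?_⟩
  by_cases hn : (q : ℤ) ∣ n
  · obtain ⟨m, rfl⟩ := Int.natCast_dvd_natCast.1 hn
    have h1 := h m
    rw [add_zero] at h1
    push_cast
    rw [ramifyFormal_coeff_mul]
    refine h1.trans (mul_le_mul_of_nonneg_left (pow_le_pow_right₀ hA ?_) hC)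
    exact Nat.le_mul_of_pos_left m (NeZero.pos q)
  · rw [ramifyFormal_coeff_of_not_dvd q f n hn, norm_zero]
    positivity

theorem eulerFormal_ramify (q : ℕ) [NeZero q] (f : ℂ⸨X⸩) :
    eulerFormal (ramifyFormal q f) = (q : ℂ) • ramifyFormal q (eulerFormal f) := by
  ext n
  rw [eulerFormal_coeff, HahnSeries.coeff_smul, smul_eq_mul]
  by_cases hn : (q : ℤ) ∣ n
  · obtain ⟨m, rfl⟩ := hn
    rw [ramifyFormal_coeff_mul, ramifyFormal_coeff_mul, eulerFormal_coeff]
    push_cast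
    ring
  · simp [ramifyFormal_coeff_of_not_dvd q _ n hn]

theorem rotate_ramify (q : ℕ) [NeZero q] (ζ : rootsOfUnity q ℂ) (f : ℂ⸨X⸩) :
    rotateFormal ζ (ramifyFormal q f) = ramifyFormal q f := by
  ext n
  rw [rotateFormal_coeff]
  by_cases hn : (q : ℤ) ∣ n
  · obtain ⟨m, rfl⟩ := hn
    have h : (ζ : ℂˣ) ^ q = 1 := ζ.2
    rw [zpow_mul, zpow_natCast, h]
    simp
  · simp [ramifyFormal_coeff_of_not_dvd q _ n hn]

/-! ### The ramified field `ℂ{y}[1/y]`, `y ^ q = x` -/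

/-- The field `ℂ{y}[1/y]`, seen as an extension of `ℂ{x}[1/x]` through `x = y ^ q`. -/
def Ramified (_q : ℕ) : Type := ConvLaurent

instance (q : ℕ) : Field (Ramified q) := inferInstanceAs (Field ConvLaurent)
instance (q : ℕ) : Algebra ℂ (Ramified q) := inferInstanceAs (Algebra ℂ ConvLaurent)
instance (q : ℕ) : Algebra (Ramified q) ℂ⸨X⸩ := inferInstanceAs (Algebra ConvLaurent ℂ⸨X⸩)
instance (q : ℕ) : IsScalarTower ℂ (Ramified q) ℂ⸨X⸩ :=
  inferInstanceAs (IsScalarTower ℂ ConvLaurent ℂ⸨X⸩)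

instance (q : ℕ) [NeZero q] : Algebra ConvLaurent (Ramified q) :=
  RingHom.toAlgebra (S := Ramified q)
    { toFun := fun f => (⟨ramifyFormal q f, IsConvergent.ramify f.2 q⟩ : ConvLaurent)
      map_zero' := Subtype.ext (map_zero (ramifyFormal q))
      map_one' := Subtype.ext (map_one (ramifyFormal q))
      map_add' := fun f g => Subtype.ext (map_add (ramifyFormal q) (f : ℂ⸨X⸩) g)
      map_mul' := fun f g => Subtype.ext (map_mul (ramifyFormal q) (f : ℂ⸨X⸩) g) }

instance (q : ℕ) [NeZero q] : IsScalarTower ℂ ConvLaurent (Ramified q) :=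
  IsScalarTower.of_algebraMap_eq fun c => Subtype.ext (by
    change algebraMap ℂ ℂ⸨X⸩ c = ramifyFormal q (algebraMap ℂ ℂ⸨X⸩ c)
    have : algebraMap ℂ ℂ⸨X⸩ c = HahnSeries.C c := rfl
    rw [this]
    exact HahnSeries.embDomainRingHom_C.symm)

/-- The derivation `y d/dy` of `ℂ{y}[1/y]`. -/
def eulerRam (q : ℕ) : Derivation ℂ (Ramified q) (Ramified q) := eulerConv

theorem eulerRam_algebraMap (q : ℕ) [NeZero q] (f : ConvLaurent) :
    eulerRam q (algebraMap ConvLaurent (Ramified q) f) =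
      (q : ℂ) • algebraMap ConvLaurent (Ramified q) (eulerConv f) :=
  Subtype.ext (eulerFormal_ramify q f)

theorem eulerFormal_algebraMap (q : ℕ) (f : Ramified q) :
    eulerFormal (algebraMap (Ramified q) ℂ⸨X⸩ f) =
      (1 : ℂ) • algebraMap (Ramified q) ℂ⸨X⸩ (eulerRam q f) := by
  rw [one_smul]
  rfl

/-- A `q`-th root of unity `ζ` acts on `ℂ{y}[1/y]` by `f(y) ↦ f(ζ y)`; this is linear over
`ℂ{x}[1/x]`. -/
def rotateRam (q : ℕ) [NeZero q] (ζ : rootsOfUnity q ℂ) :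
    Ramified q →ₗ[ConvLaurent] Ramified q where
  toFun f := (⟨rotateFormal ζ (algebraMap (Ramified q) ℂ⸨X⸩ f),
    IsConvergent.rotate (Subtype.property (p := fun f => f ∈ ConvLaurent) f) ζ⟩ : ConvLaurent)
  map_add' f g := Subtype.ext (map_add (rotateFormal ζ)
    (algebraMap (Ramified q) ℂ⸨X⸩ f) (algebraMap (Ramified q) ℂ⸨X⸩ g))
  map_smul' c f := Subtype.ext (by
    change rotateFormal ζ (ramifyFormal q c * algebraMap (Ramified q) ℂ⸨X⸩ f) =
      ramifyFormal q c * rotateFormal ζ (algebraMap (Ramified q) ℂ⸨X⸩ f)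
    rw [map_mul, rotate_ramify])

/-! ### Connections -/

section Connection

variable {F : Type*} [Field F] [Algebra ℂ F]

/-- A connection on an `F`-vector space `M`, where `F` is a field of (convergent or formal) Laurent
series in `x` and `δ = x d/dx`. It is given by the operator `θ = ∇_{x∂ₓ}`, so that
`∂ₓ = x⁻¹ θ` and `∇ m = θ m ⊗ dx / x`. -/
structure Connection (δ : Derivation ℂ F F) (M : Type*) [AddCommGroup M] [Module ℂ M]
    [Module F M] where
  /-- The operator `∇_{x∂ₓ}`. -/
  θ : M →ₗ[ℂ] M
  leibniz : ∀ (f : F) (m : M), θ (f • m) = δ f • m + f • θ m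

variable {F' : Type*} [Field F'] [Algebra ℂ F'] [Algebra F F'] [IsScalarTower ℂ F F']
  {δ : Derivation ℂ F F} {δ' : Derivation ℂ F' F'}

/-- Pull-back of a connection along a field extension `F ⊆ F'` on which `δ' = c δ`:
on `F' ⊗ M` the operator is `g ⊗ m ↦ δ' g ⊗ m + c g ⊗ θ m`. -/
def Connection.baseChange {M : Type*} [AddCommGroup M] [Module ℂ M] [Module F M]
    (D : Connection δ M) (c : ℂ)
    (h : ∀ f, δ' (algebraMap F F' f) = c • algebraMap F F' (δ f)) :
    Connection δ' (F' ⊗[F] M) :=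
  let T : F' ⊗[F] M →+ F' ⊗[F] M := TensorProduct.liftAddHom
    { toFun := fun g =>
        { toFun := fun m => δ' g ⊗ₜ m + (c • g) ⊗ₜ D.θ m
          map_zero' := by simp
          map_add' := fun m m' => by simp only [map_add, TensorProduct.tmul_add]; abel }
      map_zero' := by ext m; simp
      map_add' := fun g g' => by
        ext m
        simp only [map_add, smul_add, TensorProduct.add_tmul, AddMonoidHom.coe_mk, ZeroHom.coe_mk,
          AddMonoidHom.add_apply]
        abel }
    (fun f g m => by
      simp only [AddMonoidHom.coe_mk, ZeroHom.coe_mk, D.leibniz, TensorProduct.tmul_add]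
      rw [Algebra.smul_def f g, Derivation.leibniz, h, TensorProduct.add_tmul,
        ← TensorProduct.smul_tmul f (δ' g), ← TensorProduct.smul_tmul (δ f),
        ← TensorProduct.smul_tmul f, Algebra.smul_def f (δ' g), Algebra.smul_def (δ f),
        Algebra.smul_def f (c • g)]
      simp only [smul_eq_mul, mul_smul_comm, smul_mul_assoc, mul_comm g]
      abel)
  have hT : ∀ (a g : F') (m : M), T ((a * g) ⊗ₜ m) = (δ' a * g) ⊗ₜ m + a • T (g ⊗ₜ m) := by
    intro a g m
    simp only [T, TensorProduct.liftAddHom_tmul, AddMonoidHom.coe_mk, ZeroHom.coe_mk,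
      Derivation.leibniz, TensorProduct.add_tmul, smul_add, TensorProduct.smul_tmul', smul_eq_mul,
      mul_smul_comm, mul_comm g]
    abel
  { θ :=
      { toFun := T
        map_add' := map_add T
        map_smul' := fun a z => by
          induction z with
          | zero => simp
          | add z w hz hw => rw [smul_add, map_add, hz, hw, map_add, smul_add]
          | tmul g m =>
            rw [TensorProduct.smul_tmul', Algebra.smul_def, hT, Derivation.map_algebraMap]
            simp [algebraMap_smul] }
    leibniz := fun a z => by
      change T (a • z) = δ' a • z + a • T z
      induction z with
      | zero => simp
      | add z w hz hw => rw [smul_add, map_add, hz, hw, map_add, smul_add, smul_add]; abel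
      | tmul g m =>
        rw [TensorProduct.smul_tmul', smul_eq_mul, hT, TensorProduct.smul_tmul', smul_eq_mul] }

theorem Connection.baseChange_tmul {M : Type*} [AddCommGroup M] [Module ℂ M] [Module F M]
    (D : Connection δ M) (c : ℂ) (h : ∀ f, δ' (algebraMap F F' f) = c • algebraMap F F' (δ f))
    (g : F') (m : M) :
    (D.baseChange c h).θ (g ⊗ₜ[F] m) = δ' g ⊗ₜ[F] m + (c • g) ⊗ₜ[F] D.θ m :=
  rfl

/-- The connection `E^φ ⊗ R` for a Laurent series `φ`: the space `R` (`e^φ ⊗ m` being identified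
with `m`), with the operator `m ↦ θ m + δ(φ) m`. -/
def Connection.expTwist {R : Type*} [AddCommGroup R] [Module ℂ R] [Module F R]
    [IsScalarTower ℂ F R] (D : Connection δ R) (φ : F) : Connection δ R where
  θ := D.θ + Algebra.lsmul ℂ ℂ R (δ φ)
  leibniz f m := by
    simp only [LinearMap.add_apply, Algebra.lsmul_coe, D.leibniz, smul_add]
    rw [smul_comm (δ φ) f m, add_assoc]

/-- The direct sum of finitely many connections. -/
def Connection.pi {ι : Type*} [Finite ι] {R : ι → Type*} [∀ i, AddCommGroup (R i)]
    [∀ i, Module ℂ (R i)] [∀ i, Module F (R i)] (D : ∀ i, Connection δ (R i)) :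
    Connection δ (∀ i, R i) where
  θ := LinearMap.pi fun i => (D i).θ ∘ₗ LinearMap.proj i
  leibniz f m := by
    ext i
    simp [(D i).leibniz]

end Connection

/-! ### The Deligne filtration of a meromorphic connection -/

section Deligne

variable {M : Type*} [AddCommGroup M] [Module ℂ M] [Module ConvLaurent M]
  [IsScalarTower ℂ ConvLaurent M]

/-- The ring `ℂ{x}⟨x∂ₓ⟩`, through its action on `M`: the algebra of operators on `M` generated by
the multiplications by convergent power series and by `∇_{x∂ₓ}`. -/
def logDiffOps (D : Connection eulerConv M) : Subalgebra ℂ (Module.End ℂ M) :=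
  Algebra.adjoin ℂ ({D.θ} ∪ (fun f : ConvLaurent => Algebra.lsmul ℂ ℂ M f) '' ConvPower)

/-- The ring `logDiffOps D`, as a type. -/
def LogOps (D : Connection eulerConv M) : Type _ := logDiffOps D

instance (D : Connection eulerConv M) : Ring (LogOps D) := inferInstanceAs (Ring (logDiffOps D))
instance (D : Connection eulerConv M) : Algebra ℂ (LogOps D) :=
  inferInstanceAs (Algebra ℂ (logDiffOps D))
instance (D : Connection eulerConv M) : Module (LogOps D) M :=
  inferInstanceAs (Module (logDiffOps D) M)
instance (D : Connection eulerConv M) : IsScalarTower ℂ (LogOps D) M :=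
  inferInstanceAs (IsScalarTower ℂ (logDiffOps D) M)

/-- The operator `x∂ₓ`, as an element of `ℂ{x}⟨x∂ₓ⟩`. -/
def LogOps.xdx (D : Connection eulerConv M) : LogOps D :=
  (⟨D.θ, Algebra.subset_adjoin (Or.inl rfl)⟩ : logDiffOps D)

theorem LogOps.xdx_smul (D : Connection eulerConv M) (m : M) : LogOps.xdx D • m = D.θ m := rfl

/-- `V^{>b} = ⋃_{c > b} V^c`. -/
def filtGt {D : Connection eulerConv M} (V : ℝ → Submodule (LogOps D) M) (b : ℝ) :
    Submodule (LogOps D) M :=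
  ⨆ c : Set.Ioi b, V c

/-- `gr^b_V = V^b / V^{>b}`. -/
abbrev Gr {D : Connection eulerConv M} (V : ℝ → Submodule (LogOps D) M) (b : ℝ) : Type _ :=
  V b ⧸ (filtGt V b).submoduleOf (V b)

/-- `V` is the Deligne filtration of the meromorphic connection `(M, D)`: an exhaustive, decreasing,
left-continuous filtration indexed by `ℝ` by finitely generated `ℂ{x}⟨x∂ₓ⟩`-submodules, with
`x V^b = V^{b+1}`, whose graded pieces `gr^b_V` are finite dimensional with all the eigenvalues of
`x∂ₓ` on `gr^b_V` of real part `b`. -/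
structure IsDeligneFiltration (D : Connection eulerConv M)
    (V : ℝ → Submodule (LogOps D) M) : Prop where
  antitone : Antitone V
  exhaustive : ⨆ b, V b = ⊤
  left_continuous : ∀ b, ⨅ c : Set.Iio b, V c = V b
  fg : ∀ b, (V b).FG
  mul_x : ∀ b (m : M), coordX • m ∈ V (b + 1) ↔ m ∈ V b
  finite_gr : ∀ b, FiniteDimensional ℂ (Gr V b)
  eigenvalue_re : ∀ b (β : ℂ),
    Module.End.HasEigenvalue (Algebra.lsmul ℂ ℂ (Gr V b) (LogOps.xdx D)) β → β.re = b

end Deligne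

/-! ### Formal regular singular connections and their Deligne lattices -/

section Formal

variable {R : Type*} [AddCommGroup R] [Module ℂ R] [Module ℂ⸨X⸩ R]

/-- A logarithmic lattice: a finitely generated `ℂ[[y]]`-submodule which generates `R` over `ℂ((y))`
and is stable by `∇_{y∂_y}`. -/
structure IsLogLattice (D : Connection eulerFormal R)
    (L : Submodule (LaurentSeries.powerSeries_as_subring ℂ) R) : Prop where
  fg : L.FG
  span_eq_top : Submodule.span ℂ⸨X⸩ (L : Set R) = ⊤
  stable : ∀ m ∈ L, D.θ m ∈ L

/-- Regular singularity: there is a logarithmic lattice. -/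
def IsRegularSingular (D : Connection eulerFormal R) : Prop :=
  ∃ L, IsLogLattice D L

/-- `L` is a logarithmic lattice such that the eigenvalues of the residue of the connection, that is
of the endomorphism induced by `∇_{y∂_y}` on `L / y L`, have real part in `[b, b + 1)`. -/
structure IsDeligneLattice (D : Connection eulerFormal R) (b : ℝ)
    (L : Submodule (LaurentSeries.powerSeries_as_subring ℂ) R) : Prop
    extends IsLogLattice D L where
  residue_re : ∀ (β : ℂ), ∀ m ∈ L,
    (¬ ∃ m' ∈ L, m = (HahnSeries.single 1 1 : ℂ⸨X⸩) • m') →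
    (∃ m' ∈ L, D.θ m - β • m = (HahnSeries.single 1 1 : ℂ⸨X⸩) • m') →
    b ≤ β.re ∧ β.re < b + 1

/-- `V^b R`: the (unique) Deligne lattice of index `b` of a formal regular singular connection. -/
def deligneLattice (D : Connection eulerFormal R) (b : ℝ) :
    Submodule (LaurentSeries.powerSeries_as_subring ℂ) R :=
  sSup {L | IsDeligneLattice D b L}

end Formal

/-! ### Formal elementary models and the canonical parabolic filtration -/

/-- The Laurent polynomial `φ(1/y)`. -/
def polarPart (φ : Polynomial ℂ) : ℂ⸨X⸩ :=
  Polynomial.aeval (HahnSeries.single (-1) 1 : ℂ⸨X⸩) φ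

/-- An elementary model of a formal connection `(W, D)`: a finite set `Φ ⊆ y⁻¹ℂ[y⁻¹]`, regular
singular connections `R_φ` and an isomorphism of connections `W ≃ ⨁_{φ ∈ Φ} E^φ ⊗ R_φ`. -/
structure ElementaryModel.{w, v} {W : Type v} [AddCommGroup W] [Module ℂ W] [Module ℂ⸨X⸩ W]
    (D : Connection eulerFormal W) where
  /-- The exponents, as polynomials without constant term in `1/y`. -/
  Φ : Finset (Polynomial ℂ)
  coeff_zero : ∀ φ ∈ Φ, φ.coeff 0 = 0
  /-- The spaces `R_φ`. -/
  R : Φ → Type w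
  [addCommGroup : ∀ φ, AddCommGroup (R φ)]
  [moduleC : ∀ φ, Module ℂ (R φ)]
  [module : ∀ φ, Module ℂ⸨X⸩ (R φ)]
  [tower : ∀ φ, IsScalarTower ℂ ℂ⸨X⸩ (R φ)]
  /-- The connections on the spaces `R_φ`. -/
  conn : ∀ φ, Connection eulerFormal (R φ)
  regular : ∀ φ, IsRegularSingular (conn φ)
  /-- The isomorphism. -/
  iso : W ≃ₗ[ℂ⸨X⸩] ∀ φ, R φ
  iso_conn : ∀ z,
    iso (D.θ z) = (Connection.pi fun φ => (conn φ).expTwist (polarPart φ)).θ (iso z)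

attribute [instance] ElementaryModel.addCommGroup ElementaryModel.moduleC ElementaryModel.module
  ElementaryModel.tower

/-- `P^b(W) = ⨁_φ E^φ ⊗ V^b R_φ`. -/
def ElementaryModel.parabolicFormal {W : Type*} [AddCommGroup W] [Module ℂ W] [Module ℂ⸨X⸩ W]
    {D : Connection eulerFormal W} (E : ElementaryModel D) (b : ℝ) : Set W :=
  {z | ∀ φ, E.iso z φ ∈ deligneLattice (E.conn φ) b}

section Main

variable {M : Type*} [AddCommGroup M] [Module ℂ M] [Module ConvLaurent M]

/-- The underlying space of `N = π⁺M`, for `π : y ↦ x = y ^ q`. -/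
abbrev RamPullback (q : ℕ) [NeZero q] (M : Type*) [AddCommGroup M] [Module ConvLaurent M] :
    Type _ :=
  Ramified q ⊗[ConvLaurent] M

/-- The connection on `N = π⁺M`: `y∂_y (g ⊗ m) = y g'(y) ⊗ m + q g ⊗ x∂ₓ m`. -/
def Connection.ramPullback (D : Connection eulerConv M) (q : ℕ) [NeZero q] :
    Connection (eulerRam q) (RamPullback q M) :=
  D.baseChange (q : ℂ) (eulerRam_algebraMap q)

/-- The formalization `ℂ((y)) ⊗ N` of a connection `N` over `ℂ{y}[1/y]`. -/
def Connection.formalization {q : ℕ} {N : Type*} [AddCommGroup N] [Module ℂ N]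
    [Module (Ramified q) N] (D : Connection (eulerRam q) N) :
    Connection eulerFormal (ℂ⸨X⸩ ⊗[Ramified q] N) :=
  D.baseChange 1 (eulerFormal_algebraMap q)

/-- The action of a `q`-th root of unity on `N = π⁺M`: `g(y) ⊗ m ↦ g(ζ y) ⊗ m`. -/
def galoisAct (q : ℕ) [NeZero q] (M : Type*) [AddCommGroup M] [Module ConvLaurent M]
    (ζ : rootsOfUnity q ℂ) : RamPullback q M →ₗ[ConvLaurent] RamPullback q M :=
  LinearMap.rTensor M (rotateRam q ζ)

variable {D : Connection eulerConv M} {q : ℕ} [NeZero q]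

/-- `P^b(N) = P^b(N^) ∩ N`, for `N = π⁺M` with formalization `N^`. -/
def parabolicRam (E : ElementaryModel (D.ramPullback q).formalization) (b : ℝ) :
    Set (RamPullback q M) :=
  {n | (1 : ℂ⸨X⸩) ⊗ₜ[Ramified q] n ∈ E.parabolicFormal b}

/-- The canonical parabolic filtration of `M`: `P^b(M)` is the set of invariants of `P^{qb}(N)`
under the `q`-th roots of unity, `M` being identified with the invariants of `N = π⁺M` through
`m ↦ 1 ⊗ m`. -/
def parabolic (E : ElementaryModel (D.ramPullback q).formalization) (b : ℝ) : Set M :=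
  {m | (1 : Ramified q) ⊗ₜ[ConvLaurent] m ∈
    {n ∈ parabolicRam E (q * b) | ∀ ζ, galoisAct q M ζ n = n}}

end Main

end MeroConn

end

open MeroConn

noncomputable section

namespace MeroConn

/-! Why the theorem holds. In the formal decomposition of `N`, the operator `y∂_y` acts on the
summand of exponent `φ` as `θ + χ`, where `θ` is the regular singular operator and `χ = y∂_y φ`. If
`φ ≠ 0`, then `χ` has negative order, so every `m` in `V^b` is `(θ + χ) m₀ + m₁` with `m₀ = χ⁻¹ m`
and `m₁ = -θ m₀`, both in `V^{b+1}` (`exists_eq_theta_add`). Hence `y∂_y` generates the whole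
irregular summand from any one of its lattices, whereas on the summand `φ = 0` the lattice `V^b` is
already stable. The module generated by the formal parabolic lattice is therefore `V^b` on the
summand `φ = 0` plus all the irregular summands (`regularLattice_le`), and its trace on `M`, with
index `q b` because `y∂_y = q x∂ₓ`, is the Deligne filtration (`deligneStep`).

Descent to `M` (`deligneStep_le`) uses three facts: `N` is dense in its formalization for the
filtration by parabolic lattices, `y∂_y` lowers the parabolic index by a bounded amount, and
averaging over the roots of unity preserves the parabolic filtration. The last one holds because the
block of a rotation between two summands either commutes with the regular operators or is twisted by
a nonzero series of negative order, and then vanishes (`eq_zero_of_twist`).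

Eigenvalues are controlled throughout by polynomials in the operator whose roots have real part at
least `b`. In a formal regular singular connection, `V^b` consists of the vectors which such
polynomials send arbitrarily deep into a fixed logarithmic lattice (`regularPart`); this does not
depend on the lattice and gives the existence and uniqueness of the Deligne lattices
(`deligneLattice_eq`). The same device compares two Deligne filtrations of `M`
(`IsDeligneFiltration.le`): a polynomial with roots of real part at least `b` pushes `V^b` deep into
both filtrations, so a vector of `V^b` cannot have order less than `b` in the other one. -/

/-! ### Polynomials in an operator, modulo a subspace -/

section Operators

open Polynomial

variable {E : Type*} [AddCommGroup E] [Module ℂ E] (θ : Module.End ℂ E)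

/-- The nonzero polynomials whose roots all have real part at least `b`. -/
def RootsGE (b : ℝ) (p : ℂ[X]) : Prop := p ≠ 0 ∧ ∀ β, p.IsRoot β → b ≤ β.re

theorem rootsGE_one (b : ℝ) : RootsGE b 1 :=
  ⟨one_ne_zero, fun β h => by simp [IsRoot.def] at h⟩

theorem RootsGE.mul {b : ℝ} {p p' : ℂ[X]} (hp : RootsGE b p) (hp' : RootsGE b p') :
    RootsGE b (p * p') :=
  ⟨mul_ne_zero hp.1 hp'.1, fun β h => (root_mul.1 h).elim (hp.2 β) (hp'.2 β)⟩

theorem RootsGE.mono {b c : ℝ} (h : b ≤ c) {p : ℂ[X]} (hp : RootsGE c p) : RootsGE b p :=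
  ⟨hp.1, fun β hβ => h.trans (hp.2 β hβ)⟩

theorem RootsGE.comp_X_sub_C {b : ℝ} {p : ℂ[X]} (hp : RootsGE b p) (c : ℂ) :
    RootsGE (b + c.re) (p.comp (X - C c)) := by
  refine ⟨fun h => hp.1 ?_, fun β hβ => ?_⟩
  · have := congrArg (fun r => r.comp (X + C c)) h
    simpa [comp_assoc] using this
  · have := hp.2 (β - c) (by simpa [IsRoot.def, eval_comp] using hβ)
    rw [Complex.sub_re] at this
    linarith

theorem rootsGE_X_sub_C {b : ℝ} {β : ℂ} (h : b ≤ β.re) : RootsGE b (X - C β) :=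
  ⟨X_sub_C_ne_zero β, fun γ hγ => by rwa [← root_X_sub_C.1 hγ]⟩

theorem aeval_mem {A : Submodule ℂ E} (hA : ∀ m ∈ A, θ m ∈ A) (p : ℂ[X]) {m : E} (hm : m ∈ A) :
    aeval θ p m ∈ A := by
  induction p using Polynomial.induction_on' with
  | add p p' h h' => rw [map_add]; exact A.add_mem h h'
  | monomial n a =>
    rw [aeval_monomial, Module.End.mul_apply, Module.algebraMap_end_apply]
    refine A.smul_mem _ ?_
    induction n with
    | zero => simpa
    | succ n ih => rw [pow_succ', Module.End.mul_apply]; exact hA _ ih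

/-- If some nonzero polynomial in `θ` sends `m` into `A`, then so does a divisor of this polynomial
all of whose roots are eigenvalues of `θ` modulo `A` in the cyclic module generated by `m`. -/
theorem exists_annihilator_eigenvalues (A : Submodule ℂ E) (m : E) {p : ℂ[X]} (hp : p ≠ 0)
    (hpm : aeval θ p m ∈ A) :
    ∃ g : ℂ[X], g ≠ 0 ∧ g ∣ p ∧ aeval θ g m ∈ A ∧ ∀ β, g.IsRoot β →
      ∃ h : ℂ[X], aeval θ h m ∉ A ∧ θ (aeval θ h m) - β • aeval θ h m ∈ A := by
  induction hn : p.natDegree using Nat.strong_induction_on generalizing p with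
  | _ n ih =>
    by_cases hall : ∀ β, p.IsRoot β →
      ∃ h : ℂ[X], aeval θ h m ∉ A ∧ θ (aeval θ h m) - β • aeval θ h m ∈ A
    · exact ⟨p, hp, dvd_rfl, hpm, hall⟩
    push Not at hall
    obtain ⟨β, hβ, hh⟩ := hall
    obtain ⟨h, rfl⟩ := dvd_iff_isRoot.2 hβ
    have hh0 : h ≠ 0 := right_ne_zero_of_mul hp
    have hm : aeval θ h m ∈ A := by
      -- Otherwise `aeval θ h m` would be an eigenvector modulo `A` of eigenvalue `β`, against the
      -- choice of `β`; so the factor `X - β` can be dropped.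
      by_contra hc
      refine hh h hc ?_
      simpa [sub_mul, Module.End.mul_apply] using hpm
    obtain ⟨g, hg0, hg, hgm, hgr⟩ := ih h.natDegree (by
      rw [← hn, natDegree_mul (X_sub_C_ne_zero β) hh0, natDegree_X_sub_C]; omega) hh0 hm rfl
    exact ⟨g, hg0, hg.mul_left _, hgm, hgr⟩

/-- A vector outside of `A` which is sent into `A` by a nonzero polynomial in `θ` gives rise to an
eigenvector modulo `A` whose eigenvalue is a root of the polynomial. -/
theorem exists_eigenvector {A : Submodule ℂ E} {m : E} (hm : m ∉ A) {p : ℂ[X]} (hp : p ≠ 0)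
    (hpm : aeval θ p m ∈ A) :
    ∃ β, p.IsRoot β ∧ ∃ h : ℂ[X], aeval θ h m ∉ A ∧ θ (aeval θ h m) - β • aeval θ h m ∈ A := by
  obtain ⟨g, hg0, hgp, hgm, hgr⟩ := exists_annihilator_eigenvalues θ A m hp hpm
  by_cases hd : g.degree = 0
  · rw [eq_C_of_degree_eq_zero hd, aeval_C, Module.algebraMap_end_apply] at hgm
    refine absurd ((A.smul_mem_iff ?_).1 hgm) hm
    intro h0
    rw [eq_C_of_degree_eq_zero hd, h0, C_0] at hg0
    exact hg0 rfl
  · obtain ⟨β, hβ⟩ := IsAlgClosed.exists_root g hd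
    exact ⟨β, hβ.dvd hgp, hgr β hβ⟩

/-- `p - p(β)` is divisible by `X - β`, which sends `m` into the stable subspace `A`. -/
theorem aeval_sub_eval_mem {A : Submodule ℂ E} (hA : ∀ m ∈ A, θ m ∈ A) {m : E} {β : ℂ}
    (hm : θ m - β • m ∈ A) (p : ℂ[X]) : aeval θ p m - p.eval β • m ∈ A := by
  obtain ⟨r, hr⟩ := X_sub_C_dvd_sub_C_eval (a := β) (p := p)
  have h := congrArg (fun s => aeval θ s m) hr
  simp only [map_sub, aeval_C, LinearMap.sub_apply, Module.algebraMap_end_apply] at h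
  rw [h, mul_comm, map_mul, Module.End.mul_apply]
  refine aeval_mem θ hA r ?_
  simpa using hm

/-- The eigenvalue of an eigenvector modulo `A` is a root of every polynomial in `θ` which sends
this eigenvector into `A`. -/
theorem isRoot_of_eigenvector {A : Submodule ℂ E} (hA : ∀ m ∈ A, θ m ∈ A) {m : E} {β : ℂ}
    (hmA : m ∉ A) (hm : θ m - β • m ∈ A) {p : ℂ[X]} (hp : aeval θ p m ∈ A) : p.IsRoot β := by
  by_contra h
  have h1 := A.sub_mem hp (aeval_sub_eval_mem θ hA hm p)
  rw [sub_sub_cancel] at h1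
  exact hmA ((A.smul_mem_iff h).1 h1)

/-- The map `p ↦ p(θ) m` modulo `A` takes its values in the finite dimensional image of `F`, hence
is not injective on `ℂ[X]`. -/
theorem exists_aeval_mem {A F : Submodule ℂ E} [FiniteDimensional ℂ F] {B : Submodule ℂ E}
    (hB : ∀ m ∈ B, θ m ∈ B) (hBF : B ≤ F ⊔ A) {m : E} (hm : m ∈ B) :
    ∃ p : ℂ[X], p ≠ 0 ∧ aeval θ p m ∈ A := by
  let f : ℂ[X] →ₗ[ℂ] F.map A.mkQ :=
    (A.mkQ ∘ₗ LinearMap.applyₗ m ∘ₗ (aeval θ).toLinearMap).codRestrict _ fun p => by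
      have h1 := hBF (aeval_mem θ hB p hm)
      obtain ⟨x, hx, a, ha, hxa⟩ := Submodule.mem_sup.1 h1
      refine ⟨x, hx, ?_⟩
      simp only [LinearMap.comp_apply, AlgHom.toLinearMap_apply, LinearMap.applyₗ_apply_apply]
      rw [← hxa, map_add, (Submodule.Quotient.mk_eq_zero A).2 ha |> (id : A.mkQ a = 0 → _),
        add_zero]
  have hf : ¬ Function.Injective f := fun h => by
    have := Module.Finite.of_injective f h
    exact Polynomial.not_finite this
  rw [← LinearMap.ker_eq_bot, Submodule.eq_bot_iff] at hf
  push Not at hf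
  obtain ⟨p, hp, hp0⟩ := hf
  refine ⟨p, hp0, ?_⟩
  have := congrArg Subtype.val (LinearMap.mem_ker.1 hp)
  exact (Submodule.Quotient.mk_eq_zero A).1 this

/-- The product of the polynomials attached to finitely many generators of `F` works for all of `B`.
-/
theorem exists_aeval_mem_uniform {A F : Submodule ℂ E} [FiniteDimensional ℂ F] {B : Submodule ℂ E}
    (hA : ∀ m ∈ A, θ m ∈ A) (hB : ∀ m ∈ B, θ m ∈ B) (hFB : F ≤ B) (hBF : B ≤ F ⊔ A) :
    ∃ p : ℂ[X], p ≠ 0 ∧ ∀ m ∈ B, aeval θ p m ∈ A := by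
  classical
  obtain ⟨s, hs⟩ := (Submodule.fg_iff_finiteDimensional F).2 inferInstance
  have h1 : ∀ m : E, ∃ p : ℂ[X], p ≠ 0 ∧ (m ∈ B → aeval θ p m ∈ A) := fun m => by
    by_cases hm : m ∈ B
    · obtain ⟨p, hp, h⟩ := exists_aeval_mem θ hB hBF hm
      exact ⟨p, hp, fun _ => h⟩
    · exact ⟨1, one_ne_zero, fun h => absurd h hm⟩
  choose p hp hpm using h1
  refine ⟨∏ m ∈ s, p m, Finset.prod_ne_zero_iff.2 fun m _ => hp m, fun m hm => ?_⟩
  have h2 : F ≤ A.comap (aeval θ (∏ m ∈ s, p m)) := by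
    rw [← hs, Submodule.span_le]
    intro x hx
    rw [SetLike.mem_coe, Submodule.mem_comap, ← Finset.prod_erase_mul _ _ hx, map_mul,
      Module.End.mul_apply]
    exact aeval_mem θ hA _ (hpm x (hFB (hs ▸ Submodule.subset_span hx)))
  have h3 : F ⊔ A ≤ A.comap (aeval θ (∏ m ∈ s, p m)) :=
    sup_le h2 fun x hx => aeval_mem θ hA _ hx
  exact h3 (hBF hm)

/-- An operator which shifts `θ` by a scalar transports polynomials in `θ`. -/
theorem aeval_comp_apply {E' : Type*} [AddCommGroup E'] [Module ℂ E'] (θ' : Module.End ℂ E')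
    (f : E →ₗ[ℂ] E') (c : ℂ) (hf : ∀ m, θ' (f m) = f (θ m) + c • f m) (p : ℂ[X]) (m : E) :
    aeval θ' (p.comp (X - C c)) (f m) = f (aeval θ p m) := by
  induction p using Polynomial.induction_on' generalizing m with
  | add p p' h h' => simp [h, h']
  | monomial n a =>
    simp only [← C_mul_X_pow_eq_monomial, mul_comp, C_comp, X_pow_comp, map_mul, aeval_C, map_pow,
      Module.End.mul_apply, Module.algebraMap_end_apply, aeval_X, map_sub, map_smul]
    congr 1
    induction n generalizing m with
    | zero => simp
    | succ n ih =>
      rw [pow_succ, pow_succ, Module.End.mul_apply, Module.End.mul_apply, ← ih]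
      congr 1
      simp [hf]

end Operators

/-! ### Laurent series and their orders -/

section Series

/-- The ring `ℂ[[y]]`, as a subring of `ℂ((y))`. -/
abbrev FormalPower : Subring ℂ⸨X⸩ := LaurentSeries.powerSeries_as_subring ℂ

/-- The monomial `y ^ n`. -/
abbrev yPow (n : ℤ) : ℂ⸨X⸩ := HahnSeries.single n 1

theorem yPow_mul (m n : ℤ) : yPow m * yPow n = yPow (m + n) := by
  rw [HahnSeries.single_mul_single, one_mul]

theorem yPow_zero : yPow 0 = 1 := rfl

theorem yPow_neg_mul (n : ℤ) : yPow (-n) * yPow n = 1 := by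
  rw [yPow_mul, neg_add_cancel, yPow_zero]

theorem yPow_mul_neg (n : ℤ) : yPow n * yPow (-n) = 1 := by
  rw [yPow_mul, add_neg_cancel, yPow_zero]

theorem yPow_ne_zero (n : ℤ) : yPow n ≠ 0 := HahnSeries.single_ne_zero one_ne_zero

theorem eulerFormal_yPow (n : ℤ) : eulerFormal (yPow n) = (n : ℂ) • yPow n := by
  ext k
  rw [eulerFormal_coeff, HahnSeries.coeff_smul, HahnSeries.coeff_single]
  split_ifs with h <;> simp [h]

theorem rotateFormal_yPow (ζ : ℂˣ) (n : ℤ) :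
    rotateFormal ζ (yPow n) = ((ζ ^ n : ℂˣ) : ℂ) • yPow n := by
  ext k
  rw [rotateFormal_coeff, HahnSeries.coeff_smul, HahnSeries.coeff_single]
  split_ifs with h <;> simp [h]

theorem mem_formalPower_iff {f : ℂ⸨X⸩} : f ∈ FormalPower ↔ ∀ n < 0, f.coeff n = 0 := by
  constructor
  · rintro ⟨p, -, rfl⟩ n hn
    exact HahnSeries.embDomain_of_notMem_range (by rintro ⟨k, rfl⟩; simp at hn; omega)
  · intro h
    refine ⟨PowerSeries.mk fun n => f.coeff n, trivial, ?_⟩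
    ext n
    rcases lt_or_ge n 0 with hn | hn
    · rw [h n hn]
      exact HahnSeries.embDomain_of_notMem_range (by rintro ⟨k, rfl⟩; simp at hn; omega)
    · obtain ⟨k, rfl⟩ := Int.eq_ofNat_of_zero_le hn
      exact (LaurentSeries.coeff_coe_powerSeries _ k).trans (PowerSeries.coeff_mk _ _)

theorem mem_formalPower_iff_order {f : ℂ⸨X⸩} : f ∈ FormalPower ↔ 0 ≤ f.order := by
  rw [mem_formalPower_iff]
  constructor
  · intro h
    by_contra hc
    push Not at hc
    have h1 := HahnSeries.coeff_order_eq_zero.1 (h _ hc)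
    rw [h1, HahnSeries.order_zero] at hc
    exact lt_irrefl _ hc
  · exact fun h n hn => HahnSeries.coeff_eq_zero_of_lt_order (hn.trans_le h)

theorem yPow_mem {n : ℤ} (hn : 0 ≤ n) : yPow n ∈ FormalPower := by
  rw [mem_formalPower_iff_order, HahnSeries.order_single one_ne_zero]
  exact hn

theorem order_yPow_mul (n : ℤ) {f : ℂ⸨X⸩} (hf : f ≠ 0) : (yPow n * f).order = n + f.order := by
  rw [HahnSeries.order_mul (yPow_ne_zero n) hf, HahnSeries.order_single one_ne_zero]

theorem yPow_mul_mem {n : ℤ} {f : ℂ⸨X⸩} (h : 0 ≤ n + f.order) : yPow n * f ∈ FormalPower := by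
  rcases eq_or_ne f 0 with rfl | hf
  · rw [mul_zero]; exact zero_mem _
  · rwa [mem_formalPower_iff_order, order_yPow_mul n hf]

theorem order_inv_of_ne_zero {f : ℂ⸨X⸩} (hf : f ≠ 0) : (f⁻¹).order = -f.order := by
  have h := HahnSeries.order_mul hf (inv_ne_zero hf)
  rw [mul_inv_cancel₀ hf, HahnSeries.order_one] at h
  omega

theorem inv_mul_mem {f : ℂ⸨X⸩} (hf : f ≠ 0) (h : f.order < 0) :
    yPow (-1) * f⁻¹ ∈ FormalPower :=
  yPow_mul_mem (by rw [order_inv_of_ne_zero hf]; omega)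

theorem algebraMap_mem_formalPower (c : ℂ) : algebraMap ℂ ℂ⸨X⸩ c ∈ FormalPower := by
  rw [mem_formalPower_iff]
  intro n hn
  exact HahnSeries.coeff_single_of_ne hn.ne

theorem rotate_mem {f : ℂ⸨X⸩} (ζ : ℂˣ) (h : f ∈ FormalPower) :
    rotateFormal ζ f ∈ FormalPower := by
  rw [mem_formalPower_iff] at h ⊢
  intro n hn
  rw [rotateFormal_coeff, h n hn, mul_zero]

/-- A power series is the sum of its constant coefficient and of a multiple of `y`. -/
theorem exists_eq_add_yPow_mul {f : ℂ⸨X⸩} (h : f ∈ FormalPower) :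
    ∃ c : ℂ, ∃ g ∈ FormalPower, f = algebraMap ℂ ℂ⸨X⸩ c + yPow 1 * g := by
  refine ⟨f.coeff 0, yPow (-1) * (f - algebraMap ℂ ℂ⸨X⸩ (f.coeff 0)), ?_, ?_⟩
  · rw [mem_formalPower_iff] at h ⊢
    intro n hn
    rw [HahnSeries.coeff_single_mul, one_mul, HahnSeries.coeff_sub]
    change _ - (HahnSeries.single 0 (f.coeff 0)).coeff _ = 0
    rw [HahnSeries.coeff_single]
    split_ifs with h0
    · rw [h0, sub_self]
    · rw [h _ (by omega), sub_zero]
  · rw [← mul_assoc, yPow_mul_neg, one_mul]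
    ring

/-- Truncation of a Laurent series at an arbitrarily large order. -/
theorem exists_convergent_approx (f : ℂ⸨X⸩) (T : ℕ) :
    ∃ g ∈ ConvLaurent, ∃ h ∈ FormalPower, f = g + yPow T * h := by
  have hy : ∀ n : ℤ, yPow n ∈ ConvLaurent := fun n => by
    have := isConvergent_single_mul (isConvergent_C 1) n
    rwa [HahnSeries.C_one, mul_one] at this
  have key : ∀ h ∈ FormalPower, ∀ T : ℕ,
      ∃ g ∈ ConvLaurent, ∃ h' ∈ FormalPower, h = g + yPow T * h' := by
    intro h hh T
    induction T with
    | zero => exact ⟨0, zero_mem _, h, hh, by simp⟩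
    | succ T ih =>
      obtain ⟨g, hg, h', hh', rfl⟩ := ih
      obtain ⟨c, h'', hh'', rfl⟩ := exists_eq_add_yPow_mul hh'
      refine ⟨g + yPow T * algebraMap ℂ ℂ⸨X⸩ c,
        add_mem hg (mul_mem (hy _) (ConvLaurent.algebraMap_mem c)), h'', hh'', ?_⟩
      push_cast
      rw [← yPow_mul]
      ring
  -- The extra `|f.order|` in the accuracy makes up for the later multiplication by `y ^ f.order`.
  obtain ⟨g, hg, h, hh, he⟩ := key (yPow (-f.order) * f) (yPow_mul_mem (by omega))
    (T + f.order.natAbs)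
  refine ⟨yPow f.order * g, mul_mem (hy _) hg, yPow (f.order + f.order.natAbs) * h,
    mul_mem (yPow_mem (by omega)) hh, ?_⟩
  calc f = yPow f.order * (yPow (-f.order) * f) := by rw [← mul_assoc, yPow_mul_neg, one_mul]
    _ = _ := by
      rw [he, mul_add, ← mul_assoc, ← mul_assoc, yPow_mul, yPow_mul]
      congr 3
      push_cast
      ring

instance : IsNoetherianRing FormalPower :=
  isNoetherianRing_of_ringEquiv _ (LaurentSeries.powerSeriesEquivSubring ℂ)

theorem mem_convPower {f : ConvLaurent} : f ∈ ConvPower ↔ (f : ℂ⸨X⸩) ∈ FormalPower := Iff.rfl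

theorem coe_coordX_zpow (n : ℤ) : ((coordX ^ n : ConvLaurent) : ℂ⸨X⸩) = yPow n := by
  have h1 : ∀ n : ℕ, ((coordX ^ n : ConvLaurent) : ℂ⸨X⸩) = yPow n := fun n => by
    rw [SubmonoidClass.coe_pow]
    change yPow 1 ^ n = _
    rw [HahnSeries.single_pow]
    simp
  obtain ⟨k, rfl | rfl⟩ := n.eq_nat_or_neg
  · rw [zpow_natCast, h1]
  · rw [zpow_neg, zpow_natCast]
    change ((coordX ^ k : ConvLaurent) : ℂ⸨X⸩)⁻¹ = _
    rw [h1]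
    exact inv_eq_of_mul_eq_one_right (yPow_mul_neg _)

theorem coordX_ne_zero : coordX ≠ 0 := fun h => yPow_ne_zero 1 (congrArg Subtype.val h)

theorem exists_eq_zpow_mul {a : ConvLaurent} (ha : a ≠ 0) :
    ∃ (n : ℤ) (u : ConvLaurent), a = coordX ^ n * u ∧ u ∈ ConvPower ∧ u⁻¹ ∈ ConvPower := by
  have ha' : (a : ℂ⸨X⸩) ≠ 0 := fun h => ha (Subtype.ext h)
  have hc : ((coordX ^ (-(a : ℂ⸨X⸩).order) * a : ConvLaurent) : ℂ⸨X⸩) =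
      yPow (-(a : ℂ⸨X⸩).order) * a := by
    rw [← coe_coordX_zpow]; rfl
  refine ⟨(a : ℂ⸨X⸩).order, coordX ^ (-(a : ℂ⸨X⸩).order) * a, ?_, ?_, ?_⟩
  · rw [← mul_assoc, ← zpow_add₀ coordX_ne_zero, add_neg_cancel, zpow_zero, one_mul]
  · rw [mem_convPower, hc]
    exact yPow_mul_mem (by omega)
  · rw [mem_convPower]
    change (((coordX ^ (-(a : ℂ⸨X⸩).order) * a : ConvLaurent) : ℂ⸨X⸩))⁻¹ ∈ _
    rw [hc, mem_formalPower_iff_order,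
      order_inv_of_ne_zero (mul_ne_zero (yPow_ne_zero _) ha'), order_yPow_mul _ ha']
    omega

end Series

/-! ### Uniqueness of the Deligne filtration -/

section DeligneUnique

open Polynomial

variable {M : Type*} [AddCommGroup M] [Module ℂ M] [Module ConvLaurent M]
  [IsScalarTower ℂ ConvLaurent M] {D : Connection eulerConv M}

theorem theta_mem (V : Submodule (LogOps D) M) {m : M} (hm : m ∈ V) : D.θ m ∈ V :=
  V.smul_mem (LogOps.xdx D) hm

theorem conv_smul_mem (V : Submodule (LogOps D) M) {a : ConvLaurent} (ha : a ∈ ConvPower) {m : M}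
    (hm : m ∈ V) : a • m ∈ V :=
  V.smul_mem (⟨Algebra.lsmul ℂ ℂ M a, Algebra.subset_adjoin (Or.inr ⟨a, ha, rfl⟩)⟩ :
    logDiffOps D) hm

/-- The underlying complex vector space of a `ℂ{x}⟨x∂ₓ⟩`-submodule. -/
abbrev toComplex (V : Submodule (LogOps D) M) : Submodule ℂ M := V.restrictScalars ℂ

theorem logOps_smul_mem {A : Submodule ℂ M} (hθ : ∀ m ∈ A, D.θ m ∈ A)
    (hx : ∀ a ∈ ConvPower, ∀ m ∈ A, a • m ∈ A) (P : LogOps D) {m : M} (hm : m ∈ A) :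
    P • m ∈ A := by
  have key : ∀ P ∈ logDiffOps D, ∀ m ∈ A, P m ∈ A := by
    intro P hP
    induction hP using Algebra.adjoin_induction with
    | mem P hP =>
      rcases hP with rfl | ⟨a, ha, rfl⟩
      · exact hθ
      · exact hx a ha
    | algebraMap c => exact fun m hm => A.smul_mem c hm
    | add P Q _ _ h h' => exact fun m hm => A.add_mem (h m hm) (h' m hm)
    | mul P Q _ _ h h' => exact fun m hm => h _ (h' m hm)
  exact key (show logDiffOps D from P).1 (show logDiffOps D from P).2 m hm

/-- A complex subspace stable by `x∂ₓ` and `ℂ{x}`, as a `ℂ{x}⟨x∂ₓ⟩`-submodule. -/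
def ofStable (A : Submodule ℂ M) (hθ : ∀ m ∈ A, D.θ m ∈ A)
    (hx : ∀ a ∈ ConvPower, ∀ m ∈ A, a • m ∈ A) : Submodule (LogOps D) M where
  carrier := A
  add_mem' := A.add_mem
  zero_mem' := A.zero_mem
  smul_mem' P _ hm := logOps_smul_mem hθ hx P hm

theorem mem_filtGt {V : ℝ → Submodule (LogOps D) M} (hV : Antitone V) {b : ℝ} {m : M} :
    m ∈ filtGt V b ↔ ∃ c, b < c ∧ m ∈ V c := by
  rw [filtGt, Submodule.mem_iSup_of_directed]
  · simp
  · rintro ⟨c, hc⟩ ⟨d, hd⟩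
    exact ⟨⟨min c d, Set.mem_Ioi.2 (lt_min hc hd)⟩, hV (min_le_left c d), hV (min_le_right c d)⟩

namespace IsDeligneFiltration

variable {V V' : ℝ → Submodule (LogOps D) M}

theorem re_eq (hV : IsDeligneFiltration D V) {b : ℝ} {m : M} (hm : m ∈ V b)
    (hm' : m ∉ filtGt V b) {β : ℂ} (h : D.θ m - β • m ∈ filtGt V b) : β.re = b := by
  refine hV.eigenvalue_re b β ?_
  refine Module.End.hasEigenvalue_of_hasEigenvector
    (x := Submodule.Quotient.mk (⟨m, hm⟩ : V b)) ⟨?_, ?_⟩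
  · rw [Module.End.mem_eigenspace_iff]
    have h2 : (Submodule.Quotient.mk (LogOps.xdx D • (⟨m, hm⟩ : V b)) : Gr V b) =
        Submodule.Quotient.mk (β • (⟨m, hm⟩ : V b)) :=
      (Submodule.Quotient.eq _).2 h
    exact h2
  · intro h0
    exact hm' ((Submodule.Quotient.mk_eq_zero ((filtGt V b).submoduleOf (V b))).1 h0)

/-- Finite dimensionality of `gr^b` provides an annihilator of the class of `m`; the divisor that
keeps only eigenvalues has all its roots of real part `b`. -/
theorem exists_rootsGE (hV : IsDeligneFiltration D V) {b : ℝ} {m : M} (hm : m ∈ V b) :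
    ∃ p, RootsGE b p ∧ aeval D.θ p m ∈ filtGt V b := by
  have := hV.finite_gr b
  have hst : ∀ p : ℂ[X], aeval D.θ p m ∈ V b := fun p =>
    aeval_mem (A := toComplex (V b)) D.θ (fun _ => theta_mem _) p hm
  let f : ℂ[X] →ₗ[ℂ] Gr V b :=
    { toFun := fun p => Submodule.Quotient.mk ⟨aeval D.θ p m, hst p⟩
      map_add' := fun p p' => by
        rw [← Submodule.Quotient.mk_add]
        congr 1
        ext
        simp
      map_smul' := fun c p => by
        rw [RingHom.id_apply, ← Submodule.Quotient.mk_smul]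
        congr 1
        ext
        simp }
  have hf : ¬ Function.Injective f := fun h => by
    have := Module.Finite.of_injective f h
    exact Polynomial.not_finite this
  rw [← LinearMap.ker_eq_bot, Submodule.eq_bot_iff] at hf
  push Not at hf
  obtain ⟨p, hp, hp0⟩ := hf
  have hpm : aeval D.θ p m ∈ filtGt V b :=
    (Submodule.Quotient.mk_eq_zero ((filtGt V b).submoduleOf (V b))).1 (LinearMap.mem_ker.1 hp)
  obtain ⟨g, hg0, -, hgm, hgr⟩ :=
    exists_annihilator_eigenvalues D.θ (toComplex (filtGt V b)) m hp0 hpm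
  refine ⟨g, ⟨hg0, fun β hβ => ?_⟩, hgm⟩
  obtain ⟨h, h1, h2⟩ := hgr β hβ
  exact (hV.re_eq (hst h) h1 h2).ge

theorem zpow_smul_mem (hV : IsDeligneFiltration D V) (n : ℤ) (b : ℝ) (m : M) :
    coordX ^ n • m ∈ V (b + n) ↔ m ∈ V b := by
  have h1 : ∀ (k : ℕ) (b : ℝ) (m : M), coordX ^ k • m ∈ V (b + k) ↔ m ∈ V b := by
    intro k
    induction k with
    | zero => simp
    | succ k ih =>
      intro b m
      rw [pow_succ', mul_smul, Nat.cast_succ, ← add_assoc, hV.mul_x, ih]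
  obtain ⟨k, rfl | rfl⟩ := n.eq_nat_or_neg
  · simpa using h1 k b m
  · rw [← h1 k, smul_smul, ← zpow_natCast, ← zpow_add₀ coordX_ne_zero]
    simp

theorem exists_smul_mem_iff (hV : IsDeligneFiltration D V) {a : ConvLaurent} (ha : a ≠ 0) :
    ∃ n : ℤ, ∀ (b : ℝ) (m : M), a • m ∈ V (b + n) ↔ m ∈ V b := by
  obtain ⟨n, u, rfl, hu, hu'⟩ := exists_eq_zpow_mul ha
  have hu0 : u ≠ 0 := right_ne_zero_of_mul ha
  refine ⟨n, fun b m => ?_⟩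
  rw [mul_smul, hV.zpow_smul_mem]
  refine ⟨fun h => ?_, conv_smul_mem _ hu⟩
  have := conv_smul_mem _ hu' h
  rwa [smul_smul, inv_mul_cancel₀ hu0, one_smul] at this

theorem mem_of_forall_lt (hV : IsDeligneFiltration D V) {b : ℝ} {m : M}
    (h : ∀ c < b, m ∈ V c) : m ∈ V b := by
  rw [← hV.left_continuous b, Submodule.mem_iInf]
  exact fun c => h c c.2

/-- An element outside of `V^b` lies in a last step of the filtration. -/
theorem exists_order (hV : IsDeligneFiltration D V) {b c : ℝ} {m : M} (hc : m ∈ V c)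
    (hb : m ∉ V b) : ∃ e, c ≤ e ∧ e < b ∧ m ∈ V e ∧ m ∉ filtGt V e := by
  have hle : ∀ e, m ∈ V e → e < b := fun e he => by
    by_contra h
    exact hb (hV.antitone (not_lt.1 h) he)
  have hbdd : BddAbove {e | m ∈ V e} := ⟨b, fun e he => (hle e he).le⟩
  -- Left continuity makes the supremum of the admissible indices attained.
  have hs : m ∈ V (sSup {e | m ∈ V e}) := by
    refine hV.mem_of_forall_lt fun d hd => ?_
    obtain ⟨e, he, hde⟩ := exists_lt_of_lt_csSup ⟨c, hc⟩ hd
    exact hV.antitone hde.le he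
  refine ⟨sSup {e | m ∈ V e}, le_csSup hbdd hc, hle _ hs, hs, fun h => ?_⟩
  obtain ⟨d, hd, hmd⟩ := (mem_filtGt hV.antitone).1 h
  exact absurd (le_csSup hbdd hmd) (not_le.2 hd)

/-- The index `b` is a jump of the filtration. -/
def IsJump (V : ℝ → Submodule (LogOps D) M) (b : ℝ) : Prop := ∃ m ∈ V b, m ∉ filtGt V b

/-- Vectors whose orders are distinct jumps in `[0, 1)` are linearly independent over the field: a
nonzero scalar shifts orders by an integer, so the terms of a linear relation have distinct orders
and the one of least order cannot cancel. -/
theorem finite_jumps_Ico_one [FiniteDimensional ConvLaurent M] (hV : IsDeligneFiltration D V) :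
    {e | e ∈ Set.Ico (0 : ℝ) 1 ∧ IsJump V e}.Finite := by
  choose m hm hm' using fun e : {e | e ∈ Set.Ico (0 : ℝ) 1 ∧ IsJump V e} => e.2.2
  rw [← Set.finite_coe_iff]
  refine LinearIndependent.finite_of_isNoetherian (R := ConvLaurent) (v := m) ?_
  rw [linearIndependent_iff']
  intro s a hsum
  by_contra hne
  push Not at hne
  choose! n hn using fun (a : ConvLaurent) (ha : a ≠ 0) => hV.exists_smul_mem_iff ha
  classical
  obtain ⟨i, hi, hmin⟩ := Finset.exists_min_image (s.filter fun i => a i ≠ 0)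
    (fun i => (i : ℝ) + n (a i)) (by
      obtain ⟨i, hi, h⟩ := hne
      exact ⟨i, Finset.mem_filter.2 ⟨hi, h⟩⟩)
  obtain ⟨his, hai⟩ := Finset.mem_filter.1 hi
  have h1 : a i • m i ∈ filtGt V (i + n (a i)) := by
    rw [← Finset.add_sum_erase s _ his] at hsum
    rw [eq_neg_of_add_eq_zero_left hsum]
    refine Submodule.neg_mem _ (Submodule.sum_mem _ fun j hj => ?_)
    obtain ⟨hji, hjs⟩ := Finset.mem_erase.1 hj
    by_cases haj : a j = 0
    · rw [haj, zero_smul]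
      exact zero_mem _
    refine (mem_filtGt hV.antitone).2 ⟨j + n (a j), lt_of_le_of_ne
      (hmin j (Finset.mem_filter.2 ⟨hjs, haj⟩)) fun heq => hji ?_, (hn _ haj _ _).2 (hm j)⟩
    -- Equal orders would make `j - i` an integer in `(-1, 1)`, hence zero.
    have b1 := i.2.1
    have b2 := j.2.1
    have h3 : ((n (a i) - n (a j) : ℤ) : ℝ) = (j : ℝ) - i := by push_cast; linarith
    have h4 : ((n (a i) - n (a j) : ℤ) : ℝ) < 1 := by rw [h3]; linarith [b1.1, b2.2]
    have h5 : (-1 : ℝ) < ((n (a i) - n (a j) : ℤ) : ℝ) := by rw [h3]; linarith [b1.2, b2.1]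
    have h6 : n (a i) - n (a j) = 0 := by
      have h4' : n (a i) - n (a j) < 1 := by exact_mod_cast h4
      have h5' : -1 < n (a i) - n (a j) := by exact_mod_cast h5
      omega
    rw [h6] at h3
    exact Subtype.ext (by push_cast at h3; linarith)
  obtain ⟨d, hd, hmd⟩ := (mem_filtGt hV.antitone).1 h1
  refine hm' i ((mem_filtGt hV.antitone).2 ⟨d - n (a i), by linarith, ?_⟩)
  rw [← hn _ hai, sub_add_cancel]
  exact hmd

theorem isJump_add_int (hV : IsDeligneFiltration D V) {b : ℝ} (n : ℤ) (h : IsJump V b) :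
    IsJump V (b + n) := by
  obtain ⟨m, hm, hm'⟩ := h
  refine ⟨coordX ^ n • m, (hV.zpow_smul_mem n b m).2 hm, fun h => hm' ?_⟩
  obtain ⟨d, hd, hmd⟩ := (mem_filtGt hV.antitone).1 h
  refine (mem_filtGt hV.antitone).2 ⟨d - n, by linarith, ?_⟩
  rwa [← hV.zpow_smul_mem n, sub_add_cancel]

/-- Jumps are invariant under integer translations, so those of a bounded interval come from `[0,
1)` by finitely many translations. -/
theorem finite_jumps [FiniteDimensional ConvLaurent M] (hV : IsDeligneFiltration D V) (b : ℝ)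
    (k : ℕ) : {e | e ∈ Set.Ico b (b + k) ∧ IsJump V e}.Finite := by
  refine Set.Finite.subset ((Set.finite_Icc ⌊b⌋ ⌊b + k⌋).biUnion fun n _ =>
    (hV.finite_jumps_Ico_one.image fun e => e + (n : ℝ))) ?_
  rintro e ⟨⟨h1, h2⟩, h3⟩
  refine Set.mem_biUnion (x := ⌊e⌋) ⟨Int.floor_mono h1, Int.floor_mono h2.le⟩
    ⟨e - ⌊e⌋, ⟨⟨Int.fract_nonneg e, Int.fract_lt_one e⟩, ?_⟩, sub_add_cancel _ _⟩
  simpa [sub_eq_add_neg] using hV.isJump_add_int (-⌊e⌋) h3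

/-- Each application of `exists_rootsGE` moves the vector past one jump, and only finitely many
jumps lie between `b` and `b + k`; the induction is on the number of those still ahead. -/
theorem exists_rootsGE_add [FiniteDimensional ConvLaurent M] (hV : IsDeligneFiltration D V) {b : ℝ}
    (k : ℕ) {m : M} (hm : m ∈ V b) : ∃ p, RootsGE b p ∧ aeval D.θ p m ∈ V (b + k) := by
  have key : ∀ (N : ℕ) (c : ℝ) (m : M), b ≤ c → m ∈ V c →
      {e | e ∈ Set.Ico b (b + k) ∧ IsJump V e ∧ c ≤ e}.ncard = N →
      ∃ p, RootsGE b p ∧ aeval D.θ p m ∈ V (b + k) := by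
    intro N
    induction N using Nat.strong_induction_on with
    | _ N ih =>
      intro c m hbc hmc hN
      by_cases hmk : m ∈ V (b + k)
      · exact ⟨1, rootsGE_one b, by simpa⟩
      obtain ⟨e, hce, hek, hme, hme'⟩ := hV.exists_order hmc hmk
      obtain ⟨p, hp, hpm⟩ := hV.exists_rootsGE hme
      obtain ⟨d, hed, hpd⟩ := (mem_filtGt hV.antitone).1 hpm
      -- The order `e` is a jump that is counted from `c` but no longer from `d > e`.
      obtain ⟨p', hp', hpm'⟩ := ih _ (by
        rw [← hN]
        refine Set.ncard_lt_ncard ?_ ((hV.finite_jumps b k).subset fun x hx => ⟨hx.1, hx.2.1⟩)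
        refine ⟨fun x hx => ⟨hx.1, hx.2.1, (hce.trans hed.le).trans hx.2.2⟩, fun h => ?_⟩
        have := (h ⟨⟨hbc.trans hce, hek⟩, ⟨m, hme, hme'⟩, hce⟩ : e ∈ _).2.2
        exact absurd this (not_le.2 hed)) d _ ((hbc.trans hce).trans hed.le) hpd rfl
      exact ⟨p' * p, hp'.mul (hp.mono (hbc.trans hce)), by
        rwa [map_mul, Module.End.mul_apply]⟩
  exact key _ b m le_rfl hm rfl

theorem exists_le (hV : IsDeligneFiltration D V) {W : Submodule (LogOps D) M} (hW : W.FG) :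
    ∃ c, W ≤ V c := by
  obtain ⟨s, rfl⟩ := hW
  have h1 : ∀ m : M, ∃ c, m ∈ V c := fun m => by
    have : m ∈ ⨆ b, V b := by rw [hV.exhaustive]; trivial
    rwa [Submodule.mem_iSup_of_directed _ (hV.antitone.directed_le)] at this
  choose c hc using h1
  obtain ⟨d, hd⟩ := (s.finite_toSet.image c).bddBelow
  exact ⟨d, Submodule.span_le.2 fun m hm => hV.antitone (hd ⟨m, hm, rfl⟩) (hc m)⟩

/-- Finite generation gives an inclusion up to a shift of index, which multiplication by `x ^ k`
propagates. The shift is then removed by comparing eigenvalues: order `e < b` in `V'` would produce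
an eigenvalue of real part `e` among the roots of a polynomial whose roots have real part at least
`b`. -/
theorem le [FiniteDimensional ConvLaurent M] (hV : IsDeligneFiltration D V)
    (hV' : IsDeligneFiltration D V') (b : ℝ) : V b ≤ V' b := by
  obtain ⟨c, hc⟩ := hV'.exists_le (hV.fg b)
  have hck : ∀ k : ℕ, V (b + k) ≤ V' (c + k) := fun k m hm => by
    have := hV.zpow_smul_mem (-k) (b + k) m
    have := hV'.zpow_smul_mem (-k) (c + k) m
    simp only [Int.cast_neg, Int.cast_natCast, add_neg_cancel_right] at *
    rw [← this]
    refine hc ?_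
    rwa [‹_ ∈ V b ↔ _›]
  intro m hm
  -- With `k ≥ b - c`, the step `V (b + k)` lies in `V' (c + k)`, hence in `V' b`.
  obtain ⟨k, hk⟩ := exists_nat_ge (b - c)
  obtain ⟨p, hp, hpm⟩ := hV.exists_rootsGE_add k hm
  have hpm' : aeval D.θ p m ∈ V' b := hV'.antitone (by linarith) (hck k hpm)
  by_contra hmb
  obtain ⟨e, -, heb, hme, hme'⟩ := hV'.exists_order (hc hm) hmb
  obtain ⟨β, hβ, h, h1, h2⟩ := exists_eigenvector D.θ (A := toComplex (filtGt V' e)) hme' hp.1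
    ((mem_filtGt hV'.antitone).2 ⟨b, heb, hpm'⟩)
  have := hV'.re_eq (aeval_mem (A := toComplex (V' e)) D.θ (fun _ => theta_mem _) h hme) h1 h2
  linarith [hp.2 β hβ]

theorem unique [FiniteDimensional ConvLaurent M] (hV : IsDeligneFiltration D V)
    (hV' : IsDeligneFiltration D V') : V = V' :=
  funext fun b => le_antisymm (hV.le hV' b) (hV'.le hV b)

end IsDeligneFiltration

end DeligneUnique

/-! ### Logarithmic lattices -/

section Lattices

open Polynomial

variable {R : Type*} [AddCommGroup R] [Module ℂ⸨X⸩ R]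

theorem formal_smul_mem (L : Submodule FormalPower R) {g : ℂ⸨X⸩} (hg : g ∈ FormalPower) {m : R}
    (hm : m ∈ L) : g • m ∈ L :=
  L.smul_mem ⟨g, hg⟩ hm

/-- The lattice `y ^ n L`. -/
def shift (L : Submodule FormalPower R) (n : ℤ) : Submodule FormalPower R where
  carrier := {m | yPow (-n) • m ∈ L}
  add_mem' h h' := by
    rw [Set.mem_ofPred_eq, smul_add]
    exact L.add_mem h h'
  zero_mem' := by rw [Set.mem_ofPred_eq, smul_zero]; exact L.zero_mem
  smul_mem' g m h := by
    rw [Set.mem_ofPred_eq, Subring.smul_def, smul_comm]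
    exact formal_smul_mem L g.2 h

variable {L L' : Submodule FormalPower R}

theorem mem_shift {n : ℤ} {m : R} : m ∈ shift L n ↔ yPow (-n) • m ∈ L := Iff.rfl

theorem shift_zero : shift L 0 = L := by
  ext m
  rw [mem_shift, neg_zero, yPow_zero, one_smul]

theorem yPow_smul_mem_shift {k n : ℤ} {m : R} : yPow k • m ∈ shift L n ↔ m ∈ shift L (n - k) := by
  rw [mem_shift, mem_shift, smul_smul, yPow_mul]
  ring_nf

theorem shift_shift (n k : ℤ) : shift (shift L n) k = shift L (n + k) := by
  ext m
  rw [mem_shift, yPow_smul_mem_shift, sub_neg_eq_add]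

theorem shift_anti {n n' : ℤ} (h : n ≤ n') : shift L n' ≤ shift L n := fun m hm => by
  have := formal_smul_mem L (yPow_mem (sub_nonneg.2 h)) (mem_shift.1 hm)
  rw [smul_smul, yPow_mul] at this
  rw [mem_shift]
  convert this using 3
  ring

theorem shift_mono (h : L ≤ L') (n : ℤ) : shift L n ≤ shift L' n := fun _ hm => h hm

theorem mem_shift_one_iff {m : R} : m ∈ shift L 1 ↔ ∃ m' ∈ L, m = yPow 1 • m' := by
  constructor
  · intro h
    exact ⟨_, h, by rw [smul_smul, yPow_mul_neg, one_smul]⟩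
  · rintro ⟨m', hm', rfl⟩
    rw [yPow_smul_mem_shift, sub_self, shift_zero]
    exact hm'

theorem exists_mem_shift (hL : Submodule.span ℂ⸨X⸩ (L : Set R) = ⊤) (m : R) :
    ∃ T : ℕ, m ∈ shift L (-T) := by
  have hm : m ∈ Submodule.span ℂ⸨X⸩ (L : Set R) := by rw [hL]; trivial
  induction hm using Submodule.span_induction with
  | mem m hm => exact ⟨0, by simpa [shift_zero] using hm⟩
  | zero => exact ⟨0, zero_mem _⟩
  | add m m' _ _ h h' =>
    obtain ⟨T, hT⟩ := h
    obtain ⟨T', hT'⟩ := h'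
    exact ⟨max T T', add_mem (shift_anti (by simp) hT) (shift_anti (by simp) hT')⟩
  | smul g m _ h =>
    obtain ⟨T, hT⟩ := h
    refine ⟨T + g.order.natAbs, ?_⟩
    have := formal_smul_mem L (yPow_mul_mem (n := g.order.natAbs) (f := g) (by omega)) hT
    rw [mem_shift]
    convert this using 1
    rw [smul_smul, smul_smul, mul_right_comm, yPow_mul]
    congr 3
    push_cast
    ring

theorem exists_le_shift (hL : Submodule.span ℂ⸨X⸩ (L : Set R) = ⊤) (hL' : L'.FG) :
    ∃ T : ℕ, L' ≤ shift L (-T) := by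
  obtain ⟨s, rfl⟩ := hL'
  choose T hT using exists_mem_shift hL
  exact ⟨s.sup T, Submodule.span_le.2 fun m hm =>
    shift_anti (neg_le_neg (by exact_mod_cast Finset.le_sup hm)) (hT m)⟩

set_option synthInstance.maxHeartbeats 200000 in
/-- A lattice is separated for the `y`-adic topology. -/
theorem eq_zero_of_forall_mem_shift (hL : L.FG) {m : R} (h : ∀ n : ℕ, m ∈ shift L n) : m = 0 := by
  let I : Ideal FormalPower := Ideal.span {⟨yPow 1, yPow_mem zero_le_one⟩}
  have hI : ∀ n : ℕ, ∀ m ∈ shift L n, m ∈ (I ^ n • L : Submodule FormalPower R) := by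
    intro n m hm
    have h1 : (⟨yPow 1, yPow_mem zero_le_one⟩ : FormalPower) ^ n ∈ I ^ n :=
      Ideal.pow_mem_pow (Ideal.mem_span_singleton_self _) n
    have h2 := Submodule.smul_mem_smul h1 (mem_shift.1 hm)
    convert h2 using 1
    rw [Subring.smul_def, smul_smul]
    simp [HahnSeries.single_pow]
  have hne : I ≠ ⊤ := by
    rw [Ne, Ideal.span_singleton_eq_top]
    rintro ⟨u, hu⟩
    have h1 := congrArg Subtype.val (Units.mul_inv u)
    rw [hu] at h1
    have h2 := congrArg (fun f : ℂ⸨X⸩ => f.coeff 0) h1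
    change (yPow 1 * ((u⁻¹ : FormalPowerˣ) : FormalPower).1).coeff 0 = (1 : ℂ⸨X⸩).coeff 0 at h2
    rw [HahnSeries.coeff_single_mul, mem_formalPower_iff.1 (Subtype.property _) _ (by norm_num)]
      at h2
    simp at h2
  have hFG : Module.Finite FormalPower L := Module.Finite.iff_fg.2 hL
  have : IsLocalRing FormalPower :=
    (LaurentSeries.powerSeriesEquivSubring ℂ).isLocalRing
  -- Krull's intersection theorem for the proper ideal generated by `y` in the Noetherian local ring
  -- `ℂ[[y]]`.
  have h0 := Ideal.iInf_pow_smul_eq_bot_of_isLocalRing (M := L) I hne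
  have hmL : m ∈ L := by simpa [shift_zero] using h 0
  have h3 : (⟨m, hmL⟩ : L) ∈ (⨅ i : ℕ, I ^ i • (⊤ : Submodule FormalPower L)) := by
    rw [Submodule.mem_iInf]
    intro n
    have h4 := hI n m (h n)
    have h5 : (I ^ n • L : Submodule FormalPower R) = (I ^ n • (⊤ : Submodule FormalPower L)).map L.subtype := by
      rw [Submodule.map_smul'', Submodule.map_top, Submodule.range_subtype]
    rw [h5] at h4
    obtain ⟨x, hx, hxm⟩ := h4
    rwa [show x = ⟨m, hmL⟩ from Subtype.ext hxm] at hx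
  rw [h0, Submodule.mem_bot] at h3
  exact congrArg Subtype.val h3

variable [Module ℂ R] [IsScalarTower ℂ ℂ⸨X⸩ R]

theorem theta_yPow_smul (D : Connection eulerFormal R) (n : ℤ) (m : R) :
    D.θ (yPow n • m) = yPow n • D.θ m + (n : ℂ) • yPow n • m := by
  rw [D.leibniz, eulerFormal_yPow, smul_assoc, add_comm]

/-- The complex vector space underlying a `ℂ[[y]]`-submodule. -/
def latticeSpace (L : Submodule FormalPower R) : Submodule ℂ R where
  carrier := L
  add_mem' := L.add_mem
  zero_mem' := L.zero_mem
  smul_mem' c m hm := by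
    rw [← algebraMap_smul ℂ⸨X⸩ c m]
    exact formal_smul_mem L (algebraMap_mem_formalPower c) hm

theorem mem_latticeSpace {m : R} : m ∈ latticeSpace L ↔ m ∈ L := Iff.rfl

theorem complex_smul_mem (L : Submodule FormalPower R) (c : ℂ) {m : R} (hm : m ∈ L) : c • m ∈ L :=
  (latticeSpace L).smul_mem c hm

/-- The quotient `L / y ^ n L` is finite dimensional. -/
theorem exists_finiteDimensional_sup (hL : L.FG) (n : ℕ) :
    ∃ F : Submodule ℂ R, FiniteDimensional ℂ F ∧ F ≤ latticeSpace L ∧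
      latticeSpace L ≤ F ⊔ latticeSpace (shift L n) := by
  have h1 : ∃ F : Submodule ℂ R, FiniteDimensional ℂ F ∧ F ≤ latticeSpace L ∧
      latticeSpace L ≤ F ⊔ latticeSpace (shift L 1) := by
    obtain ⟨s, hs⟩ := hL
    refine ⟨Submodule.span ℂ s, FiniteDimensional.span_finset ℂ s, Submodule.span_le.2 fun m hm =>
      mem_latticeSpace.2 (hs ▸ Submodule.subset_span hm), fun m hm => ?_⟩
    rw [mem_latticeSpace, ← hs] at hm
    induction hm using Submodule.span_induction with
    | mem m hm => exact Submodule.mem_sup_left (Submodule.subset_span hm)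
    | zero => exact zero_mem _
    | add m m' _ _ h h' => exact add_mem h h'
    | smul g m hm h =>
      obtain ⟨c, g', hg', hg⟩ := exists_eq_add_yPow_mul g.2
      rw [Subring.smul_def, hg, add_smul, algebraMap_smul, mul_smul]
      refine add_mem (Submodule.smul_mem _ _ h) (Submodule.mem_sup_right ?_)
      rw [mem_latticeSpace, mem_shift_one_iff]
      exact ⟨_, formal_smul_mem L hg' (hs ▸ hm), rfl⟩
  obtain ⟨F₁, hF₁, hF₁L, hLF₁⟩ := h1
  induction n with
  | zero =>
    refine ⟨⊥, inferInstance, bot_le, ?_⟩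
    rw [Nat.cast_zero, shift_zero]
    exact le_sup_right
  | succ n ih =>
    obtain ⟨F, hF, hFL, hLF⟩ := ih
    -- `L = F₁ + y L` and `L = F + y ^ n L` modulo each other give `L = F₁ + y F + y ^ (n + 1) L`.
    refine ⟨F₁ ⊔ F.map (Algebra.lsmul ℂ ℂ R (yPow 1)), inferInstance, sup_le hF₁L ?_,
      hLF₁.trans (sup_le (le_sup_left.trans le_sup_left) ?_)⟩
    · rintro _ ⟨m, hm, rfl⟩
      exact formal_smul_mem L (yPow_mem zero_le_one) (hFL hm)
    · intro m hm
      obtain ⟨m', hm', rfl⟩ := mem_shift_one_iff.1 hm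
      obtain ⟨f, hf, l, hl, rfl⟩ := Submodule.mem_sup.1 (hLF hm')
      rw [smul_add]
      refine add_mem (Submodule.mem_sup_left (Submodule.mem_sup_right ⟨f, hf, rfl⟩))
        (Submodule.mem_sup_right ?_)
      rw [mem_latticeSpace, yPow_smul_mem_shift]
      rw [mem_latticeSpace] at hl
      convert hl using 2
      push_cast
      ring

variable {D : Connection eulerFormal R}

theorem theta_mem_shift (hL : ∀ m ∈ L, D.θ m ∈ L) {n : ℤ} {m : R} (hm : m ∈ shift L n) :
    D.θ m ∈ shift L n := by
  have h1 := hL _ hm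
  rw [theta_yPow_smul] at h1
  have h2 := complex_smul_mem L ((-n : ℤ) : ℂ) hm
  have := L.sub_mem h1 h2
  rwa [add_sub_cancel_right] at this

theorem aeval_mem_shift (hL : ∀ m ∈ L, D.θ m ∈ L) {n : ℤ} (p : ℂ[X]) {m : R}
    (hm : m ∈ shift L n) : aeval D.θ p m ∈ shift L n :=
  aeval_mem (A := latticeSpace (shift L n)) D.θ (fun _ => theta_mem_shift hL) p hm

/-- The eigenvalues of the residue, that is of `y∂_y` on `L / y L`. -/
def IsResidue (D : Connection eulerFormal R) (L : Submodule FormalPower R) (β : ℂ) : Prop :=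
  ∃ m ∈ L, m ∉ shift L 1 ∧ D.θ m - β • m ∈ shift L 1

/-- Multiplication by `y ^ (-n)` maps `y ^ n L` onto `L` and lowers the eigenvalues of `y∂_y` by
`n`. -/
theorem IsResidue.of_shift {n : ℤ} {β : ℂ} (h : IsResidue D (shift L n) β) :
    IsResidue D L (β - n) := by
  obtain ⟨m, hm, hm', h⟩ := h
  rw [shift_shift] at hm' h
  refine ⟨yPow (-n) • m, hm, ?_, ?_⟩
  · rwa [yPow_smul_mem_shift, sub_neg_eq_add, add_comm]
  · rw [theta_yPow_smul]
    have : yPow (-n) • D.θ m + ((-n : ℤ) : ℂ) • yPow (-n) • m - (β - n) • yPow (-n) • m =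
        yPow (-n) • (D.θ m - β • m) := by
      rw [smul_sub, smul_comm _ β]
      push_cast
      module
    rwa [this, yPow_smul_mem_shift, sub_neg_eq_add, add_comm]

/-- All residue eigenvalues are roots of a single polynomial in `y∂_y` sending `L` into `y L`. The
sum of the absolute real parts of its roots is a crude bound. -/
theorem exists_residue_bound (hL : IsLogLattice D L) :
    ∃ B : ℕ, ∀ β, IsResidue D L β → |β.re| ≤ B := by
  obtain ⟨F, hF, hFL, hLF⟩ := exists_finiteDimensional_sup hL.fg 1
  have hst : ∀ m ∈ latticeSpace (shift L 1), D.θ m ∈ latticeSpace (shift L 1) := fun _ =>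
    theta_mem_shift hL.stable
  obtain ⟨p, hp, h⟩ := exists_aeval_mem_uniform D.θ (A := latticeSpace (shift L 1))
    (B := latticeSpace L) hst hL.stable hFL hLF
  obtain ⟨B, hB⟩ := exists_nat_ge (∑ β ∈ p.roots.toFinset, |β.re|)
  refine ⟨B, fun β ⟨m, hm, hm', hmβ⟩ => le_trans ?_ hB⟩
  have hβ : p.IsRoot β := isRoot_of_eigenvector D.θ hst hm' hmβ (h m hm)
  exact Finset.single_le_sum (f := fun β : ℂ => |β.re|) (fun _ _ => abs_nonneg _)
    (Multiset.mem_toFinset.2 ((mem_roots hp).2 hβ))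

theorem isLogLattice_shift (hL : IsLogLattice D L) (n : ℤ) : IsLogLattice D (shift L n) where
  fg := by
    have : shift L n = L.map ((LinearMap.lsmul ℂ⸨X⸩ R (yPow n)).restrictScalars FormalPower) := by
      ext m
      constructor
      · intro h
        exact ⟨_, h, by
          simp [smul_smul]⟩
      · rintro ⟨m, hm, rfl⟩
        change yPow n • m ∈ _
        rw [yPow_smul_mem_shift, sub_self, shift_zero]
        exact hm
    rw [this]
    exact hL.fg.map _
  span_eq_top := by
    rw [eq_top_iff, ← hL.span_eq_top, Submodule.span_le]
    intro m hm
    have h1 : yPow n • m ∈ shift L n := by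
      rw [yPow_smul_mem_shift, sub_self, shift_zero]
      exact hm
    have h2 := Submodule.smul_mem _ (yPow (-n)) (Submodule.subset_span (R := ℂ⸨X⸩) h1)
    rwa [smul_smul, yPow_neg_mul, one_smul] at h2
  stable _ hm := theta_mem_shift hL.stable hm

end Lattices

/-! ### The Deligne lattices of a formal regular singular connection -/

section DeligneLattices

open Polynomial

theorem isDeligneLattice_iff {R : Type*} [AddCommGroup R] [Module ℂ R]
    [Module ℂ⸨X⸩ R] {D : Connection eulerFormal R} {L : Submodule FormalPower R} {b : ℝ} :
    IsDeligneLattice D b L ↔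
    IsLogLattice D L ∧ ∀ β, IsResidue D L β → b ≤ β.re ∧ β.re < b + 1 := by
  constructor
  · intro h
    refine ⟨h.toIsLogLattice, fun β ⟨m, hm, h1, h2⟩ => h.residue_re β m hm ?_ ?_⟩
    · rwa [← mem_shift_one_iff]
    · rwa [← mem_shift_one_iff]
  · rintro ⟨h, hr⟩
    refine ⟨h, fun β m hm h1 h2 => hr β ⟨m, hm, ?_, ?_⟩⟩
    · rwa [mem_shift_one_iff]
    · rwa [mem_shift_one_iff]

variable {R : Type*} [AddCommGroup R] [Module ℂ R] [Module ℂ⸨X⸩ R] [IsScalarTower ℂ ℂ⸨X⸩ R]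
  {D : Connection eulerFormal R} {L L' : Submodule FormalPower R}

theorem aeval_yPow_smul (D : Connection eulerFormal R) (n : ℤ) (p : ℂ[X]) (m : R) :
    aeval D.θ (p.comp (X - C (n : ℂ))) (yPow n • m) = yPow n • aeval D.θ p m :=
  aeval_comp_apply D.θ D.θ (Algebra.lsmul ℂ ℂ R (yPow n)) n (fun m => theta_yPow_smul D n m) p m

/-- The elements which are sent arbitrarily deep in the lattice `L` by polynomials in `y∂_y` whose
roots have real part at least `b`. -/
def regularPart (hL : IsLogLattice D L) (b : ℝ) : Submodule FormalPower R where
  carrier := {m | ∀ N : ℕ, ∃ p, RootsGE b p ∧ aeval D.θ p m ∈ shift L N}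
  zero_mem' N := ⟨1, rootsGE_one b, by rw [map_zero]; exact zero_mem _⟩
  add_mem' {m m'} h h' N := by
    obtain ⟨p, hp, hm⟩ := h N
    obtain ⟨p', hp', hm'⟩ := h' N
    refine ⟨p' * p, hp'.mul hp, ?_⟩
    rw [map_add]
    refine add_mem ?_ ?_
    · rw [map_mul, Module.End.mul_apply]
      exact aeval_mem_shift hL.stable p' hm
    · rw [mul_comm, map_mul, Module.End.mul_apply]
      exact aeval_mem_shift hL.stable p hm'
  smul_mem' g m h := by
    -- Here `T` is the depth that `m` lacks in order to lie in `y ^ N L`. Writing `g = c + y g'`,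
    -- the vector `y m` lacks one step less and keeps the property, since its polynomials are
    -- translated by `1` and their roots move to the right.
    have key : ∀ (T N : ℕ), ∀ g ∈ FormalPower, ∀ m : R, m ∈ shift L (N - T) →
        (∀ N : ℕ, ∃ p, RootsGE b p ∧ aeval D.θ p m ∈ shift L N) →
        ∃ p, RootsGE b p ∧ aeval D.θ p (g • m) ∈ shift L N := by
      intro T N
      induction T with
      | zero =>
        intro g hg m hm _
        refine ⟨1, rootsGE_one b, ?_⟩
        rw [map_one, Module.End.one_apply]
        exact formal_smul_mem _ hg (by simpa using hm)
      | succ T ih =>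
        intro g hg m hm h
        obtain ⟨c, g', hg', rfl⟩ := exists_eq_add_yPow_mul hg
        obtain ⟨p, hp, hpm⟩ := ih g' hg' (yPow 1 • m) (by
          rw [yPow_smul_mem_shift]
          convert hm using 2
          push_cast
          ring) fun N => by
            obtain ⟨p, hp, hpm⟩ := h N
            refine ⟨p.comp (X - C ((1 : ℤ) : ℂ)), (hp.comp_X_sub_C _).mono (by simp), ?_⟩
            rw [aeval_yPow_smul]
            exact formal_smul_mem _ (yPow_mem zero_le_one) hpm
        obtain ⟨p', hp', hpm'⟩ := h N
        refine ⟨p' * p, hp'.mul hp, ?_⟩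
        rw [add_smul, mul_comm (yPow 1), mul_smul, map_add, algebraMap_smul, map_smul]
        refine add_mem (complex_smul_mem _ c ?_) ?_
        · rw [mul_comm, map_mul, Module.End.mul_apply]
          exact aeval_mem_shift hL.stable p hpm'
        · rw [map_mul, Module.End.mul_apply]
          exact aeval_mem_shift hL.stable p' hpm
    intro N
    obtain ⟨T, hT⟩ := exists_mem_shift hL.span_eq_top m
    exact key (T + N) N g g.2 m (by convert hT using 2; push_cast; ring) h

theorem aeval_mem_of_stable (hL : ∀ m ∈ L, D.θ m ∈ L) (p : ℂ[X]) {m : R} (hm : m ∈ L) :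
    aeval D.θ p m ∈ L :=
  aeval_mem (A := latticeSpace L) D.θ hL p hm

theorem regularPart_stable (hL : IsLogLattice D L) (b : ℝ) {m : R} (hm : m ∈ regularPart hL b) :
    D.θ m ∈ regularPart hL b := fun N => by
  obtain ⟨p, hp, h⟩ := hm N
  refine ⟨p, hp, ?_⟩
  have : aeval D.θ p (D.θ m) = D.θ (aeval D.θ p m) := by
    have h1 : aeval D.θ (p * X) m = aeval D.θ (X * p) m := by rw [mul_comm]
    simpa [Module.End.mul_apply] using h1
  rw [this]
  exact theta_mem_shift hL.stable h

theorem regularPart_antitone (hL : IsLogLattice D L) : Antitone (regularPart hL) :=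
  fun _ _ hbc _ hm N => by
    obtain ⟨p, hp, h⟩ := hm N
    exact ⟨p, hp.mono hbc, h⟩

theorem yPow_smul_mem_regularPart (hL : IsLogLattice D L) (n : ℤ) (b : ℝ) (m : R) :
    yPow n • m ∈ regularPart hL (b + n) ↔ m ∈ regularPart hL b := by
  have key : ∀ (n : ℤ) (b : ℝ) (m : R), m ∈ regularPart hL b →
      yPow n • m ∈ regularPart hL (b + n) := by
    intro n b m hm N
    obtain ⟨p, hp, h⟩ := hm (N + n.natAbs)
    refine ⟨p.comp (X - C (n : ℂ)), by simpa using hp.comp_X_sub_C n, ?_⟩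
    rw [aeval_yPow_smul, yPow_smul_mem_shift]
    exact shift_anti (by omega) h
  refine ⟨fun h => ?_, key n b m⟩
  have := key (-n) _ _ h
  rwa [smul_smul, yPow_neg_mul, one_smul, Int.cast_neg, add_neg_cancel_right] at this

/-- Left continuity of the filtration by the Deligne lattices. -/
theorem mem_regularPart_of_forall_lt (hL : IsLogLattice D L) {b : ℝ} {m : R}
    (h : ∀ c < b, m ∈ regularPart hL c) : m ∈ regularPart hL b := by
  intro N
  obtain ⟨p, hp, hpm⟩ := h (b - 1) (by linarith) N
  obtain ⟨g, hg0, -, hgm, hgr⟩ :=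
    exists_annihilator_eigenvalues D.θ (latticeSpace (shift L N)) m hp.1 hpm
  refine ⟨g, ⟨hg0, fun β hβ => le_of_forall_lt fun c hc => ?_⟩, hgm⟩
  obtain ⟨d, hcd, hdb⟩ := exists_between hc
  refine hcd.trans_le ?_
  -- A root `β` of `g` is an eigenvalue modulo `y ^ N L`, hence a root of the polynomial attached to
  -- every `d < b`; so its real part is at least each such `d`.
  obtain ⟨p', hp', hpm'⟩ := h d hdb N
  obtain ⟨r, hr, hrβ⟩ := hgr β hβ
  refine hp'.2 β (isRoot_of_eigenvector D.θ (fun _ => theta_mem_shift hL.stable) hr hrβ ?_)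
  rw [← Module.End.mul_apply, ← map_mul, mul_comm, map_mul, Module.End.mul_apply]
  exact aeval_mem_shift hL.stable r hpm'

/-- A polynomial whose roots are residue eigenvalues sends a given vector of `L` into `y L`. Its
translate by `N` passes from `y ^ N L` to `y ^ (N + 1) L`, with roots moved to the right. -/
theorem le_regularPart (hL : IsLogLattice D L) {b : ℝ}
    (h : ∀ β, IsResidue D L β → b ≤ β.re) : L ≤ regularPart hL b := by
  have step : ∀ m ∈ L, ∃ p, RootsGE b p ∧ aeval D.θ p m ∈ shift L 1 := fun m hm => by
    obtain ⟨F, hF, hFL, hLF⟩ := exists_finiteDimensional_sup hL.fg 1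
    obtain ⟨p, hp, hpm⟩ := exists_aeval_mem D.θ (A := latticeSpace (shift L 1))
      (B := latticeSpace L) hL.stable hLF hm
    obtain ⟨g, hg0, -, hgm, hgr⟩ := exists_annihilator_eigenvalues D.θ _ m hp hpm
    refine ⟨g, ⟨hg0, fun β hβ => h β ?_⟩, hgm⟩
    obtain ⟨r, hr, hrβ⟩ := hgr β hβ
    exact ⟨_, aeval_mem_of_stable hL.stable r hm, hr, hrβ⟩
  intro m hm N
  induction N with
  | zero => exact ⟨1, rootsGE_one b, by simpa [shift_zero] using hm⟩
  | succ N ih =>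
    obtain ⟨p, hp, hpm⟩ := ih
    obtain ⟨p', hp', hpm'⟩ := step _ hpm
    refine ⟨p'.comp (X - C ((N : ℤ) : ℂ)) * p,
      ((hp'.comp_X_sub_C _).mono (by simp)).mul hp, ?_⟩
    have h1 : aeval D.θ p m = yPow N • yPow (-N) • aeval D.θ p m := by
      rw [smul_smul, yPow_mul_neg, one_smul]
    rw [map_mul, Module.End.mul_apply, h1, aeval_yPow_smul, yPow_smul_mem_shift]
    convert hpm' using 2
    push_cast
    ring

/-- A vector in `y ^ (-k-1) L` but not in `y ^ (-k) L` yields an eigenvalue of the residue of `y ^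
(-k-1) L`. Its real part is less than `b - k`, yet it is a root of a polynomial whose roots have
real part at least `b`. -/
theorem regularPart_le (hL : IsLogLattice D L) {b : ℝ}
    (h : ∀ β, IsResidue D L β → β.re < b + 1) : regularPart hL b ≤ L := by
  have key : ∀ k : ℕ, ∀ m ∈ regularPart hL b, m ∈ shift L (-k) → m ∈ L := by
    intro k
    induction k with
    | zero => intro m _ hm; simpa [shift_zero] using hm
    | succ k ih =>
      intro m hm hmk
      refine ih m hm ?_
      by_contra hc
      obtain ⟨p, hp, hpm⟩ := hm 0
      obtain ⟨β, hβ, r, hr, hrβ⟩ := exists_eigenvector D.θ (A := latticeSpace (shift L (-k))) hc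
        hp.1 (shift_anti (by simp) hpm)
      have h2 : shift (shift L (-(k + 1 : ℕ))) 1 = shift L (-k) := by
        rw [shift_shift]
        congr 1
        push_cast
        ring
      have h1 : IsResidue D (shift L (-(k + 1 : ℕ))) β :=
        ⟨_, aeval_mem_shift hL.stable r hmk, by rwa [h2], by rw [h2]; exact hrβ⟩
      have h3 := h _ h1.of_shift
      have h4 := hp.2 β hβ
      simp at h3
      have h5 : (0 : ℝ) ≤ k := Nat.cast_nonneg k
      linarith
  intro m hm
  obtain ⟨T, hT⟩ := exists_mem_shift hL.span_eq_top m
  exact key T m hm hT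

variable {R' : Type*} [AddCommGroup R'] [Module ℂ R'] [Module ℂ⸨X⸩ R'] [IsScalarTower ℂ ℂ⸨X⸩ R']
  {D' : Connection eulerFormal R'} {L₁ : Submodule FormalPower R'}

/-- Maps of bounded order which commute with `y∂_y` are compatible with the regular parts. -/
theorem map_mem_regularPart (hL : IsLogLattice D L) (hL₁ : IsLogLattice D' L₁) (f : R →ₗ[ℂ] R')
    (hf : ∀ m, D'.θ (f m) = f (D.θ m)) (T : ℕ)
    (hT : ∀ (n : ℤ), ∀ m ∈ shift L n, f m ∈ shift L₁ (n - T)) {b : ℝ} {m : R}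
    (hm : m ∈ regularPart hL b) : f m ∈ regularPart hL₁ b := by
  intro N
  obtain ⟨p, hp, hpm⟩ := hm (N + T)
  refine ⟨p, hp, ?_⟩
  have h1 := aeval_comp_apply D.θ D'.θ f 0 (by simpa using hf) p m
  rw [C_0, sub_zero, comp_X] at h1
  rw [h1]
  have h2 := hT _ _ hpm
  push_cast at h2
  rwa [add_sub_cancel_right] at h2

/-- Two lattices are commensurable, so the identity has bounded order from one to the other. This is
what makes the regular part intrinsic. -/
theorem regularPart_le_regularPart (hL : IsLogLattice D L) (hL' : IsLogLattice D L') (b : ℝ) :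
    regularPart hL b ≤ regularPart hL' b := by
  obtain ⟨T, hT⟩ := exists_le_shift hL'.span_eq_top hL.fg
  intro m hm
  refine map_mem_regularPart hL hL' LinearMap.id (fun _ => rfl) T (fun n m hm => ?_) hm
  have := shift_mono hT n hm
  rwa [shift_shift, add_comm, ← sub_eq_add_neg] at this

theorem regularPart_eq (hL : IsLogLattice D L) (hL' : IsLogLattice D L') (b : ℝ) :
    regularPart hL b = regularPart hL' b :=
  le_antisymm (regularPart_le_regularPart hL hL' b) (regularPart_le_regularPart hL' hL b)

/-- The regular part may be computed from `y ^ T L`, whose residue eigenvalues have real part at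
least `T - B`. -/
theorem exists_shift_le_regularPart (hL : IsLogLattice D L) (b : ℝ) :
    ∃ T : ℕ, shift L T ≤ regularPart hL b := by
  obtain ⟨B, hB⟩ := exists_residue_bound hL
  obtain ⟨T, hT⟩ := exists_nat_ge (b + B)
  refine ⟨T, ?_⟩
  rw [regularPart_eq hL (isLogLattice_shift hL T)]
  refine le_regularPart _ fun β hβ => ?_
  have h1 := hB _ hβ.of_shift
  simp at h1
  linarith [neg_le_of_abs_le h1]

theorem exists_regularPart_le_shift (hL : IsLogLattice D L) (b : ℝ) :
    ∃ T : ℕ, regularPart hL b ≤ shift L (-T) := by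
  obtain ⟨B, hB⟩ := exists_residue_bound hL
  obtain ⟨T, hT⟩ := exists_nat_gt (B - b)
  refine ⟨T, ?_⟩
  rw [regularPart_eq hL (isLogLattice_shift hL (-T))]
  refine regularPart_le _ fun β hβ => ?_
  have h1 := hB _ hβ.of_shift
  simp at h1
  linarith [le_of_abs_le h1]

/-- The regular part is caught between two shifts of `L`, and `ℂ[[y]]` is Noetherian. -/
theorem isLogLattice_regularPart (hL : IsLogLattice D L) (b : ℝ) :
    IsLogLattice D (regularPart hL b) where
  fg := by
    obtain ⟨T, hT⟩ := exists_regularPart_le_shift hL b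
    exact (isLogLattice_shift hL (-T)).fg.of_le hT
  span_eq_top := by
    obtain ⟨T, hT⟩ := exists_shift_le_regularPart hL b
    rw [eq_top_iff, ← (isLogLattice_shift hL T).span_eq_top]
    exact Submodule.span_mono hT
  stable _ hm := regularPart_stable hL b hm

theorem shift_regularPart (hL : IsLogLattice D L) (b : ℝ) (n : ℤ) :
    shift (regularPart hL b) n = regularPart hL (b + n) := by
  ext m
  rw [mem_shift, ← yPow_smul_mem_regularPart hL (-n) (b + n)]
  simp

/-- An eigenvector of `y∂_y` modulo a later step of the filtration. -/
theorem mem_regularPart_of_eigenvector (hL : IsLogLattice D L) {b c : ℝ} {m : R} {β : ℂ}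
    (hm : m ∈ regularPart hL b) (hmβ : D.θ m - β • m ∈ regularPart hL c) (hβ : β.re < b) :
    m ∈ regularPart hL c := by
  obtain ⟨T, hT⟩ := exists_shift_le_regularPart hL c
  obtain ⟨p, hp, hpm⟩ := hm T
  by_contra hc
  have := hp.2 β (isRoot_of_eigenvector D.θ (A := latticeSpace (regularPart hL c))
    (fun _ => regularPart_stable hL c) hc hmβ (hT hpm))
  linarith

/-- The factor `X - β` has an admissible root, so it can be added to the polynomials of `(θ - β) m`.
-/
theorem mem_regularPart_of_re_ge (hL : IsLogLattice D L) {c : ℝ} {m : R} {β : ℂ}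
    (hmβ : D.θ m - β • m ∈ regularPart hL c) (hβ : c ≤ β.re) : m ∈ regularPart hL c := by
  intro N
  obtain ⟨p, hp, hpm⟩ := hmβ N
  refine ⟨p * (X - C β), hp.mul (rootsGE_X_sub_C hβ), ?_⟩
  rw [map_mul, Module.End.mul_apply]
  simpa using hpm

/-- Existence and uniqueness of the Deligne lattice of index `b`. -/
theorem deligneLattice_eq (hL : IsLogLattice D L) (b : ℝ) :
    deligneLattice D b = regularPart hL b := by
  refine le_antisymm (sSup_le fun L' hL' => ?_) (le_sSup ?_)
  -- The regular part may be computed from the Deligne lattice `L'` itself.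
  · obtain ⟨h, hr⟩ := isDeligneLattice_iff.1 hL'
    rw [regularPart_eq hL h]
    exact le_regularPart h fun β hβ => (hr β hβ).1
  · refine isDeligneLattice_iff.2 ⟨isLogLattice_regularPart hL b, ?_⟩
    rintro β ⟨m, hm, hm', hβ⟩
    rw [shift_regularPart, Int.cast_one] at hm' hβ
    constructor
    · by_contra hc
      exact hm' (mem_regularPart_of_eigenvector hL hm hβ (not_le.1 hc))
    · by_contra hc
      exact hm' (mem_regularPart_of_re_ge hL hβ (not_lt.1 hc))

/-! The resulting properties of the Deligne lattices. -/

theorem isLogLattice_deligneLattice (hD : IsRegularSingular D) (b : ℝ) :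
    IsLogLattice D (deligneLattice D b) := by
  obtain ⟨L, hL⟩ := hD
  rw [deligneLattice_eq hL]
  exact isLogLattice_regularPart hL b

theorem deligneLattice_antitone (hD : IsRegularSingular D) : Antitone (deligneLattice D) := by
  obtain ⟨L, hL⟩ := hD
  intro b c h
  rw [deligneLattice_eq hL, deligneLattice_eq hL]
  exact regularPart_antitone hL h

theorem yPow_smul_mem_deligneLattice (hD : IsRegularSingular D) (n : ℤ) (b : ℝ) (m : R) :
    yPow n • m ∈ deligneLattice D (b + n) ↔ m ∈ deligneLattice D b := by
  obtain ⟨L, hL⟩ := hD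
  rw [deligneLattice_eq hL, deligneLattice_eq hL]
  exact yPow_smul_mem_regularPart hL n b m

theorem shift_deligneLattice (hD : IsRegularSingular D) (b : ℝ) (n : ℤ) :
    shift (deligneLattice D b) n = deligneLattice D (b + n) := by
  obtain ⟨L, hL⟩ := hD
  rw [deligneLattice_eq hL, deligneLattice_eq hL, shift_regularPart]

theorem exists_mem_deligneLattice (hD : IsRegularSingular D) (m : R) :
    ∃ b, m ∈ deligneLattice D b := by
  obtain ⟨T, hT⟩ := exists_mem_shift (isLogLattice_deligneLattice hD 0).span_eq_top m
  rw [shift_deligneLattice hD] at hT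
  exact ⟨_, hT⟩

theorem mem_deligneLattice_of_forall_lt (hD : IsRegularSingular D) {b : ℝ} {m : R}
    (h : ∀ c < b, m ∈ deligneLattice D c) : m ∈ deligneLattice D b := by
  obtain ⟨L, hL⟩ := hD
  rw [deligneLattice_eq hL]
  refine mem_regularPart_of_forall_lt hL fun c hc => ?_
  rw [← deligneLattice_eq hL]
  exact h c hc

/-- This is the eigenvalue condition on the graded pieces: a class of `gr^b` with an eigenvalue of
another real part vanishes. -/
theorem exists_mem_deligneLattice_of_eigenvector (hD : IsRegularSingular D) {b c : ℝ} (hbc : b < c)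
    {m : R} {β : ℂ} (hm : m ∈ deligneLattice D b) (hβ : D.θ m - β • m ∈ deligneLattice D c)
    (hne : β.re ≠ b) : ∃ d, b < d ∧ m ∈ deligneLattice D d := by
  obtain ⟨L, hL⟩ := hD
  simp only [deligneLattice_eq hL] at *
  rcases lt_or_gt_of_ne hne with h | h
  · exact ⟨c, hbc, mem_regularPart_of_eigenvector hL hm hβ h⟩
  · exact ⟨min c β.re, lt_min hbc h, mem_regularPart_of_re_ge hL
      (regularPart_antitone hL (min_le_left _ _) hβ) (min_le_right _ _)⟩

/-! ### Semilinear maps between regular singular connections. -/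

section Rotation

variable {ζ : ℂˣ}

/-- A bound on finitely many generators of `L` suffices, because rotations preserve `ℂ[[y]]` and
multiply `y ^ n` by a nonzero constant. -/
theorem exists_map_mem_shift {R : Type*} [AddCommGroup R] [Module ℂ R] [Module ℂ⸨X⸩ R]
    {L : Submodule FormalPower R} (hL : L.FG)
    (hL₁ : Submodule.span ℂ⸨X⸩ (L₁ : Set R') = ⊤) (f : R →ₗ[ℂ] R')
    (hsmul : ∀ (g : ℂ⸨X⸩) m, f (g • m) = rotateFormal ζ g • f m) :
    ∃ T : ℕ, ∀ (n : ℤ), ∀ m ∈ shift L n, f m ∈ shift L₁ (n - T) := by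
  obtain ⟨s, hs⟩ := hL
  choose T hT using exists_mem_shift hL₁
  have h1 : ∀ m ∈ L, f m ∈ shift L₁ (-(s.sup fun m => T (f m) : ℕ)) := by
    intro m hm
    rw [← hs] at hm
    induction hm using Submodule.span_induction with
    | mem m hm =>
      refine shift_anti (neg_le_neg ?_) (hT (f m))
      exact_mod_cast Finset.le_sup (f := fun m => T (f m)) hm
    | zero => rw [map_zero]; exact zero_mem _
    | add m m' _ _ h h' => rw [map_add]; exact add_mem h h'
    | smul g m _ h =>
      rw [Subring.smul_def, hsmul]
      exact formal_smul_mem _ (rotate_mem ζ g.2) h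
  refine ⟨s.sup fun m => T (f m), fun n m hm => ?_⟩
  have h2 := h1 _ (mem_shift.1 hm)
  rw [hsmul, rotateFormal_yPow, smul_assoc] at h2
  have h3 := complex_smul_mem _ (((ζ ^ (-n) : ℂˣ)⁻¹ : ℂˣ) : ℂ) h2
  rw [smul_smul, Units.inv_mul, one_smul, yPow_smul_mem_shift] at h3
  convert h3 using 2
  ring

set_option linter.unusedSectionVars false in
/-- A semilinear map between connections twisted by different exponents, compatible with `y∂_y`,
vanishes. -/
theorem eq_zero_of_twist (hL : IsLogLattice D L) (hL₁ : IsLogLattice D' L₁) (f : R →ₗ[ℂ] R')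
    (hsmul : ∀ (g : ℂ⸨X⸩) m, f (g • m) = rotateFormal ζ g • f m) {χ : ℂ⸨X⸩} (hχ0 : χ ≠ 0)
    (hχ : χ.order < 0) (hf : ∀ m, f (D.θ m) - D'.θ (f m) = χ • f m) : f = 0 := by
  obtain ⟨T, hT⟩ := exists_map_mem_shift hL.fg hL₁.span_eq_top f hsmul
  -- Since `f = χ⁻¹ (f θ - θ' f)` and `χ⁻¹` has positive order, each use of the relation gains one
  -- power of `y`. The values of `f` on `L` thus lie in every `y ^ n L₁`.
  have key : ∀ (k : ℕ), ∀ m ∈ L, f m ∈ shift L₁ (k - T) := by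
    intro k
    induction k with
    | zero =>
      intro m hm
      exact hT 0 m (by rwa [shift_zero])
    | succ k ih =>
      intro m hm
      have h1 := sub_mem (ih _ (hL.stable m hm)) (theta_mem_shift hL₁.stable (ih m hm))
      rw [hf] at h1
      have h2 := formal_smul_mem _ (inv_mul_mem hχ0 hχ) h1
      rw [smul_smul, mul_assoc, inv_mul_cancel₀ hχ0, mul_one, yPow_smul_mem_shift] at h2
      convert h2 using 2
      push_cast
      ring
  have h0 : ∀ m ∈ L, f m = 0 := fun m hm => eq_zero_of_forall_mem_shift hL₁.fg fun n => by
    have := key (n + T) m hm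
    push_cast at this
    rwa [add_sub_cancel_right] at this
  ext m
  obtain ⟨k, hk⟩ := exists_mem_shift hL.span_eq_top m
  have h1 := h0 _ (mem_shift.1 hk)
  rw [hsmul, rotateFormal_yPow, smul_assoc] at h1
  have h2 := congrArg (fun v => (((ζ ^ (- -(k : ℤ)) : ℂˣ)⁻¹ : ℂˣ) : ℂ) • v) h1
  simp only [smul_smul, smul_zero, Units.inv_mul, one_smul] at h2
  have h3 := congrArg (fun v => yPow (-k) • v) h2
  simpa [smul_smul] using h3

/-- Either `χ = 0`, and `f` commutes with the operators and has bounded order, or `f` vanishes. -/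
theorem map_mem_deligneLattice (hD : IsRegularSingular D) (hD' : IsRegularSingular D')
    (f : R →ₗ[ℂ] R') (hsmul : ∀ (g : ℂ⸨X⸩) m, f (g • m) = rotateFormal ζ g • f m) {χ : ℂ⸨X⸩}
    (hχ : χ = 0 ∨ χ.order < 0) (hf : ∀ m, f (D.θ m) - D'.θ (f m) = χ • f m) {b : ℝ} {m : R}
    (hm : m ∈ deligneLattice D b) : f m ∈ deligneLattice D' b := by
  obtain ⟨L, hL⟩ := hD
  obtain ⟨L₁, hL₁⟩ := hD'
  by_cases h0 : χ = 0
  · subst h0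
    rw [deligneLattice_eq hL] at hm
    rw [deligneLattice_eq hL₁]
    obtain ⟨T, hT⟩ := exists_map_mem_shift hL.fg hL₁.span_eq_top f hsmul
    refine map_mem_regularPart hL hL₁ f (fun m => ?_) T hT hm
    exact (sub_eq_zero.1 ((hf m).trans (zero_smul ℂ⸨X⸩ (f m)))).symm
  · rw [eq_zero_of_twist hL hL₁ f hsmul h0 (hχ.resolve_left h0) hf]
    exact zero_mem _

end Rotation

/-- In a nontrivially twisted connection, `y∂_y` recovers one more step of the filtration. -/
theorem exists_eq_theta_add (hD : IsRegularSingular D) {χ : ℂ⸨X⸩} (hχ0 : χ ≠ 0) (hχ : χ.order < 0)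
    {b : ℝ} {m : R} (hm : m ∈ deligneLattice D b) :
    ∃ m₀ ∈ deligneLattice D (b + 1), ∃ m₁ ∈ deligneLattice D (b + 1),
      m = (D.θ m₀ + χ • m₀) + m₁ := by
  -- The witnesses are `m₀ = χ⁻¹ m` and `m₁ = -θ m₀`; dividing by `χ` raises the index by at least
  -- one.
  have h1 : χ⁻¹ • m ∈ deligneLattice D (b + 1) := by
    have h2 := formal_smul_mem _ (inv_mul_mem hχ0 hχ) hm
    rw [← yPow_smul_mem_deligneLattice hD 1, smul_smul, ← mul_assoc, yPow_mul_neg, one_mul,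
      Int.cast_one] at h2
    exact h2
  refine ⟨_, h1, _, neg_mem ((isLogLattice_deligneLattice hD (b + 1)).stable _ h1), ?_⟩
  rw [smul_smul, mul_inv_cancel₀ hχ0, one_smul]
  abel

end DeligneLattices

/-! ### Elementary formal connections -/

section Polar

theorem polarPart_coeff (φ : Polynomial ℂ) (n : ℤ) :
    (polarPart φ).coeff n = if n ≤ 0 then φ.coeff n.natAbs else 0 := by
  induction φ using Polynomial.induction_on' with
  | add p p' h h' =>
    rw [polarPart, map_add, HahnSeries.coeff_add]
    change (polarPart p).coeff n + (polarPart p').coeff n = _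
    rw [h, h', Polynomial.coeff_add]
    split_ifs <;> simp
  | monomial k a =>
    rw [polarPart, Polynomial.aeval_monomial, HahnSeries.single_pow, ← Algebra.smul_def,
      HahnSeries.coeff_smul, HahnSeries.coeff_single, Polynomial.coeff_monomial]
    simp only [nsmul_eq_mul, mul_neg, mul_one, one_pow, smul_eq_mul]
    split_ifs <;> first | omega | simp

theorem coeff_euler_polarPart (φ : Polynomial ℂ) {n : ℤ} (hn : 0 ≤ n) :
    (eulerFormal (polarPart φ)).coeff n = 0 := by
  rw [eulerFormal_coeff, polarPart_coeff]
  split_ifs with h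
  · rw [le_antisymm h hn, Int.cast_zero, zero_mul]
  · rw [mul_zero]

theorem eq_zero_or_order_neg {f : ℂ⸨X⸩} (hf : ∀ n : ℤ, 0 ≤ n → f.coeff n = 0) :
    f = 0 ∨ f.order < 0 := by
  by_contra! h
  exact h.1 (HahnSeries.coeff_order_eq_zero.1 (hf _ h.2))

/-- `y∂_y` kills only constants, and `φ` has no constant term. -/
theorem euler_polarPart_ne_zero {φ : Polynomial ℂ} (h0 : φ.coeff 0 = 0) (hφ : φ ≠ 0) :
    eulerFormal (polarPart φ) ≠ 0 := by
  intro h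
  refine hφ (Polynomial.ext fun k => ?_)
  rcases Nat.eq_zero_or_pos k with rfl | hk
  · exact h0
  · have h1 := congrArg (fun f : ℂ⸨X⸩ => f.coeff (-k)) h
    simp only [eulerFormal_coeff, polarPart_coeff, HahnSeries.coeff_zero] at h1
    rw [if_pos (by omega), mul_eq_zero] at h1
    rcases h1 with h1 | h1
    · rw [Int.cast_eq_zero] at h1
      omega
    · simpa using h1

end Polar

/-! ### Lattices in an elementary model. -/

namespace ElementaryModel

variable {W : Type*} [AddCommGroup W] [Module ℂ W] [Module ℂ⸨X⸩ W] {D : Connection eulerFormal W}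
  (E : ElementaryModel D)

theorem iso_theta (z : W) (φ : E.Φ) : E.iso (D.θ z) φ =
    (E.conn φ).θ (E.iso z φ) + eulerFormal (polarPart φ) • E.iso z φ := by
  rw [E.iso_conn]
  rfl

/-- The lattice `P^b(W)`. -/
def parabolicLattice (b : ℝ) : Submodule FormalPower W where
  carrier := E.parabolicFormal b
  add_mem' {z w} hz hw φ := by
    rw [map_add]
    exact add_mem (hz φ) (hw φ)
  zero_mem' φ := by rw [map_zero]; exact zero_mem _
  smul_mem' g z hz φ := by
    rw [Subring.smul_def, map_smul]
    exact formal_smul_mem _ g.2 (hz φ)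

/-- The sum of the lattice `V^b R_0` and of all the irregular summands. -/
def regularLattice (b : ℝ) : Submodule FormalPower W where
  carrier := {z | ∀ φ : E.Φ, (φ : Polynomial ℂ) = 0 → E.iso z φ ∈ deligneLattice (E.conn φ) b}
  add_mem' {z w} hz hw φ h := by
    rw [map_add]
    exact add_mem (hz φ h) (hw φ h)
  zero_mem' φ _ := by rw [map_zero]; exact zero_mem _
  smul_mem' g z hz φ h := by
    rw [Subring.smul_def, map_smul]
    exact formal_smul_mem _ g.2 (hz φ h)

variable {E}

theorem mem_parabolicLattice {b : ℝ} {z : W} :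
    z ∈ E.parabolicLattice b ↔ ∀ φ, E.iso z φ ∈ deligneLattice (E.conn φ) b := Iff.rfl

theorem mem_regularLattice {b : ℝ} {z : W} : z ∈ E.regularLattice b ↔
    ∀ φ : E.Φ, (φ : Polynomial ℂ) = 0 → E.iso z φ ∈ deligneLattice (E.conn φ) b := Iff.rfl

variable (E)

theorem parabolicLattice_antitone : Antitone E.parabolicLattice :=
  fun _ _ h _ hz φ => deligneLattice_antitone (E.regular φ) h (hz φ)

theorem regularLattice_antitone : Antitone E.regularLattice :=
  fun _ _ h _ hz φ hφ => deligneLattice_antitone (E.regular φ) h (hz φ hφ)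

theorem parabolicLattice_le_regularLattice (b : ℝ) :
    E.parabolicLattice b ≤ E.regularLattice b :=
  fun _ hz φ _ => hz φ

theorem yPow_smul_mem_parabolicLattice (n : ℤ) (b : ℝ) (z : W) :
    yPow n • z ∈ E.parabolicLattice (b + n) ↔ z ∈ E.parabolicLattice b := by
  simp only [mem_parabolicLattice, map_smul, Pi.smul_apply,
    fun φ => yPow_smul_mem_deligneLattice (E.regular φ) n b]

theorem yPow_smul_mem_regularLattice (n : ℤ) (b : ℝ) (z : W) :
    yPow n • z ∈ E.regularLattice (b + n) ↔ z ∈ E.regularLattice b := by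
  simp only [mem_regularLattice, map_smul, Pi.smul_apply,
    fun φ => yPow_smul_mem_deligneLattice (E.regular φ) n b]

theorem exists_mem_parabolicLattice (z : W) : ∃ b, z ∈ E.parabolicLattice b := by
  choose b hb using fun φ => exists_mem_deligneLattice (E.regular φ) (E.iso z φ)
  obtain ⟨c, hc⟩ := (Set.finite_range b).bddBelow
  exact ⟨c, fun φ => deligneLattice_antitone (E.regular φ) (hc ⟨φ, rfl⟩) (hb φ)⟩

theorem mem_regularLattice_of_forall_lt {b : ℝ} {z : W} (h : ∀ c < b, z ∈ E.regularLattice c) :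
    z ∈ E.regularLattice b :=
  fun φ hφ => mem_deligneLattice_of_forall_lt (E.regular φ) fun c hc => h c hc φ hφ

theorem iso_theta_of_eq_zero {φ : E.Φ} (hφ : (φ : Polynomial ℂ) = 0) (z : W) :
    E.iso (D.θ z) φ = (E.conn φ).θ (E.iso z φ) := by
  have : polarPart (φ : Polynomial ℂ) = 0 := by rw [hφ, polarPart, map_zero]
  rw [iso_theta, this, map_zero, zero_smul ℂ⸨X⸩ (E.iso z φ), add_zero]

theorem theta_mem_regularLattice {b : ℝ} {z : W} (hz : z ∈ E.regularLattice b) :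
    D.θ z ∈ E.regularLattice b := fun φ hφ => by
  rw [E.iso_theta_of_eq_zero hφ]
  exact (isLogLattice_deligneLattice (E.regular φ) b).stable _ (hz φ hφ)

/-- The operator `y∂_y` has bounded order for the parabolic filtration. -/
theorem exists_theta_mem : ∃ K : ℕ, ∀ (b : ℝ), ∀ z ∈ E.parabolicLattice b,
    D.θ z ∈ E.parabolicLattice (b - K) := by
  obtain ⟨K, hK⟩ := (Set.finite_range fun φ : E.Φ =>
    (eulerFormal (polarPart φ)).order.natAbs).bddAbove
  refine ⟨K, fun b z hz φ => ?_⟩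
  rw [iso_theta]
  refine add_mem (deligneLattice_antitone (E.regular φ) (by simp)
    ((isLogLattice_deligneLattice (E.regular φ) b).stable _ (hz φ))) ?_
  have h1 := hK ⟨φ, rfl⟩
  have h2 := formal_smul_mem _ (yPow_mul_mem (n := K) (f := eulerFormal (polarPart φ)) (by
    simp only at h1; omega)) (hz φ)
  rw [mul_smul] at h2
  rw [← yPow_smul_mem_deligneLattice (E.regular φ) K]
  simpa using h2

theorem iso_symm_single_smul [DecidableEq E.Φ] (φ : E.Φ) (g : ℂ⸨X⸩) (r : E.R φ) :
    E.iso.symm (Pi.single φ (g • r)) = g • E.iso.symm (Pi.single φ r) := by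
  rw [← map_smul, Pi.single_smul]

theorem theta_iso_symm_single [DecidableEq E.Φ] (φ : E.Φ) (r : E.R φ) :
    D.θ (E.iso.symm (Pi.single φ r)) =
      E.iso.symm (Pi.single φ ((E.conn φ).θ r + eulerFormal (polarPart φ) • r)) := by
  rw [LinearEquiv.eq_symm_apply]
  ext ψ
  rw [iso_theta, LinearEquiv.apply_symm_apply]
  by_cases h : ψ = φ
  · subst h
    simp
  · simp [h]

theorem sum_iso_symm_single [DecidableEq E.Φ] (z : W) :
    ∑ φ, E.iso.symm (Pi.single φ (E.iso z φ)) = z := by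
  rw [← map_sum, Finset.univ_sum_single, LinearEquiv.symm_apply_apply]

/-- The operators `y∂_y` generate `regularLattice` from `parabolicLattice`. -/
theorem regularLattice_le {b : ℝ} {Z : AddSubmonoid W} (hZ : ∀ z ∈ Z, D.θ z ∈ Z)
    (hP : ∀ z ∈ E.parabolicLattice b, z ∈ Z) {z : W} (hz : z ∈ E.regularLattice b) : z ∈ Z := by
  classical
  rw [← E.sum_iso_symm_single z]
  refine sum_mem fun φ _ => ?_
  have hP' : ∀ r ∈ deligneLattice (E.conn φ) b, E.iso.symm (Pi.single φ r) ∈ Z := fun r hr => by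
    refine hP _ fun ψ => ?_
    rw [LinearEquiv.apply_symm_apply]
    by_cases h : ψ = φ
    · subst h
      simpa using hr
    · simp [h]
  by_cases hφ : (φ : Polynomial ℂ) = 0
  · exact hP' _ (hz φ hφ)
  have hχ0 := euler_polarPart_ne_zero (E.coeff_zero φ φ.2) hφ
  have hχ := (eq_zero_or_order_neg fun n hn => coeff_euler_polarPart (φ : Polynomial ℂ) hn
    ).resolve_left hχ0
  -- On an irregular summand one application of `y∂_y` lowers the index by one. As the lattices
  -- exhaust `R_φ`, the whole summand is reached.
  have key : ∀ (k : ℕ), ∀ r ∈ deligneLattice (E.conn φ) (b - k),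
      E.iso.symm (Pi.single φ r) ∈ Z := by
    intro k
    induction k with
    | zero => simpa using hP'
    | succ k ih =>
      intro r hr
      obtain ⟨r₀, hr₀, r₁, hr₁, rfl⟩ := exists_eq_theta_add (E.regular φ) hχ0 hχ hr
      have hk : b - ((k + 1 : ℕ) : ℝ) + 1 = b - k := by push_cast; ring
      rw [hk] at hr₀ hr₁
      rw [Pi.single_add, map_add, ← theta_iso_symm_single]
      exact add_mem (hZ _ (ih _ hr₀)) (ih _ hr₁)
  obtain ⟨c, hc⟩ := exists_mem_deligneLattice (E.regular φ) (E.iso z φ)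
  obtain ⟨k, hk⟩ := exists_nat_ge (b - c)
  exact key k _ (deligneLattice_antitone (E.regular φ) (by linarith) hc)

/-- A rotation of `W` which commutes with `y∂_y` preserves the parabolic filtration. -/
theorem map_mem_parabolicLattice [IsScalarTower ℂ ℂ⸨X⸩ W] {ζ : ℂˣ} (σ : W →ₗ[ℂ] W)
    (hσ : ∀ (g : ℂ⸨X⸩) z, σ (g • z) = rotateFormal ζ g • σ z) (hθ : ∀ z, D.θ (σ z) = σ (D.θ z))
    {b : ℝ} {z : W} (hz : z ∈ E.parabolicLattice b) : σ z ∈ E.parabolicLattice b := by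
  classical
  intro ψ
  rw [← E.sum_iso_symm_single z, map_sum, map_sum, Finset.sum_apply]
  refine sum_mem fun φ _ => ?_
  -- The block of `σ` from `R_φ` to `R_ψ`. It commutes with the regular operators up to `y∂_y ψ`
  -- minus the rotation of `y∂_y φ`, a series with only negative powers.
  let f : E.R φ →ₗ[ℂ] E.R ψ :=
    { toFun := fun r => E.iso (σ (E.iso.symm (Pi.single φ r))) ψ
      map_add' := fun r r' => by simp only [Pi.single_add, map_add, Pi.add_apply]
      map_smul' := fun c r => by
        rw [← algebraMap_smul ℂ⸨X⸩ c r, iso_symm_single_smul, algebraMap_smul, map_smul,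
          ← algebraMap_smul ℂ⸨X⸩ c (σ _), map_smul, Pi.smul_apply, algebraMap_smul,
          RingHom.id_apply] }
  refine map_mem_deligneLattice (ζ := ζ) (E.regular φ) (E.regular ψ) f (fun g r => ?_)
    (χ := eulerFormal (polarPart ψ) - rotateFormal ζ (eulerFormal (polarPart φ)))
    (eq_zero_or_order_neg fun n hn => ?_) (fun r => ?_) (hz φ)
  · change E.iso (σ (E.iso.symm (Pi.single φ (g • r)))) ψ = _
    rw [iso_symm_single_smul, hσ, map_smul]
    rfl
  · rw [HahnSeries.coeff_sub, rotateFormal_coeff, coeff_euler_polarPart _ hn,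
      coeff_euler_polarPart _ hn, mul_zero, sub_zero]
  · have h1 := E.iso_theta (σ (E.iso.symm (Pi.single φ r))) ψ
    rw [hθ, theta_iso_symm_single, Pi.single_add, map_add, map_add, map_add, Pi.add_apply,
      iso_symm_single_smul, hσ, map_smul] at h1
    change f ((E.conn φ).θ r) + rotateFormal ζ (eulerFormal (polarPart φ)) • f r =
      (E.conn ψ).θ (f r) + eulerFormal (polarPart ψ) • f r at h1
    rw [sub_smul, sub_eq_sub_iff_add_eq_add, h1, add_comm]

/-- Linear forms have bounded poles on the parabolic lattices. -/
theorem exists_yPow_mul_mem (f : W →ₗ[ℂ⸨X⸩] ℂ⸨X⸩) (b : ℝ) :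
    ∃ T : ℕ, ∀ z ∈ E.parabolicLattice b, yPow T * f z ∈ FormalPower := by
  classical
  have h1 : ∀ φ : E.Φ, ∃ T : ℕ, ∀ r ∈ deligneLattice (E.conn φ) b,
      yPow T * f (E.iso.symm (Pi.single φ r)) ∈ FormalPower := fun φ => by
    obtain ⟨s, hs⟩ := (isLogLattice_deligneLattice (E.regular φ) b).fg
    refine ⟨s.sup fun r => (f (E.iso.symm (Pi.single φ r))).order.natAbs, fun r hr => ?_⟩
    rw [← hs] at hr
    induction hr using Submodule.span_induction with
    | mem r hr =>
      have := Finset.le_sup (f := fun r => (f (E.iso.symm (Pi.single φ r))).order.natAbs) hr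
      exact yPow_mul_mem (by omega)
    | zero => rw [Pi.single_zero, map_zero, map_zero, mul_zero]; exact zero_mem _
    | add r r' _ _ h h' =>
      rw [Pi.single_add, map_add, map_add, mul_add]
      exact add_mem h h'
    | smul g r _ h =>
      rw [Subring.smul_def, iso_symm_single_smul, map_smul, smul_eq_mul, mul_left_comm]
      exact mul_mem g.2 h
  choose T hT using h1
  refine ⟨Finset.univ.sup T, fun z hz => ?_⟩
  rw [← E.sum_iso_symm_single z, map_sum, Finset.mul_sum]
  refine sum_mem fun φ _ => ?_
  have h2 := Finset.le_sup (f := T) (Finset.mem_univ φ)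
  have h3 := mul_mem (yPow_mem (n := (Finset.univ.sup T : ℕ) - T φ) (by omega)) (hT φ _ (hz φ))
  rw [← mul_assoc, yPow_mul] at h3
  simpa using h3

end ElementaryModel

/-! ### Ramification and averaging -/

section Averaging

theorem rotate_euler (ζ : ℂˣ) (f : ℂ⸨X⸩) :
    rotateFormal ζ (eulerFormal f) = eulerFormal (rotateFormal ζ f) := by
  ext n
  rw [rotateFormal_coeff, eulerFormal_coeff, eulerFormal_coeff, rotateFormal_coeff]
  ring

variable (q : ℕ) [NeZero q]

theorem ramify_injective : Function.Injective (algebraMap ConvLaurent (Ramified q)) :=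
  (algebraMap ConvLaurent (Ramified q)).injective

/-- The coefficients of a Laurent series at the multiples of `q`. -/
def unramifySeries (f : ℂ⸨X⸩) : ℂ⸨X⸩ :=
  HahnSeries.ofSuppBddBelow (fun n => f.coeff (q * n)) ⟨min f.order 0, fun n hn => by
    by_contra h
    push Not at h
    refine hn (HahnSeries.coeff_eq_zero_of_lt_order ?_)
    have hq : (1 : ℤ) ≤ q := by exact_mod_cast NeZero.pos q
    have h1 := h.trans_le (min_le_left _ _)
    have h2 := h.trans_le (min_le_right _ _)
    nlinarith⟩

theorem unramifySeries_coeff (f : ℂ⸨X⸩) (n : ℤ) :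
    (unramifySeries q f).coeff n = f.coeff (q * n) := rfl

theorem IsConvergent.unramify {f : ℂ⸨X⸩} (hf : IsConvergent f) :
    IsConvergent (unramifySeries q f) := by
  obtain ⟨C, A, h⟩ := hf
  refine ⟨C, A ^ q, fun n => ?_⟩
  have := h (q * n)
  push_cast at this
  rwa [unramifySeries_coeff, ← pow_mul]

/-- A primitive `q`-th root of unity. -/
def primitiveRoot : rootsOfUnity q ℂ :=
  (Complex.isPrimitiveRoot_exp q (NeZero.ne q)).toRootsOfUnity

theorem sum_zpow_primitiveRoot (n : ℤ) :
    ∑ k ∈ Finset.range q, ((((primitiveRoot q ^ k : rootsOfUnity q ℂ) : ℂˣ) ^ n : ℂˣ) : ℂ) =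
      if (q : ℤ) ∣ n then (q : ℂ) else 0 := by
  have hprim := Complex.isPrimitiveRoot_exp q (NeZero.ne q)
  set z : ℂ := Complex.exp (2 * Real.pi * Complex.I / q) with hz
  have hval : (((primitiveRoot q : rootsOfUnity q ℂ) : ℂˣ) : ℂ) = z :=
    IsPrimitiveRoot.val_toRootsOfUnity_coe hprim
  have h1 : ∀ k : ℕ, ((((primitiveRoot q ^ k : rootsOfUnity q ℂ) : ℂˣ) ^ n : ℂˣ) : ℂ) =
      (z ^ n) ^ k := fun k => by
    rw [SubgroupClass.coe_pow, ← zpow_natCast, ← zpow_mul, mul_comm, zpow_mul, zpow_natCast]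
    simp [hval]
  rw [Finset.sum_congr rfl fun k _ => h1 k]
  split_ifs with h
  · rw [(hprim.zpow_eq_one_iff_dvd n).2 h]
    simp
  · have hne : z ^ n ≠ 1 := fun h' => h ((hprim.zpow_eq_one_iff_dvd n).1 h')
    rw [geom_sum_eq hne, ← zpow_natCast, ← zpow_mul, mul_comm, zpow_mul, zpow_natCast,
      hprim.pow_eq_one, one_zpow, sub_self, zero_div]

theorem sum_rotate (f : ℂ⸨X⸩) :
    ∑ k ∈ Finset.range q, rotateFormal (primitiveRoot q ^ k : rootsOfUnity q ℂ) f =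
      (q : ℂ) • ramifyFormal q (unramifySeries q f) := by
  ext n
  rw [HahnSeries.coeff_sum]
  simp only [rotateFormal_coeff]
  rw [← Finset.sum_mul, sum_zpow_primitiveRoot, HahnSeries.coeff_smul, smul_eq_mul]
  split_ifs with h
  · obtain ⟨m, rfl⟩ := h
    rw [ramifyFormal_coeff_mul, unramifySeries_coeff]
  · rw [ramifyFormal_coeff_of_not_dvd q _ n h, zero_mul, mul_zero]

/-- The average under the `q`-th roots of unity, as a function with values in `ℂ{x}[1/x]`. -/
def unramifyFun (f : Ramified q) : ConvLaurent :=
  ⟨unramifySeries q (algebraMap (Ramified q) ℂ⸨X⸩ f),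
    IsConvergent.unramify q (Subtype.property (p := fun f => f ∈ ConvLaurent) f)⟩

theorem sum_rotateRam (f : Ramified q) :
    ∑ k ∈ Finset.range q, rotateRam q (primitiveRoot q ^ k) f =
      (q : ℂ) • algebraMap ConvLaurent (Ramified q) (unramifyFun q f) := by
  apply (algebraMap (Ramified q) ℂ⸨X⸩).injective
  rw [map_sum]
  exact sum_rotate q (algebraMap (Ramified q) ℂ⸨X⸩ f)

theorem natCast_ne_zero : (q : ℂ) ≠ 0 := Nat.cast_ne_zero.2 (NeZero.ne q)

/-- The average under the `q`-th roots of unity, as a retraction of `ℂ{x}[1/x] → ℂ{y}[1/y]`. -/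
def unramify : Ramified q →ₗ[ConvLaurent] ConvLaurent where
  toFun := unramifyFun q
  map_add' f g := by
    apply ramify_injective q
    -- After multiplication by `q`, linearity is read off the sum of the rotations.
    apply smul_right_injective (Ramified q) (natCast_ne_zero q)
    simp only [map_add, smul_add, ← sum_rotateRam, Finset.sum_add_distrib]
  map_smul' a f := by
    apply ramify_injective q
    apply smul_right_injective (Ramified q) (natCast_ne_zero q)
    simp only [RingHom.id_apply, smul_eq_mul, map_mul]
    rw [← mul_smul_comm, ← sum_rotateRam, ← sum_rotateRam, Finset.mul_sum]
    exact Finset.sum_congr rfl fun k _ => by rw [map_smul, Algebra.smul_def]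

theorem sum_rotateRam_eq (f : Ramified q) :
    ∑ k ∈ Finset.range q, rotateRam q (primitiveRoot q ^ k) f =
      (q : ℂ) • algebraMap ConvLaurent (Ramified q) (unramify q f) :=
  sum_rotateRam q f

theorem unramify_one : unramify q 1 = 1 := by
  apply ramify_injective q
  apply smul_right_injective (Ramified q) (natCast_ne_zero q)
  have h : ∀ ζ, rotateRam q ζ 1 = 1 := fun ζ => Subtype.ext (map_one (rotateFormal ζ))
  simp only [← sum_rotateRam_eq, h]
  simp [Algebra.smul_def]

theorem unramify_euler (f : Ramified q) :
    unramify q (eulerRam q f) = (q : ℂ) • eulerConv (unramify q f) := by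
  refine Subtype.ext (HahnSeries.ext (funext fun n => ?_))
  change (unramifySeries q (eulerFormal (algebraMap (Ramified q) ℂ⸨X⸩ f))).coeff n =
    ((q : ℂ) • eulerFormal (unramifySeries q (algebraMap (Ramified q) ℂ⸨X⸩ f))).coeff n
  rw [unramifySeries_coeff, eulerFormal_coeff, HahnSeries.coeff_smul, eulerFormal_coeff,
    unramifySeries_coeff, smul_eq_mul]
  push_cast
  ring

variable (M : Type*) [AddCommGroup M] [Module ConvLaurent M]

/-- The projection of `π⁺M` onto `M` given by the average under the `q`-th roots of unity. -/
def descend : RamPullback q M →ₗ[ConvLaurent] M :=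
  TensorProduct.lid ConvLaurent M ∘ₗ LinearMap.rTensor M (unramify q)

instance : IsScalarTower ℂ ℂ⸨X⸩ ℂ⸨X⸩ :=
  ⟨fun c g h => by rw [smul_eq_mul, smul_eq_mul, ← HahnSeries.C_mul_eq_smul,
    ← HahnSeries.C_mul_eq_smul, mul_assoc]⟩

instance : IsScalarTower ℂ ℂ⸨X⸩ (ℂ⸨X⸩ ⊗[Ramified q] RamPullback q M) := by
  refine ⟨fun c g z => ?_⟩
  induction z using TensorProduct.induction_on with
  | zero => simp
  | add z z' h h' => simp only [smul_add, h, h']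
  | tmul g' n =>
    rw [TensorProduct.smul_tmul', TensorProduct.smul_tmul', TensorProduct.smul_tmul', smul_eq_mul,
      smul_eq_mul, smul_mul_assoc]

variable {M}

theorem descend_tmul (g : Ramified q) (m : M) :
    descend q M (g ⊗ₜ m) = unramify q g • m := by
  simp [descend]

theorem descend_one_tmul (m : M) : descend q M ((1 : Ramified q) ⊗ₜ m) = m := by
  rw [descend_tmul, unramify_one, one_smul]

theorem galoisAct_tmul (ζ : rootsOfUnity q ℂ) (g : Ramified q) (m : M) :
    galoisAct q M ζ (g ⊗ₜ m) = rotateRam q ζ g ⊗ₜ m := rfl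

theorem rotateRam_one (ζ : rootsOfUnity q ℂ) : rotateRam q ζ 1 = 1 :=
  Subtype.ext (map_one (rotateFormal ζ))

/-- Expressing the projection to `M` as a sum of rotations lets it inherit the stability of the
parabolic filtration. -/
theorem sum_galoisAct (n : RamPullback q M) :
    ∑ k ∈ Finset.range q, galoisAct q M (primitiveRoot q ^ k) n =
      (q : ℂ) • ((1 : Ramified q) ⊗ₜ[ConvLaurent] descend q M n) := by
  induction n using TensorProduct.induction_on with
  | zero => simp
  | add n n' h h' =>
    simp only [map_add, Finset.sum_add_distrib, h, h', TensorProduct.tmul_add, smul_add]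
  | tmul g m =>
    simp only [galoisAct_tmul]
    rw [← TensorProduct.sum_tmul, sum_rotateRam_eq, descend_tmul, ← TensorProduct.smul_tmul,
      TensorProduct.smul_tmul', Algebra.algebraMap_eq_smul_one]

/-- The rotation `f(y) ↦ f(ζ y)` of `ℂ{y}[1/y]`. -/
def rotateRamHom (ζ : rootsOfUnity q ℂ) : Ramified q →+* Ramified q where
  toFun := rotateRam q ζ
  map_one' := rotateRam_one q ζ
  map_mul' f g := Subtype.ext (map_mul (rotateFormal ζ) (algebraMap (Ramified q) ℂ⸨X⸩ f)
    (algebraMap (Ramified q) ℂ⸨X⸩ g))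
  map_zero' := map_zero _
  map_add' := map_add _

theorem galoisAct_smul (ζ : rootsOfUnity q ℂ) (f : Ramified q) (n : RamPullback q M) :
    galoisAct q M ζ (f • n) = rotateRamHom q ζ f • galoisAct q M ζ n := by
  induction n using TensorProduct.induction_on with
  | zero => simp
  | add n n' h h' => simp only [map_add, smul_add, h, h']
  | tmul g m =>
    rw [TensorProduct.smul_tmul', galoisAct_tmul, galoisAct_tmul, TensorProduct.smul_tmul',
      smul_eq_mul, smul_eq_mul]
    congr 1
    exact map_mul (rotateRamHom q ζ) f g

variable (M) in
/-- The action of a root of unity on the formalization of `π⁺M`. -/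
def galoisFormal (ζ : rootsOfUnity q ℂ) :
    ℂ⸨X⸩ ⊗[Ramified q] RamPullback q M →+ ℂ⸨X⸩ ⊗[Ramified q] RamPullback q M :=
  TensorProduct.liftAddHom
    { toFun := fun g =>
        { toFun := fun n => rotateFormal ζ g ⊗ₜ galoisAct q M ζ n
          map_zero' := by simp
          map_add' := fun n n' => by rw [map_add, TensorProduct.tmul_add] }
      map_zero' := by ext n; simp
      map_add' := fun g g' => by ext n; simp [TensorProduct.add_tmul] }
    (fun f g n => by
      simp only [AddMonoidHom.coe_mk, ZeroHom.coe_mk]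
      rw [galoisAct_smul, ← TensorProduct.smul_tmul, Algebra.smul_def, Algebra.smul_def, map_mul]
      rfl)

theorem galoisFormal_tmul (ζ : rootsOfUnity q ℂ) (g : ℂ⸨X⸩) (n : RamPullback q M) :
    galoisFormal q M ζ (g ⊗ₜ n) = rotateFormal ζ g ⊗ₜ galoisAct q M ζ n := rfl

theorem galoisFormal_smul (ζ : rootsOfUnity q ℂ) (g : ℂ⸨X⸩)
    (z : ℂ⸨X⸩ ⊗[Ramified q] RamPullback q M) :
    galoisFormal q M ζ (g • z) = rotateFormal ζ g • galoisFormal q M ζ z := by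
  induction z with
  | zero => simp
  | add z z' h h' => simp only [map_add, smul_add, h, h']
  | tmul g' n =>
    rw [TensorProduct.smul_tmul', galoisFormal_tmul, galoisFormal_tmul, TensorProduct.smul_tmul',
      smul_eq_mul, smul_eq_mul, map_mul]

variable [Module ℂ M] (D : Connection eulerConv M)

theorem ramPullback_tmul (g : Ramified q) (m : M) : (D.ramPullback q).θ (g ⊗ₜ m) =
    eulerRam q g ⊗ₜ[ConvLaurent] m + ((q : ℂ) • g) ⊗ₜ[ConvLaurent] D.θ m := rfl

theorem galoisAct_theta (ζ : rootsOfUnity q ℂ) (n : RamPullback q M) :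
    galoisAct q M ζ ((D.ramPullback q).θ n) = (D.ramPullback q).θ (galoisAct q M ζ n) := by
  induction n using TensorProduct.induction_on with
  | zero => simp
  | add n n' h h' => simp only [map_add, h, h']
  | tmul g m =>
    rw [ramPullback_tmul, map_add, galoisAct_tmul, galoisAct_tmul, galoisAct_tmul,
      ramPullback_tmul, LinearMap.map_smul_of_tower]
    congr 2
    exact Subtype.ext (rotate_euler ζ _)

theorem formalization_tmul (g : ℂ⸨X⸩) (n : RamPullback q M) :
    (D.ramPullback q).formalization.θ (g ⊗ₜ n) =
      eulerFormal g ⊗ₜ[Ramified q] n + g ⊗ₜ[Ramified q] (D.ramPullback q).θ n := by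
  conv_rhs => rw [← one_smul ℂ g]
  rw [one_smul]
  exact (Connection.baseChange_tmul _ 1 _ g n).trans (by rw [one_smul])

theorem galoisFormal_theta (ζ : rootsOfUnity q ℂ) (z : ℂ⸨X⸩ ⊗[Ramified q] RamPullback q M) :
    (D.ramPullback q).formalization.θ (galoisFormal q M ζ z) =
      galoisFormal q M ζ ((D.ramPullback q).formalization.θ z) := by
  induction z with
  | zero => simp
  | add z z' h h' => simp only [map_add, h, h']
  | tmul g n =>
    rw [formalization_tmul, map_add, galoisFormal_tmul, galoisFormal_tmul, galoisFormal_tmul,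
      formalization_tmul, galoisAct_theta, rotate_euler]

/-- The elements of `π⁺M` are dense in its formalization. -/
theorem exists_eq_tmul_add {D : Connection eulerConv M}
    (E : ElementaryModel (D.ramPullback q).formalization)
    (z : ℂ⸨X⸩ ⊗[Ramified q] RamPullback q M) (c : ℝ) :
    ∃ n : RamPullback q M, ∃ w ∈ E.parabolicLattice c,
      z = (1 : ℂ⸨X⸩) ⊗ₜ[Ramified q] n + w := by
  induction z with
  | zero => exact ⟨0, 0, zero_mem _, by simp⟩
  | add z z' h h' =>
    obtain ⟨n, w, hw, rfl⟩ := h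
    obtain ⟨n', w', hw', rfl⟩ := h'
    exact ⟨n + n', w + w', add_mem hw hw', by rw [TensorProduct.tmul_add]; abel⟩
  | tmul g n =>
    obtain ⟨b, hb⟩ := E.exists_mem_parabolicLattice ((1 : ℂ⸨X⸩) ⊗ₜ[Ramified q] n)
    obtain ⟨T, hT⟩ := exists_nat_ge (c - b)
    -- As `1 ⊗ n` has index `b` and `T ≥ c - b`, the remainder `y ^ T h ⊗ n` has index at least `c`.
    obtain ⟨g₀, hg₀, h, hh, rfl⟩ := exists_convergent_approx g T
    have h2 := formal_smul_mem _ hh ((E.yPow_smul_mem_parabolicLattice T b _).2 hb)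
    rw [smul_smul, TensorProduct.smul_tmul', smul_eq_mul, mul_one, mul_comm] at h2
    refine ⟨(show Ramified q from ⟨g₀, hg₀⟩) • n, _,
      E.parabolicLattice_antitone (by push_cast; linarith) h2, ?_⟩
    have h1 : (1 : ℂ⸨X⸩) ⊗ₜ[Ramified q] ((show Ramified q from ⟨g₀, hg₀⟩) • n) =
        g₀ ⊗ₜ[Ramified q] n := by
      rw [← TensorProduct.smul_tmul, Algebra.smul_def, mul_one]
      rfl
    rw [h1, TensorProduct.add_tmul]

variable {D} (E : ElementaryModel (D.ramPullback q).formalization)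

/-- The parabolic filtration of `π⁺M` is stable under the roots of unity. -/
theorem galoisAct_mem_parabolicRam (ζ : rootsOfUnity q ℂ) {b : ℝ} {n : RamPullback q M}
    (hn : (1 : ℂ⸨X⸩) ⊗ₜ[Ramified q] n ∈ E.parabolicLattice b) :
    (1 : ℂ⸨X⸩) ⊗ₜ[Ramified q] galoisAct q M ζ n ∈ E.parabolicLattice b := by
  let σ : ℂ⸨X⸩ ⊗[Ramified q] RamPullback q M →ₗ[ℂ] ℂ⸨X⸩ ⊗[Ramified q] RamPullback q M :=
    { toFun := galoisFormal q M ζ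
      map_add' := map_add _
      map_smul' := fun c z => by
        rw [← algebraMap_smul ℂ⸨X⸩ c z, galoisFormal_smul, RingHom.id_apply,
          ← algebraMap_smul ℂ⸨X⸩ c (galoisFormal q M ζ z)]
        congr 1
        ext n
        change ((_ : ℂˣ) : ℂ) * (HahnSeries.single 0 c).coeff n = (HahnSeries.single 0 c).coeff n
        rw [HahnSeries.coeff_single]
        split_ifs with h
        · simp [h]
        · rw [mul_zero] }
  have h1 : galoisFormal q M ζ ((1 : ℂ⸨X⸩) ⊗ₜ[Ramified q] n) ∈ E.parabolicLattice b :=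
    E.map_mem_parabolicLattice (ζ := ζ) σ (galoisFormal_smul q ζ) (galoisFormal_theta q D ζ) hn
  rwa [galoisFormal_tmul, map_one] at h1

/-- The average under the roots of unity preserves the parabolic filtration. -/
theorem descend_mem {b : ℝ} {n : RamPullback q M}
    (hn : (1 : ℂ⸨X⸩) ⊗ₜ[Ramified q] n ∈ E.parabolicLattice b) :
    (1 : ℂ⸨X⸩) ⊗ₜ[Ramified q] ((1 : Ramified q) ⊗ₜ[ConvLaurent] descend q M n) ∈
      E.parabolicLattice b := by
  have h1 : (1 : ℂ⸨X⸩) ⊗ₜ[Ramified q]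
      (∑ k ∈ Finset.range q, galoisAct q M (primitiveRoot q ^ k) n) ∈ E.parabolicLattice b := by
    rw [TensorProduct.tmul_sum]
    exact sum_mem fun k _ => galoisAct_mem_parabolicRam q E _ hn
  rw [sum_galoisAct, TensorProduct.tmul_smul] at h1
  have h2 := complex_smul_mem _ (q : ℂ)⁻¹ h1
  rwa [smul_smul, inv_mul_cancel₀ (natCast_ne_zero q), one_smul] at h2

variable [IsScalarTower ℂ ConvLaurent M]

theorem descend_theta (D : Connection eulerConv M) (n : RamPullback q M) :
    descend q M ((D.ramPullback q).θ n) = (q : ℂ) • D.θ (descend q M n) := by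
  induction n using TensorProduct.induction_on with
  | zero => simp
  | add n n' h h' => simp only [map_add, h, h', smul_add]
  | tmul g m =>
    rw [ramPullback_tmul, map_add, descend_tmul, descend_tmul, descend_tmul, unramify_euler,
      D.leibniz, smul_add, smul_assoc, LinearMap.map_smul_of_tower, smul_assoc]

end Averaging

/-! ### The Deligne filtration and the parabolic filtration -/

section Approximation

theorem exists_conv_eq_add {a : ConvLaurent} (ha : a ∈ ConvPower) :
    ∃ c : ℂ, ∃ u ∈ ConvPower, a = algebraMap ℂ ConvLaurent c + coordX * u := by
  obtain ⟨c, g, hg, he⟩ := exists_eq_add_yPow_mul (mem_convPower.1 ha)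
  have h1 : ((coordX⁻¹ * (a - algebraMap ℂ ConvLaurent c) : ConvLaurent) : ℂ⸨X⸩) = g := by
    change (yPow 1)⁻¹ * ((a : ℂ⸨X⸩) - algebraMap ℂ ℂ⸨X⸩ c) = g
    rw [he, add_sub_cancel_left, ← mul_assoc, inv_mul_cancel₀ (yPow_ne_zero 1), one_mul]
  refine ⟨c, coordX⁻¹ * (a - algebraMap ℂ ConvLaurent c), ?_, ?_⟩
  · rw [mem_convPower, h1]
    exact hg
  · rw [← mul_assoc, mul_inv_cancel₀ coordX_ne_zero, one_mul]
    ring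

/-- Truncations of the convergent power series belong to a finite dimensional space. -/
theorem exists_truncation (k : ℕ) : ∃ F : Submodule ℂ ConvLaurent, FiniteDimensional ℂ F ∧
    ∀ a ∈ ConvPower, ∃ f ∈ F, ∃ u ∈ ConvPower, a = f + coordX ^ k * u := by
  induction k with
  | zero => exact ⟨⊥, inferInstance, fun a ha => ⟨0, zero_mem _, a, ha, by simp⟩⟩
  | succ k ih =>
    obtain ⟨F, hF, h⟩ := ih
    refine ⟨F ⊔ Submodule.span ℂ {coordX ^ k}, inferInstance, fun a ha => ?_⟩
    obtain ⟨f, hf, u, hu, rfl⟩ := h a ha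
    obtain ⟨c, u', hu', rfl⟩ := exists_conv_eq_add hu
    refine ⟨f + c • coordX ^ k, add_mem (Submodule.mem_sup_left hf) (Submodule.mem_sup_right
      (Submodule.smul_mem _ _ (Submodule.mem_span_singleton_self _))), u', hu', ?_⟩
    rw [Algebra.smul_def]
    ring

end Approximation

/-! ### The trace on `M` of the formal filtrations. -/

section Existence

variable {M : Type*} [AddCommGroup M] [Module ConvLaurent M] {q : ℕ} [NeZero q]

variable (q M) in
/-- The embedding of `M` in the formalization of `π⁺M`. -/
def embed : M →+ ℂ⸨X⸩ ⊗[Ramified q] RamPullback q M where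
  toFun m := (1 : ℂ⸨X⸩) ⊗ₜ ((1 : Ramified q) ⊗ₜ m)
  map_zero' := by simp
  map_add' m m' := by rw [TensorProduct.tmul_add, TensorProduct.tmul_add]

theorem embed_apply (m : M) :
    embed M q m = (1 : ℂ⸨X⸩) ⊗ₜ[Ramified q] ((1 : Ramified q) ⊗ₜ[ConvLaurent] m) := rfl

theorem embed_smul (a : ConvLaurent) (m : M) :
    embed M q (a • m) = ramifyFormal q a • embed M q m := by
  have h1 : (1 : Ramified q) ⊗ₜ[ConvLaurent] (a • m) =
      algebraMap ConvLaurent (Ramified q) a • ((1 : Ramified q) ⊗ₜ[ConvLaurent] m) := by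
    rw [← TensorProduct.smul_tmul, TensorProduct.smul_tmul', Algebra.smul_def, smul_eq_mul]
  rw [embed_apply, embed_apply, h1, ← TensorProduct.smul_tmul, TensorProduct.smul_tmul',
    Algebra.smul_def]
  rfl

variable [Module ℂ M] {D : Connection eulerConv M}

theorem embed_theta (m : M) : (D.ramPullback q).formalization.θ (embed M q m) =
    (q : ℂ) • embed M q (D.θ m) := by
  rw [embed_apply, formalization_tmul, ramPullback_tmul, Derivation.map_one_eq_zero,
    Derivation.map_one_eq_zero, TensorProduct.zero_tmul, TensorProduct.zero_tmul, zero_add,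
    zero_add, ← TensorProduct.smul_tmul', TensorProduct.tmul_smul]
  rfl

theorem embed_complex_smul [IsScalarTower ℂ ConvLaurent M] (c : ℂ) (m : M) :
    embed M q (c • m) = c • embed M q m := by
  rw [← algebraMap_smul ConvLaurent c m, embed_smul, ← algebraMap_smul ℂ⸨X⸩ c (embed M q m)]
  congr 1
  exact HahnSeries.embDomainRingHom_C

theorem ramify_mem {a : ConvLaurent} (ha : a ∈ ConvPower) :
    ramifyFormal q a ∈ FormalPower := by
  rw [mem_formalPower_iff]
  intro n hn
  by_cases h : (q : ℤ) ∣ n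
  · obtain ⟨m, rfl⟩ := h
    rw [ramifyFormal_coeff_mul]
    exact mem_formalPower_iff.1 (mem_convPower.1 ha) m
      (neg_of_mul_neg_right hn (Int.natCast_nonneg q))
  · exact ramifyFormal_coeff_of_not_dvd q _ n h

theorem ramify_coordX_pow (k : ℕ) :
    ramifyFormal q ((coordX ^ k : ConvLaurent) : ℂ⸨X⸩) = yPow (q * k) := by
  have h := coe_coordX_zpow k
  rw [zpow_natCast] at h
  rw [h]
  exact HahnSeries.embDomain_single

theorem cast_pos_of_neZero (q : ℕ) [NeZero q] : (0 : ℝ) < q := Nat.cast_pos.2 (NeZero.pos q)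

variable (E : ElementaryModel (D.ramPullback q).formalization)

theorem mem_parabolic {b : ℝ} {m : M} :
    m ∈ parabolic E b ↔ embed M q m ∈ E.parabolicLattice (q * b) := by
  -- Invariance under the roots of unity is automatic for `1 ⊗ m`.
  refine ⟨fun h => h.1, fun h => ⟨h, fun ζ => ?_⟩⟩
  rw [galoisAct_tmul, rotateRam_one]

theorem exists_mem_parabolic (m : M) (b : ℝ) : ∃ T : ℕ, ∀ k, T ≤ k →
    coordX ^ k • m ∈ parabolic E b := by
  obtain ⟨c, hc⟩ := E.exists_mem_parabolicLattice (embed M q m)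
  obtain ⟨T, hT⟩ := exists_nat_ge (q * b - c)
  refine ⟨T, fun k hk => ?_⟩
  rw [mem_parabolic, embed_smul, ramify_coordX_pow]
  refine E.parabolicLattice_antitone ?_ ((E.yPow_smul_mem_parabolicLattice (q * k) c _).2 hc)
  have h1 : (T : ℝ) ≤ k := Nat.cast_le.2 hk
  have h2 : (1 : ℝ) ≤ q := Nat.one_le_cast.2 (NeZero.pos q)
  push_cast
  nlinarith [Nat.cast_nonneg (α := ℝ) k]

/-- The coordinates of the elements of `P^b(M)` have bounded poles. -/
theorem exists_pow_mul_repr_mem {ι : Type*} (e : Module.Basis ι ConvLaurent M) (i : ι) (b : ℝ) :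
    ∃ T : ℕ, ∀ m ∈ parabolic E b, coordX ^ T * e.repr m i ∈ ConvPower := by
  let f : RamPullback q M →ₗ[Ramified q] Ramified q :=
    LinearMap.liftBaseChange (Ramified q) (Algebra.linearMap ConvLaurent (Ramified q) ∘ₗ e.coord i)
  let g : ℂ⸨X⸩ ⊗[Ramified q] RamPullback q M →ₗ[ℂ⸨X⸩] ℂ⸨X⸩ :=
    LinearMap.liftBaseChange ℂ⸨X⸩ (Algebra.linearMap (Ramified q) ℂ⸨X⸩ ∘ₗ f)
  have hg : ∀ m : M, g (embed M q m) = ramifyFormal q (e.repr m i) := fun m => by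
    simp only [g, f, embed_apply, LinearMap.liftBaseChange_tmul, one_smul, LinearMap.comp_apply,
      Algebra.linearMap_apply, Module.Basis.coord_apply]
    rfl
  obtain ⟨T, hT⟩ := E.exists_yPow_mul_mem g (q * b)
  refine ⟨T, fun m hm => ?_⟩
  have h1 := hT _ ((mem_parabolic E).1 hm)
  rw [hg, mem_formalPower_iff] at h1
  have h2 := coe_coordX_zpow T
  rw [zpow_natCast] at h2
  rw [mem_convPower, MulMemClass.coe_mul, h2, mem_formalPower_iff]
  intro n hn
  -- The index `T + q (n - T) = q n - (q - 1) T` is negative, so the bound `T` on the pole in `y`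
  -- also bounds the pole in `x`.
  have h3 := h1 (T + q * (n - T)) (by
    have hq : (1 : ℤ) ≤ q := by exact_mod_cast NeZero.pos q
    have hT0 : (0 : ℤ) ≤ T := Int.natCast_nonneg T
    nlinarith)
  rw [HahnSeries.coeff_single_mul, one_mul, add_sub_cancel_left, ramifyFormal_coeff_mul] at h3
  rw [HahnSeries.coeff_single_mul, one_mul]
  exact h3

variable [IsScalarTower ℂ ConvLaurent M]

/-- The steps of the Deligne filtration of `M`, defined by means of the regular part of the
formalization of `π⁺M`. -/
def deligneStep (b : ℝ) : Submodule (LogOps D) M :=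
  ofStable
    { carrier := {m | embed M q m ∈ E.regularLattice (q * b)}
      add_mem' := fun {m m'} h h' => by
        rw [Set.mem_ofPred_eq, map_add]
        exact add_mem h h'
      zero_mem' := by rw [Set.mem_ofPred_eq, map_zero]; exact zero_mem _
      smul_mem' := fun c m h => by
        rw [Set.mem_ofPred_eq, embed_complex_smul]
        exact complex_smul_mem _ c h }
    (fun m h => by
      have h1 := complex_smul_mem _ (q : ℂ)⁻¹ (E.theta_mem_regularLattice h)
      rwa [embed_theta, smul_smul, inv_mul_cancel₀ (natCast_ne_zero q), one_smul] at h1)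
    (fun a ha m h => by
      change embed M q (a • m) ∈ E.regularLattice (q * b)
      rw [embed_smul]
      exact formal_smul_mem _ (ramify_mem ha) h)

theorem mem_deligneStep {b : ℝ} {m : M} :
    m ∈ deligneStep E b ↔ embed M q m ∈ E.regularLattice (q * b) := Iff.rfl

/-- The Deligne filtration is generated by the parabolic filtration. -/
theorem deligneStep_le {b : ℝ} {X : Submodule (LogOps D) M} (hX : parabolic E b ⊆ X) :
    deligneStep E b ≤ X := by
  intro m hm
  obtain ⟨K, hK⟩ := E.exists_theta_mem
  have hdesc : ∀ n : RamPullback q M,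
      (1 : ℂ⸨X⸩) ⊗ₜ[Ramified q] n ∈ E.parabolicLattice (q * b) → descend q M n ∈ X :=
    fun n hn => hX ((mem_parabolic E).2 (descend_mem q E hn))
  -- The formal vectors approximable to every depth by elements of `N` whose average lies in `X`.
  -- This transfers membership in `X` to the formalization.
  let Z : AddSubmonoid (ℂ⸨X⸩ ⊗[Ramified q] RamPullback q M) :=
    { carrier := {w | ∀ c, ∃ n : RamPullback q M, descend q M n ∈ X ∧
        ∃ p ∈ E.parabolicLattice c, w = (1 : ℂ⸨X⸩) ⊗ₜ[Ramified q] n + p}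
      zero_mem' := fun c => ⟨0, by rw [map_zero]; exact zero_mem _, 0, zero_mem _, by simp⟩
      add_mem' := fun {w w'} h h' c => by
        obtain ⟨n, hn, p, hp, rfl⟩ := h c
        obtain ⟨n', hn', p', hp', rfl⟩ := h' c
        exact ⟨n + n', by rw [map_add]; exact add_mem hn hn', p + p', add_mem hp hp',
          by rw [TensorProduct.tmul_add]; abel⟩ }
  have hZ : ∀ z ∈ Z, (D.ramPullback q).formalization.θ z ∈ Z := by
    intro z hz c
    -- `y∂_y` loses at most `K` in the index, so the approximation is taken at depth `c + K`.
    obtain ⟨n, hn, p, hp, rfl⟩ := hz (c + K)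
    refine ⟨(D.ramPullback q).θ n, ?_, _, add_sub_cancel_right c (K : ℝ) ▸ hK _ p hp, ?_⟩
    · rw [descend_theta]
      exact (toComplex X).smul_mem _ (theta_mem X hn)
    · rw [map_add, formalization_tmul, Derivation.map_one_eq_zero, TensorProduct.zero_tmul,
        zero_add]
  have hP : ∀ z ∈ E.parabolicLattice (q * b), z ∈ Z := by
    intro z hz c
    -- Depth at least `q b` forces `n` itself into the parabolic filtration of `N`, so its average
    -- lies in `X`.
    obtain ⟨n, w, hw, rfl⟩ := exists_eq_tmul_add q E z (max c (q * b))
    refine ⟨n, hdesc n ?_, w, E.parabolicLattice_antitone (le_max_left _ _) hw, rfl⟩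
    exact (Submodule.add_mem_iff_left _
      (E.parabolicLattice_antitone (le_max_right _ _) hw)).1 hz
  -- At depth `q b` the error `1 ⊗ m - n` is in the parabolic filtration of `N`. Its average `m -
  -- descend n` therefore lies in `X`, as does `descend n`.
  obtain ⟨n, hn, p, hp, he⟩ := E.regularLattice_le hZ hP hm (q * b)
  have h1 : (1 : ℂ⸨X⸩) ⊗ₜ[Ramified q] ((1 : Ramified q) ⊗ₜ[ConvLaurent] m + -n) = p := by
    rw [TensorProduct.tmul_add, ← embed_apply, he, add_right_comm, ← TensorProduct.tmul_add,
      add_neg_cancel, TensorProduct.tmul_zero, zero_add]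
  rw [← h1] at hp
  have h2 := hdesc _ hp
  rw [map_add, map_neg, descend_one_tmul] at h2
  simpa using add_mem h2 hn

theorem span_parabolic (b : ℝ) :
    Submodule.span (LogOps D) (parabolic E b) = deligneStep E b := by
  refine le_antisymm (Submodule.span_le.2 fun m hm => ?_) (deligneStep_le E Submodule.subset_span)
  exact E.parabolicLattice_le_regularLattice _ ((mem_parabolic E).1 hm)

theorem deligneStep_antitone : Antitone (deligneStep E) := fun _ _ h _ hm =>
  E.regularLattice_antitone (mul_le_mul_of_nonneg_left h (cast_pos_of_neZero q).le) hm

/-- In a basis `e`, `P^b(M)` contains all `x ^ T i • e i` with large `T i`, and its coordinates have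
poles of order at most `S i`. Modulo the `ℂ{x}`-span of the `x ^ T i • e i`, only a finite
dimensional space of truncations remains. -/
theorem fg_span_parabolic [FiniteDimensional ConvLaurent M] (b : ℝ) :
    (Submodule.span (LogOps D) (parabolic E b)).FG := by
  classical
  let e := Module.finBasis ConvLaurent M
  choose T hT using fun i => exists_mem_parabolic E (e i) b
  choose S hS using fun i => exists_pow_mul_repr_mem E e i b
  -- Truncating `x ^ S i` times the coordinate at order `S i + T i` leaves a remainder divisible by
  -- `x ^ T i` after division by `x ^ S i`.
  choose F hF hFu using fun i => exists_truncation (S i + T i)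
  let G : Submodule ℂ M := ⨆ i, (F i).map
    (LinearMap.toSpanSingleton ConvLaurent M ((coordX ^ S i)⁻¹ • e i) |>.restrictScalars ℂ)
  let P : Submodule ℂ M :=
    { carrier := parabolic E b
      add_mem' := fun {m m'} h h' => by
        rw [mem_parabolic] at *
        rw [map_add]
        exact add_mem h h'
      zero_mem' := by rw [mem_parabolic, map_zero]; exact zero_mem _
      smul_mem' := fun c m h => by
        rw [mem_parabolic] at *
        rw [embed_complex_smul]
        exact complex_smul_mem _ c h }
  have hPu : ∀ a ∈ ConvPower, ∀ m ∈ P, a • m ∈ P := fun a ha m hm => by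
    refine (mem_parabolic E).2 ?_
    rw [embed_smul]
    exact formal_smul_mem _ (ramify_mem ha) ((mem_parabolic E).1 hm)
  have hGP : FiniteDimensional ℂ (G ⊓ P : Submodule ℂ M) := inferInstance
  obtain ⟨s, hs⟩ := (Submodule.fg_iff_finiteDimensional (G ⊓ P)).2 hGP
  have hsP : ∀ m ∈ s, m ∈ P := fun m hm => (hs.le (Submodule.subset_span hm)).2
  refine ⟨s ∪ Finset.univ.image fun i => coordX ^ T i • e i, ?_⟩
  refine le_antisymm (Submodule.span_mono fun m hm => ?_) (Submodule.span_le.2 fun m hm => ?_)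
  · rcases Finset.mem_union.1 hm with h | h
    · exact hsP m h
    · obtain ⟨i, -, rfl⟩ := Finset.mem_image.1 h
      exact hT i _ le_rfl
  set Y := Submodule.span (LogOps D)
    ((s ∪ Finset.univ.image fun i => coordX ^ T i • e i : Finset M) : Set M) with hY
  choose! f hf u hu hfu using hFu
  let a := fun i => coordX ^ S i * e.repr m i
  have ha : ∀ i, a i ∈ ConvPower := fun i => hS i m hm
  let m₁ := ∑ i, u i (a i) • coordX ^ T i • e i
  let m₀ := ∑ i, f i (a i) • (coordX ^ S i)⁻¹ • e i
  have hm₀ : m₀ ∈ G := Submodule.sum_mem _ fun i _ =>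
    Submodule.mem_iSup_of_mem i ⟨f i (a i), hf i _ (ha i), by simp⟩
  have hadd : m = m₀ + m₁ := by
    conv_lhs => rw [← e.sum_repr m]
    rw [← Finset.sum_add_distrib]
    refine Finset.sum_congr rfl fun i _ => ?_
    have h0 : coordX ^ S i ≠ 0 := pow_ne_zero _ coordX_ne_zero
    have h1 : e.repr m i = f i (a i) * (coordX ^ S i)⁻¹ + u i (a i) * coordX ^ T i := by
      refine mul_left_cancel₀ h0 ((hfu i _ (ha i)).trans ?_)
      rw [mul_add, mul_comm (f i (a i)), mul_inv_cancel_left₀ h0, pow_add, mul_assoc,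
        mul_comm (u i (a i))]
    rw [smul_smul, smul_smul, ← add_smul, ← h1]
  have hm₁P : m₁ ∈ P := Submodule.sum_mem _ fun i _ => hPu _ (hu i _ (ha i)) _ (hT i _ le_rfl)
  have hm₁Y : m₁ ∈ Y := Submodule.sum_mem _ fun i _ => conv_smul_mem _ (hu i _ (ha i))
    (Submodule.subset_span (Finset.mem_union_right _ (Finset.mem_image_of_mem _
      (Finset.mem_univ i))))
  have hm₀P : m₀ ∈ P := (Submodule.add_mem_iff_left P hm₁P).1 (hadd ▸ hm)
  have hm₀Y : G ⊓ P ≤ toComplex Y := by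
    rw [← hs, Submodule.span_le]
    exact fun x hx => Submodule.subset_span (Finset.mem_union_left _ hx)
  change m ∈ Y
  rw [hadd]
  exact add_mem (hm₀Y ⟨hm₀, hm₀P⟩) hm₁Y

/-- The kernel of `V^b → Y / A` lies in `V^c`, which dies in `gr^b`. So `gr^b` is a quotient of a
subspace of the finite dimensional image of `F`. -/
theorem finiteDimensional_gr {V : ℝ → Submodule (LogOps D) M} (hV : Antitone V) {b : ℝ}
    {Y : Type*} [AddCommGroup Y] [Module ℂ Y] {F A : Submodule ℂ Y} [FiniteDimensional ℂ F]
    (f : V b →ₗ[ℂ] Y) (hF : ∀ m, f m ∈ F ⊔ A) {c : ℝ} (hc : b < c)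
    (hf : ∀ m : V b, f m ∈ A → (m : M) ∈ V c) : FiniteDimensional ℂ (Gr V b) := by
  let f' : V b →ₗ[ℂ] F.map A.mkQ := (A.mkQ ∘ₗ f).codRestrict (F.map A.mkQ) fun m => by
    have h1 : (F ⊔ A).map A.mkQ = F.map A.mkQ := by
      rw [Submodule.map_sup, Submodule.mkQ_map_self, sup_bot_eq]
    rw [← h1]
    exact ⟨f m, hF m, rfl⟩
  let p : V b →ₗ[ℂ] Gr V b :=
    ((filtGt V b).submoduleOf (V b)).mkQ.restrictScalars ℂ
  have hker : LinearMap.ker f' ≤ LinearMap.ker p := fun m hm => by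
    rw [LinearMap.mem_ker] at hm ⊢
    have h1 : A.mkQ (f m) = 0 := congrArg Subtype.val hm
    exact (Submodule.Quotient.mk_eq_zero ((filtGt V b).submoduleOf (V b))).2
      ((mem_filtGt hV).2 ⟨c, hc, hf m ((Submodule.Quotient.mk_eq_zero A).1 h1)⟩)
  have : FiniteDimensional ℂ (V b ⧸ LinearMap.ker f') :=
    Module.Finite.equiv f'.quotKerEquivRange.symm
  refine Module.Finite.of_surjective ((LinearMap.ker f').liftQ p hker) fun x => ?_
  obtain ⟨m, rfl⟩ := Submodule.Quotient.mk_surjective _ x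
  exact ⟨Submodule.Quotient.mk m, rfl⟩

/-- The component in `R_φ` of the elements of `M`. -/
def component (φ : E.Φ) : M →ₗ[ℂ] E.R φ where
  toFun m := E.iso (embed M q m) φ
  map_add' m m' := by rw [map_add, map_add, Pi.add_apply]
  map_smul' c m := by
    change E.iso (embed M q (c • m)) φ = c • E.iso (embed M q m) φ
    rw [embed_complex_smul, ← algebraMap_smul ℂ⸨X⸩ c (embed M q m), map_smul,
      Pi.smul_apply, algebraMap_smul]

theorem component_theta {φ : E.Φ} (hφ : (φ : Polynomial ℂ) = 0) (m : M) :
    (q : ℂ) • component E φ (D.θ m) = (E.conn φ).θ (component E φ m) := by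
  change (q : ℂ) • E.iso (embed M q (D.θ m)) φ = (E.conn φ).θ (E.iso (embed M q m) φ)
  rw [← E.iso_theta_of_eq_zero hφ, embed_theta,
    ← algebraMap_smul ℂ⸨X⸩ (q : ℂ) (embed M q (D.θ m)), map_smul, Pi.smul_apply, algebraMap_smul]

/-- Only the component of exponent `0` matters: raising `b` by one is multiplication by `y ^ q` on
its lattice. Without the exponent `0`, every step is all of `M`. -/
theorem finiteDimensional_gr_deligneStep (b : ℝ) :
    FiniteDimensional ℂ (Gr (deligneStep E) b) := by
  by_cases h : ∃ φ : E.Φ, (φ : Polynomial ℂ) = 0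
  · obtain ⟨φ, hφ⟩ := h
    obtain ⟨F, hF, -, hLF⟩ := exists_finiteDimensional_sup
      (isLogLattice_deligneLattice (E.regular φ) (q * b)).fg q
    rw [shift_deligneLattice (E.regular φ)] at hLF
    refine finiteDimensional_gr (deligneStep_antitone E)
      (component E φ ∘ₗ (deligneStep E b).subtype.restrictScalars ℂ)
      (fun m => hLF (m.2 φ hφ)) (lt_add_one b) fun m hm ψ hψ => ?_
    obtain rfl : ψ = φ := Subtype.ext (hψ.trans hφ.symm)
    rw [mul_add, mul_one]
    exact hm
  · exact finiteDimensional_gr (deligneStep_antitone E) (F := (⊥ : Submodule ℂ ℂ)) (A := ⊥) 0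
      (fun m => zero_mem _) (lt_add_one b) fun m _ ψ hψ => absurd ⟨ψ, hψ⟩ h

theorem exists_mem_deligneStep_of_eigenvector {b c : ℝ} (hbc : b < c) {m : M} {β : ℂ}
    (hm : m ∈ deligneStep E b) (hc : D.θ m - β • m ∈ deligneStep E c) (hne : β.re ≠ b) :
    ∃ d, b < d ∧ m ∈ deligneStep E d := by
  have hq := cast_pos_of_neZero q
  by_cases h : ∃ φ : E.Φ, (φ : Polynomial ℂ) = 0
  · obtain ⟨φ, hφ⟩ := h
    have h1 : (q : ℂ) • component E φ (D.θ m - β • m) ∈ deligneLattice (E.conn φ) (q * c) :=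
      complex_smul_mem _ (q : ℂ) (hc φ hφ)
    have h2 : (q : ℂ) • component E φ (D.θ m - β • m) =
        (E.conn φ).θ (component E φ m) - (q * β) • component E φ m := by
      rw [map_sub, map_smul, smul_sub, component_theta E hφ, smul_smul]
    rw [h2] at h1
    -- Since `y∂_y = q x∂ₓ`, the eigenvalue becomes `q β` and the index `q b`.
    obtain ⟨d, hd, hmd⟩ := exists_mem_deligneLattice_of_eigenvector (E.regular φ)
      (mul_lt_mul_of_pos_left hbc hq) (hm φ hφ) h1 (by
        rw [← Complex.ofReal_natCast, Complex.re_ofReal_mul]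
        exact fun h => hne (mul_left_cancel₀ hq.ne' h))
    refine ⟨d / q, by rwa [lt_div_iff₀ hq, mul_comm], fun ψ hψ => ?_⟩
    obtain rfl : ψ = φ := Subtype.ext (hψ.trans hφ.symm)
    rwa [mul_div_cancel₀ _ hq.ne']
  · exact ⟨b + 1, lt_add_one b, fun ψ hψ => absurd ⟨ψ, hψ⟩ h⟩

theorem isDeligneFiltration_deligneStep [FiniteDimensional ConvLaurent M] :
    IsDeligneFiltration D (deligneStep E) where
  antitone := deligneStep_antitone E
  exhaustive := by
    rw [eq_top_iff]
    intro m _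
    obtain ⟨c, hc⟩ := E.exists_mem_parabolicLattice (embed M q m)
    refine Submodule.mem_iSup_of_mem (c / q) ?_
    rw [mem_deligneStep, mul_div_cancel₀ _ (cast_pos_of_neZero q).ne']
    exact E.parabolicLattice_le_regularLattice c hc
  left_continuous b := by
    refine le_antisymm (fun m hm => ?_) (le_iInf fun c => deligneStep_antitone E (le_of_lt c.2))
    rw [Submodule.mem_iInf] at hm
    refine E.mem_regularLattice_of_forall_lt fun c hc => ?_
    have hq := cast_pos_of_neZero q
    have h1 := hm ⟨c / q, by rw [Set.mem_Iio, div_lt_iff₀ hq, mul_comm]; exact hc⟩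
    rwa [mem_deligneStep, mul_div_cancel₀ _ hq.ne'] at h1
  fg b := by
    rw [← span_parabolic]
    exact fg_span_parabolic E b
  mul_x b m := by
    have h1 := ramify_coordX_pow (q := q) 1
    have h2 := E.yPow_smul_mem_regularLattice q (q * b) (embed M q m)
    rw [pow_one, Nat.cast_one, mul_one] at h1
    rw [Int.cast_natCast] at h2
    rw [mem_deligneStep, mem_deligneStep, embed_smul, h1, mul_add, mul_one]
    exact h2
  finite_gr := finiteDimensional_gr_deligneStep E
  eigenvalue_re b β hβ := by
    obtain ⟨v, hv⟩ := hβ.exists_hasEigenvector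
    obtain ⟨m, rfl⟩ := Submodule.Quotient.mk_surjective _ v
    have hm0 : (m : M) ∉ filtGt (deligneStep E) b := fun h =>
      hv.2 ((Submodule.Quotient.mk_eq_zero
        ((filtGt (deligneStep E) b).submoduleOf (deligneStep E b))).2 h)
    have hm1 : D.θ m - β • (m : M) ∈ filtGt (deligneStep E) b :=
      (Submodule.Quotient.eq ((filtGt (deligneStep E) b).submoduleOf (deligneStep E b))).1
        (Module.End.mem_eigenspace_iff.1 hv.1)
    obtain ⟨c, hbc, hc⟩ := (mem_filtGt (deligneStep_antitone E)).1 hm1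
    by_contra hne
    exact hm0 ((mem_filtGt (deligneStep_antitone E)).2
      (exists_mem_deligneStep_of_eigenvector E hbc m.2 hc hne))

end Existence

end MeroConn

end

open MeroConn
theorem mainTheorem4 {M : Type*} [AddCommGroup M] [Module ℂ M] [Module ConvLaurent M]
    [IsScalarTower ℂ ConvLaurent M] [FiniteDimensional ConvLaurent M]
    (D : Connection eulerConv M) (q : ℕ) [NeZero q]
    (E : ElementaryModel (D.ramPullback q).formalization) :
    (∃! V : ℝ → Submodule (LogOps D) M, IsDeligneFiltration D V) ∧
    ∀ V : ℝ → Submodule (LogOps D) M, IsDeligneFiltration D V →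
      ∀ b : ℝ, Submodule.span (LogOps D) (parabolic E b) = V b := by
  have hE := isDeligneFiltration_deligneStep E
  refine ⟨⟨_, hE, fun V hV => hV.unique hE⟩, fun V hV b => ?_⟩
  -- Any Deligne filtration is `deligneStep E`, for which the generation statement is already known.
  rw [hV.unique hE, span_parabolic]
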